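/- **Theorem (Purity for pseudorepresentations).** Let $p\neq \ell$ be primes, $K$ a finite extension of $\mathbb{Q}_\ell$, $q$ the cardinality of its residue field, $W_K$ its Weil group, $I_K$ its inertia group, $v_K: W_K\to\mathbb{Z}$ the map with $\sigma|_{K^{ur}}=\mathrm{Fr}^{v_K(\sigma)}$ ($\mathrm{Fr}$ the geometric Frobenius), and $\phi\in W_K$ a fixed element with $v_K(\phi)=1$. The Artin map is normalized so that uniformizers go to lifts of $\mathrm{Fr}$; thus $|\mathrm{Art}_K^{-1}|_K(\sigma)=q^{-v_K(\sigma)}$. For a domain $A$ put $\overline Q(A)=\overline{\mathrm{Frac}(A)}$ and let $A^{intal}$ be the integral closure of $A$ in $\overline Q(A)$. A lift of a ring homomorphism $g:A\to B$ of domains is a homomorphism $g^\dag:A^{intal}\to B^{intal}$ extending $g$ (if $B$ is an algebraically closed field, $B^{intal}=B$); it extends uniquely to $A^{intal}[1/p]\to B^{intal}[1/p]$ if $p\ne 0$ in $B$, and this extension is denoted by the same symbol. A Weil–Deligne representation over a domain $A$ of characteristic zero is a pair $(r,N)$ of a homomorphism $r:W_K\to \mathrm{GL}_n(A)$ with $r(I_K)$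 finite and a nilpotent matrix $N$ with $r(\sigma)Nr(\sigma)^{-1}=q^{-v_K(\sigma)}N$ over $A[1/\ell]$ for all $\sigma$. Over an algebraically closed field of characteristic zero, $(\cdot)^{Frss}$ denotes Frobenius-semisimplification, and $\mathrm{Sp}_t(r)$ is $\bigoplus_{j=0}^{t-1} r|\mathrm{Art}_K^{-1}|_K^{j}$ with $N$ mapping the $j$-th summand isomorphically to the $(j+1)$-st and killing the last. A Weil–Deligne representation over $\overline{\mathbb{Q}}_p$ is pure if for some $w\in\mathbb{Z}$ and every $k$ the eigenvalues of $\phi$ on the $k$-th graded piece of the monodromy filtration of its Frobenius-semisimplification are $q$-Weil numbers of weight $w+k$. A representation of $W_K$ over a domain $A$ is irreducible Frobenius-semisimple if over $\overline Q(A)$ it is irreducible with $\phi$ acting semisimply, and $I_K$ has finite image. Let $\mathscr{O}$ be a domain containing $\mathbb{Z}_p$ as a subalgebra and $T:W_K\to\mathscr{O}$ a pseudorepresentation of dimension $n\ge 1$, with characteristic polynomials $P_{\sigma,T}(X)\in\mathscr{O}[1/n!][X]$. Let $\mathcal{O}$ be a domain over $\mathbb{Z}_p$, $\mathrm{res}:\mathscr{O}\hookrightarrow\mathcal{O}$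 an injective $\mathbb{Z}_p$-algebra homomorphism, and $(r,N)$ a Weil–Deligne representation of rank $n$ over $\mathcal{O}[1/p]$ with $\mathrm{res}\circ T=\mathrm{tr}\, r$, such that $f\circ(r,N)$ is pure for some $\mathbb{Z}_p$-algebra homomorphism $f:\mathcal{O}\to\overline{\mathbb{Q}}_p$. Then there are positive integers $m$, $t_1\le\dots\le t_m$ and irreducible Frobenius-semisimple representations $r_1,\dots,r_m$ of $W_K$ over $\mathscr{O}^{intal}[1/p]$ such that: 1. $T=\sum_{i=1}^m\sum_{j=1}^{t_i}\mathrm{tr}\,(r_i|\mathrm{Art}_K^{-1}|_K^{j-1})$. 2. For every domain $\mathcal{O}'$ over $\mathbb{Z}_p$ and every Weil–Deligne representation $(r',N')$ of rank $n$ over $\mathcal{O}'[1/p]$ such that $\mathrm{res}'\circ T=\mathrm{tr}\,r'$ for an injective $\mathbb{Z}_p$-algebra homomorphism $\mathrm{res}':\mathscr{O}\hookrightarrow\mathcal{O}'$ and $f'\circ(r',N')$ is pure for a $\mathbb{Z}_p$-algebra homomorphism $f':\mathcal{O}'\to\overline{\mathbb{Q}}_p$, and for all lifts $\mathrm{res}'^\dag$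 of $\mathrm{res}'$ and $f'^\dag$ of $f'$, there are isomorphisms $$((r',N')\otimes_{\mathcal{O}'}\overline Q(\mathcal{O}'))^{Frss}\simeq\bigoplus_{i=1}^m\mathrm{Sp}_{t_i}(\mathrm{res}'^\dag\circ r_i),\qquad (f'\circ(r',N'))^{Frss}\simeq\bigoplus_{i=1}^m\mathrm{Sp}_{t_i}(f'^\dag\circ\mathrm{res}'^\dag\circ r_i).$$ 3. Suppose $P_{\phi,T}(X)$ has coefficients in $\mathscr{O}^{intal}\cap\mathscr{O}[1/n!]$, and let $i$ be such that $r_i$ is a character. Then $r_i(\sigma)\in\mathscr{O}^{intal}$ for all $\sigma\in W_K$ with $v_K(\sigma)\ge 0$; if moreover $P_{\phi^{-1},T}(X)$ has coefficients in $\mathscr{O}^{intal}\cap\mathscr{O}[1/n!]$, then $r_i$ has values in $\mathscr{O}^{intal}$. Moreover, if $M$, $s_1\le\dots\le s_M$ are positive integers and $R_1,\dots,R_M$ are irreducible Frobenius-semisimple representations of $W_K$ over $\mathscr{O}^{intal}[1/p]$ such that (1) and (2) hold with $M,s_i,R_i$ in place of $m,t_i,r_i$, then $M=m$, $s_i=t_i$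 for all $i$, and there is a permutation $\sigma$ of $\{1,\dots,m\}$ such that $r_{\sigma(i)}\simeq R_i$ over $\overline Q(\mathscr{O})$ for all $i$ and $\sigma$ preserves each block $\{a,\dots,b\}$ of indices on which $t$ takes a constant value (that is, $t_{\sigma(i)}=t_i$ for all $i$). -/

import Mathlib

universe u v w

noncomputable section

section Weil

variable (ℓ : ℕ) [Fact ℓ.Prime]

section Integers

variable (L : Type*) [Field L] [Algebra ℚ_[ℓ] L] [Algebra.IsAlgebraic ℚ_[ℓ] L]

/-- The ring of integers of an algebraic extension `L` of `ℚ_ℓ`: the elements whose absolute value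
(the unique extension of the `ℓ`-adic one) is at most one. -/
def ringOfInt : ValuationSubring L where
  carrier := {x | spectralNorm ℚ_[ℓ] L x ≤ 1}
  mul_mem' {x y} hx hy := by
    have h : spectralNorm ℚ_[ℓ] L (x * y) = spectralNorm ℚ_[ℓ] L x * spectralNorm ℚ_[ℓ] L y :=
      map_mul (spectralMulAlgNorm ℚ_[ℓ] L) x y
    simp only [Set.mem_ofPred_eq] at *
    rw [h]
    exact mul_le_one₀ hx (spectralNorm_nonneg y) hy
  one_mem' := by simp [spectralNorm_one]
  add_mem' {x y} hx hy := (isNonarchimedean_spectralNorm x y).trans (max_le hx hy)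
  zero_mem' := by simp [spectralNorm_zero]
  neg_mem' {x} hx := by
    simpa [spectralNorm_neg (Algebra.IsAlgebraic.isAlgebraic x)] using hx
  mem_or_inv_mem' x := by
    have h : spectralNorm ℚ_[ℓ] L x⁻¹ = (spectralNorm ℚ_[ℓ] L x)⁻¹ := by
      let := spectralNorm.normedField ℚ_[ℓ] L
      exact norm_inv x
    by_cases hx : spectralNorm ℚ_[ℓ] L x ≤ 1
    · exact Or.inl hx
    · right
      simp only [Set.mem_ofPred_eq]
      rw [h]
      exact inv_le_one_of_one_le₀ (le_of_lt (not_le.mp hx))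

theorem mem_ringOfInt (x : L) : x ∈ ringOfInt ℓ L ↔ spectralNorm ℚ_[ℓ] L x ≤ 1 := Iff.rfl

/-- The residue field of the ring of integers. -/
abbrev ResField : Type _ := IsLocalRing.ResidueField (ringOfInt ℓ L)

theorem residue_eq_zero_of_lt (x : ringOfInt ℓ L) (hx : spectralNorm ℚ_[ℓ] L (x : L) < 1) :
    IsLocalRing.residue (ringOfInt ℓ L) x = 0 := by
  rw [IsLocalRing.residue_eq_zero_iff, IsLocalRing.mem_maximalIdeal, mem_nonunits_iff]
  rintro ⟨u, rfl⟩
  have h : spectralNorm ℚ_[ℓ] L ((u : ringOfInt ℓ L) : L)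
      * spectralNorm ℚ_[ℓ] L (((u⁻¹ : (ringOfInt ℓ L)ˣ) : ringOfInt ℓ L) : L) = 1 := by
    have := map_mul (spectralMulAlgNorm ℚ_[ℓ] L) ((u : ringOfInt ℓ L) : L)
      (((u⁻¹ : (ringOfInt ℓ L)ˣ) : ringOfInt ℓ L) : L)
    have h2 : ((u : ringOfInt ℓ L) : L) * (((u⁻¹ : (ringOfInt ℓ L)ˣ) : ringOfInt ℓ L) : L) = 1 :=
      congrArg (Subtype.val) u.mul_inv
    rw [h2] at this
    simp only [spectralMulAlgNorm_def, spectralNorm_one] at this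
    exact this.symm
  have h3 : spectralNorm ℚ_[ℓ] L (((u⁻¹ : (ringOfInt ℓ L)ˣ) : ringOfInt ℓ L) : L) ≤ 1 :=
    ((u⁻¹ : (ringOfInt ℓ L)ˣ) : ringOfInt ℓ L).2
  nlinarith [spectralNorm_nonneg (K := ℚ_[ℓ]) ((u : ringOfInt ℓ L) : L),
    spectralNorm_nonneg (K := ℚ_[ℓ]) (((u⁻¹ : (ringOfInt ℓ L)ˣ) : ringOfInt ℓ L) : L)]

instance : CharP (ResField ℓ L) ℓ := by
  have h0 : ((ℓ : ℕ) : ResField ℓ L) = 0 := by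
    have h := residue_eq_zero_of_lt ℓ L (ℓ : ringOfInt ℓ L) (by
      have h1 : (((ℓ : ℕ) : ringOfInt ℓ L) : L) = algebraMap ℚ_[ℓ] L (ℓ : ℚ_[ℓ]) := by simp
      rw [h1, spectralNorm_extends]
      exact Padic.norm_p_lt_one)
    simpa using h
  exact (CharP.charP_iff_prime_eq_zero (Fact.out : ℓ.Prime)).mpr h0

instance [FiniteDimensional ℚ_[ℓ] L] : Finite (ResField ℓ L) := by
  let := spectralNorm.normedField ℚ_[ℓ] L
  let := spectralNorm.normedAlgebra ℚ_[ℓ] L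
  have : ProperSpace L := FiniteDimensional.proper ℚ_[ℓ] L
  obtain ⟨t, hts, htf, hc⟩ :=
    (isCompact_closedBall (0 : L) 1).finite_cover_balls (e := 1) one_pos
  have hmem : ∀ y ∈ t, y ∈ ringOfInt ℓ L := fun y hy => by
    have := hts hy
    rw [mem_closedBall_zero_iff] at this
    exact this
  have := htf.to_subtype
  refine Finite.of_surjective
    (fun y : t => IsLocalRing.residue (ringOfInt ℓ L) ⟨y.1, hmem y.1 y.2⟩) ?_
  intro z
  obtain ⟨x, rfl⟩ := IsLocalRing.residue_surjective z
  have hx : (x : L) ∈ Metric.closedBall (0 : L) 1 := by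
    rw [mem_closedBall_zero_iff]; exact x.2
  obtain ⟨y, hy, hxy⟩ := Set.mem_iUnion₂.mp (hc hx)
  refine ⟨⟨y, hy⟩, ?_⟩
  rw [← sub_eq_zero, ← map_sub]
  apply residue_eq_zero_of_lt
  rw [Metric.mem_ball, dist_comm, dist_eq_norm] at hxy
  exact hxy

instance [IsAlgClosed L] : IsAlgClosed (ResField ℓ L) := by
  refine IsAlgClosed.of_exists_root _ fun g hg hirr => ?_
  obtain ⟨G, hG, hdeg, hGm⟩ := Polynomial.lifts_and_natDegree_eq_and_monic
    (Polynomial.mem_lifts_of_surjective (IsLocalRing.residue_surjective (R := ringOfInt ℓ L)) g) hg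
  obtain ⟨y, hy⟩ := IsAlgClosed.exists_root (G.map (algebraMap (ringOfInt ℓ L) L)) (by
    rw [Polynomial.degree_map_eq_of_injective (IsFractionRing.injective (ringOfInt ℓ L) L),
      Polynomial.degree_eq_natDegree hGm.ne_zero, hdeg]
    exact_mod_cast hirr.natDegree_pos.ne')
  have hint : IsIntegral (ringOfInt ℓ L) y := ⟨G, hGm, by
    rw [Polynomial.eval₂_eq_eval_map]; exact hy⟩
  obtain ⟨z, rfl⟩ := IsIntegrallyClosed.isIntegral_iff.mp hint
  refine ⟨IsLocalRing.residue _ z, ?_⟩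
  rw [Polynomial.IsRoot.def, Polynomial.eval_map_algebraMap, Polynomial.aeval_algebraMap_apply] at hy
  have hz : Polynomial.eval z G = 0 := by
    apply IsFractionRing.injective (ringOfInt ℓ L) L
    rw [map_zero, ← hy, Polynomial.coe_aeval_eq_eval]
  rw [← hG, Polynomial.eval_map_apply, hz, map_zero]

end Integers

section Field

variable (K : Type*) [Field K] [Algebra ℚ_[ℓ] K] [FiniteDimensional ℚ_[ℓ] K]

instance : Algebra.IsAlgebraic ℚ_[ℓ] (AlgebraicClosure K) :=
  Algebra.IsAlgebraic.trans ℚ_[ℓ] K (AlgebraicClosure K)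

/-- The cardinality `q` of the residue field of `K`. -/
def resCard : ℕ := Nat.card (ResField ℓ K)

theorem exists_resCard_eq : ∃ f : ℕ, f ≠ 0 ∧ resCard ℓ K = ℓ ^ f := by
  have := Fintype.ofFinite (ResField ℓ K)
  obtain ⟨f, -, hf⟩ := FiniteField.card (ResField ℓ K) ℓ
  exact ⟨f, f.ne_zero, by rw [resCard, Nat.card_eq_fintype_card, hf]⟩

/-- The ring endomorphism `x ↦ x ^ q` of the residue field of `K̄`. -/
def powFrob : ResField ℓ (AlgebraicClosure K) →+* ResField ℓ (AlgebraicClosure K) where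
  toFun x := x ^ resCard ℓ K
  map_one' := one_pow _
  map_mul' x y := mul_pow x y _
  map_zero' := zero_pow (by
    obtain ⟨f, -, hf⟩ := exists_resCard_eq ℓ K
    rw [hf]; exact pow_ne_zero _ (Fact.out : ℓ.Prime).ne_zero)
  map_add' x y := by
    obtain ⟨f, -, hf⟩ := exists_resCard_eq ℓ K
    rw [hf]; exact add_pow_char_pow x y ℓ f

/-- The arithmetic Frobenius automorphism `x ↦ x ^ q` of the residue field of `K̄`, which is an
algebraic closure of the residue field of `K`. -/
def arithFrob : RingAut (ResField ℓ (AlgebraicClosure K)) :=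
  RingEquiv.ofBijective (powFrob ℓ K) ⟨(powFrob ℓ K).injective, fun y => by
    obtain ⟨f, hf0, hf⟩ := exists_resCard_eq ℓ K
    have hq : 0 < resCard ℓ K := by
      rw [hf]; exact pow_pos (Fact.out : ℓ.Prime).pos _
    exact IsAlgClosed.exists_pow_nat_eq y hq⟩

theorem arithFrob_apply (x : ResField ℓ (AlgebraicClosure K)) :
    arithFrob ℓ K x = x ^ resCard ℓ K := rfl

/-- The geometric Frobenius automorphism `Fr_k` of the residue field of `K̄`. -/
def geomFrob : RingAut (ResField ℓ (AlgebraicClosure K)) := (arithFrob ℓ K)⁻¹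

theorem geomFrob_zpow_injective :
    Function.Injective fun n : ℤ => geomFrob ℓ K ^ n := by
  rw [injective_zpow_iff_not_isOfFinOrder, geomFrob, isOfFinOrder_inv_iff,
    isOfFinOrder_iff_pow_eq_one]
  rintro ⟨n, hn, h⟩
  obtain ⟨f, hf0, hf⟩ := exists_resCard_eq ℓ K
  have hpow : ∀ (m : ℕ) (x : ResField ℓ (AlgebraicClosure K)),
      (arithFrob ℓ K ^ m) x = x ^ (resCard ℓ K ^ m) := by
    intro m x
    induction m generalizing x with
    | zero => simp
    | succ m ih => rw [pow_succ, RingAut.mul_apply, ih, arithFrob_apply, ← pow_mul, ← pow_succ']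
  have hq : 1 < resCard ℓ K ^ n := by
    rw [hf, ← pow_mul]
    exact Nat.one_lt_pow (by positivity) (Fact.out : ℓ.Prime).one_lt
  have hall : ∀ x : ResField ℓ (AlgebraicClosure K), x ^ (resCard ℓ K ^ n) = x := by
    intro x; rw [← hpow, h]; rfl
  refine (FiniteField.X_pow_card_sub_X_ne_zero (ResField ℓ (AlgebraicClosure K)) hq) ?_
  refine Polynomial.funext fun x => ?_
  simp [hall x]

/-- The action of `G_K = Gal(K̄/K)` on the ring of integers of `K̄`. -/
def galActInt : Gal(AlgebraicClosure K/K) →* RingAut (ringOfInt ℓ (AlgebraicClosure K)) where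
  toFun σ :=
    { toFun x := ⟨σ x, by
        have h := spectralNorm_eq_of_equiv (K := ℚ_[ℓ]) (σ.restrictScalars ℚ_[ℓ])
          (x : AlgebraicClosure K)
        exact (mem_ringOfInt ℓ _ _).mpr (h ▸ x.2)⟩
      invFun x := ⟨σ⁻¹ x, by
        have h := spectralNorm_eq_of_equiv (K := ℚ_[ℓ]) (σ⁻¹.restrictScalars ℚ_[ℓ])
          (x : AlgebraicClosure K)
        exact (mem_ringOfInt ℓ _ _).mpr (h ▸ x.2)⟩
      left_inv x := Subtype.ext (σ.symm_apply_apply _)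
      right_inv x := Subtype.ext (σ.apply_symm_apply _)
      map_mul' x y := Subtype.ext (map_mul σ _ _)
      map_add' x y := Subtype.ext (map_add σ _ _) }
  map_one' := rfl
  map_mul' _ _ := rfl

/-- The action of `G_K` on the residue field of `K̄`. -/
def galActRes : Gal(AlgebraicClosure K/K) →* RingAut (ResField ℓ (AlgebraicClosure K)) :=
  IsLocalRing.ResidueField.mapAut.comp (galActInt ℓ K)

/-- The Weil group `W_K`: the elements of `G_K` that act on the residue field of `K̄` as an integral
power of the geometric Frobenius. -/
def weilGroup : Subgroup Gal(AlgebraicClosure K/K) :=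
  (Subgroup.zpowers (geomFrob ℓ K)).comap (galActRes ℓ K)

/-- `v_K : W_K → ℤ`, characterised by `σ = Fr_k ^ v_K(σ)` on the residue field of `K̄`. -/
def weilVal (σ : weilGroup ℓ K) : ℤ :=
  Classical.choose (Subgroup.mem_zpowers_iff.mp (Subgroup.mem_comap.mp σ.2))

theorem geomFrob_zpow_weilVal (σ : weilGroup ℓ K) :
    geomFrob ℓ K ^ weilVal ℓ K σ = galActRes ℓ K σ :=
  Classical.choose_spec (Subgroup.mem_zpowers_iff.mp (Subgroup.mem_comap.mp σ.2))

theorem weilVal_mul (σ τ : weilGroup ℓ K) :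
    weilVal ℓ K (σ * τ) = weilVal ℓ K σ + weilVal ℓ K τ := by
  apply geomFrob_zpow_injective ℓ K
  simp only
  rw [zpow_add, geomFrob_zpow_weilVal, geomFrob_zpow_weilVal, geomFrob_zpow_weilVal]
  simp

/-- The inertia group `I_K`: the elements of `W_K` acting trivially on the residue field of `K̄`. -/
def inertiaGroup : Subgroup (weilGroup ℓ K) := ((galActRes ℓ K).comp (weilGroup ℓ K).subtype).ker

end Field

/-! ### Weil-Deligne representations -/

section WeilDeligne

variable (K : Type*) [Field K] [Algebra ℚ_[ℓ] K] [FiniteDimensional ℚ_[ℓ] K]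

/-- The underlying data `(r, N)` of a Weil-Deligne representation in matrix form: a representation
of `W_K` and an endomorphism of `A ^ ι`. (A homomorphism from a group to the monoid of matrices is
the same as a homomorphism to the general linear group.) -/
structure WDData (ι : Type*) [Fintype ι] [DecidableEq ι] (A : Type*) [CommRing A] where
  r : weilGroup ℓ K →* Matrix ι ι A
  N : Matrix ι ι A

variable {ℓ K}

/-- Extension of scalars of a matrix representation. -/
def repMap {ι : Type*} [Fintype ι] [DecidableEq ι] {A B : Type*} [CommRing A] [CommRing B]
    (g : A →+* B) (r : weilGroup ℓ K →* Matrix ι ι A) : weilGroup ℓ K →* Matrix ι ι B :=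
  (g.mapMatrix : Matrix ι ι A →+* Matrix ι ι B).toMonoidHom.comp r

namespace WDData

variable {ι κ : Type*} [Fintype ι] [DecidableEq ι] [Fintype κ] [DecidableEq κ]

/-- Extension of scalars along a ring homomorphism. -/
def map {A B : Type*} [CommRing A] [CommRing B] (g : A →+* B) (ρ : WDData ℓ K ι A) :
    WDData ℓ K ι B where
  r := repMap g ρ.r
  N := ρ.N.map g

/-- `(r, N)` is a Weil-Deligne representation over the domain `A` of characteristic zero: `N` is
nilpotent, `r(I_K)` is finite, and `r(σ) N r(σ)⁻¹ = q ^ (-v_K(σ)) N` over `A[1/ℓ]`. The last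
relation is written without denominators, as `q ^ (v⁺) r(σ) N = q ^ (v⁻) N r(σ)`, where
`v_K(σ) = v⁺ - v⁻` with `v⁺ = max (v_K(σ)) 0` and `v⁻ = max (-v_K(σ)) 0`. -/
structure IsWeilDeligne {A : Type*} [CommRing A] (ρ : WDData ℓ K ι A) : Prop where
  nilpotent : IsNilpotent ρ.N
  finite_inertia : (ρ.r '' (inertiaGroup ℓ K : Set (weilGroup ℓ K))).Finite
  relation : ∀ σ : weilGroup ℓ K,
    ((resCard ℓ K : A) ^ (weilVal ℓ K σ).toNat) • (ρ.r σ * ρ.N) =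
      ((resCard ℓ K : A) ^ (-weilVal ℓ K σ).toNat) • (ρ.N * ρ.r σ)

/-- Isomorphism of Weil-Deligne representations: an invertible matrix intertwining both the
actions of `W_K` and the monodromy operators. -/
def Iso {A : Type*} [CommRing A] (ρ : WDData ℓ K ι A) (ρ' : WDData ℓ K κ A) : Prop :=
  ∃ (P : Matrix ι κ A) (Q : Matrix κ ι A), P * Q = 1 ∧ Q * P = 1 ∧
    (∀ σ, ρ.r σ * P = P * ρ'.r σ) ∧ ρ.N * P = P * ρ'.N

/-- `Sp_t(r)` over a field: on the `j`-th copy of `r` (`0 ≤ j < t`), `W_K` acts through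
`r ⊗ |Art_K⁻¹|_K ^ j`, and `N` maps the `j`-th copy identically to the `(j+1)`-st, and kills the
last one. Since `Art_K` sends uniformizers to lifts of the geometric Frobenius,
`|Art_K⁻¹(σ)|_K = q ^ (-v_K(σ))`. -/
def sp {F : Type*} [Field F] (t : ℕ) (r : weilGroup ℓ K →* Matrix ι ι F)
    (hq : (resCard ℓ K : F) ≠ 0) : WDData ℓ K (ι × Fin t) F where
  r :=
    { toFun σ := Matrix.blockDiagonal fun j : Fin t =>
        ((resCard ℓ K : F) ^ (-weilVal ℓ K σ)) ^ (j : ℕ) • r σ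
      map_one' := by
        have h : weilVal ℓ K (1 : weilGroup ℓ K) = 0 := by
          have := weilVal_mul ℓ K 1 1
          rw [one_mul] at this; omega
        simp only [h, neg_zero, zpow_zero, one_pow, map_one, one_smul]
        exact Matrix.blockDiagonal_one
      map_mul' σ τ := by
        rw [← Matrix.blockDiagonal_mul]
        congr 1
        funext j
        rw [weilVal_mul, neg_add, zpow_add₀ hq, mul_pow, map_mul, smul_mul_smul_comm] }
  N := Matrix.of fun x y => if x.1 = y.1 ∧ (x.2 : ℕ) = y.2 + 1 then 1 else 0

/-- The direct sum of Weil-Deligne representations. -/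
def directSum {A : Type*} [CommRing A] {m : ℕ} {β : Fin m → Type*} [∀ i, Fintype (β i)]
    [∀ i, DecidableEq (β i)] (ρ : ∀ i, WDData ℓ K (β i) A) : WDData ℓ K (Σ i, β i) A where
  r :=
    { toFun σ := Matrix.blockDiagonal' fun i => (ρ i).r σ
      map_one' := by simp only [map_one]; exact Matrix.blockDiagonal'_one
      map_mul' σ τ := by simp only [map_mul]; exact Matrix.blockDiagonal'_mul _ _ }
  N := Matrix.blockDiagonal' fun i => (ρ i).N

/-- `ρ'` is the Frobenius-semisimplification of `ρ = (r, N)` with respect to the lift `φ` of the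
geometric Frobenius: if `r(φ) = s u = u s` with `s` semisimple and `u` unipotent (the
multiplicative Jordan decomposition), then `ρ' = (r', N)` with `r'(σ) = r(σ) u ^ (-v_K(σ))`. -/
def IsFrobSemisimplification {F : Type*} [Field F] (φ : weilGroup ℓ K) (ρ ρ' : WDData ℓ K ι F) :
    Prop :=
  ∃ (s : Matrix ι ι F) (u : (Matrix ι ι F)ˣ),
    ρ.r φ = s * u ∧ ρ.r φ = u * s ∧
    Module.End.IsSemisimple (Matrix.toLin' s) ∧ IsNilpotent ((u : Matrix ι ι F) - 1) ∧
    (∀ σ, ρ'.r σ = ρ.r σ * ((u ^ (-weilVal ℓ K σ) : (Matrix ι ι F)ˣ) : Matrix ι ι F)) ∧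
    ρ'.N = ρ.N

end WDData

/-- Isomorphism of matrix representations of `W_K`. -/
def RepIso {ι κ : Type*} [Fintype ι] [DecidableEq ι] [Fintype κ] [DecidableEq κ]
    {A : Type*} [CommRing A] (r : weilGroup ℓ K →* Matrix ι ι A)
    (r' : weilGroup ℓ K →* Matrix κ κ A) : Prop :=
  ∃ (P : Matrix ι κ A) (Q : Matrix κ ι A), P * Q = 1 ∧ Q * P = 1 ∧ ∀ σ, r σ * P = P * r' σ

/-- A matrix representation over a field, as a representation on the space of column vectors. -/
def toRepresentation {ι : Type*} [Fintype ι] [DecidableEq ι] {F : Type*} [Field F]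
    (r : weilGroup ℓ K →* Matrix ι ι F) : Representation F (weilGroup ℓ K) (ι → F) :=
  ((Matrix.toLinAlgEquiv' : Matrix ι ι F ≃ₐ[F] ((ι → F) →ₗ[F] (ι → F))) :
    Matrix ι ι F →* ((ι → F) →ₗ[F] (ι → F))).comp r

/-- Irreducible Frobenius-semisimple representations over an algebraically closed field. -/
structure IsIrreducibleFrobSemisimple {ι : Type*} [Fintype ι] [DecidableEq ι] {F : Type*} [Field F]
    (φ : weilGroup ℓ K) (r : weilGroup ℓ K →* Matrix ι ι F) : Prop where
  irreducible : (toRepresentation r).IsIrreducible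
  semisimple : Module.End.IsSemisimple (Matrix.toLin' (r φ))
  finite_inertia : (r '' (inertiaGroup ℓ K : Set (weilGroup ℓ K))).Finite

/-! ### Purity -/

/-- The monodromy filtration of a nilpotent endomorphism `N`,
`M_k = ∑_{a - b = k} ker N ^ (a + 1) ∩ im N ^ b` (with `a, b ≥ 0`): the unique finite increasing
filtration such that `N M_k ⊆ M_{k-2}` and `N ^ k` induces isomorphisms `Gr_k ≅ Gr_{-k}`. -/
def monodromyFiltration {F V : Type*} [Field F] [AddCommGroup V] [Module F V]
    (N : V →ₗ[F] V) (k : ℤ) : Submodule F V :=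
  ⨆ (a : ℕ) (b : ℕ) (_ : (a : ℤ) - b = k), LinearMap.ker (N ^ (a + 1)) ⊓ LinearMap.range (N ^ b)

/-- `x` is a `q`-Weil number of weight `w`: it is algebraic over `ℚ`, `q ^ n x` is an algebraic
integer for some `n`, and every complex conjugate of `x` has absolute value `q ^ (w / 2)`. -/
structure IsWeilNumber {F : Type*} [Field F] [CharZero F] (q : ℕ) (w : ℤ) (x : F) : Prop where
  algebraic : IsAlgebraic ℚ x
  integral : ∃ n : ℕ, IsIntegral ℤ ((q : F) ^ n * x)
  norm_eq : ∀ z : ℂ, Polynomial.aeval z (minpoly ℚ x) = 0 → ‖z‖ = (q : ℝ) ^ ((w : ℝ) / 2)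

/-- Purity of weight `w` of a Frobenius-semisimple Weil-Deligne representation: for all `k`, every
eigenvalue `α` of `φ` on `Gr_k = M_k / M_{k-1}`, where `M` is the monodromy filtration, is a
`q`-Weil number of weight `w + k`. The eigenvalue condition is written for a representative
`x ∈ M_k \ M_{k-1}` of an eigenvector. -/
def WDData.IsPureOfWeight {ι : Type*} [Fintype ι] [DecidableEq ι] {F : Type*} [Field F]
    [CharZero F] (φ : weilGroup ℓ K) (w : ℤ) (ρ : WDData ℓ K ι F) : Prop :=
  ∀ (k : ℤ) (α : F), ∀ x ∈ monodromyFiltration (Matrix.toLin' ρ.N) k,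
    x ∉ monodromyFiltration (Matrix.toLin' ρ.N) (k - 1) →
    (Matrix.toLin' (ρ.r φ) x - α • x) ∈ monodromyFiltration (Matrix.toLin' ρ.N) (k - 1) →
    IsWeilNumber (resCard ℓ K) (w + k) α

/-- A Weil-Deligne representation is pure if its Frobenius-semisimplification is pure of some
integral weight. -/
def WDData.IsPure {ι : Type*} [Fintype ι] [DecidableEq ι] {F : Type*} [Field F]
    [CharZero F] (φ : weilGroup ℓ K) (ρ : WDData ℓ K ι F) : Prop :=
  ∃ ρ' : WDData ℓ K ι F, WDData.IsFrobSemisimplification φ ρ ρ' ∧ ∃ w : ℤ, ρ'.IsPureOfWeight φ w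

end WeilDeligne

end Weil

/-! ### Pseudorepresentations -/

section Pseudo

variable {G A : Type*} [Group G] [CommRing A]

/-- `T_σ(g_1, …, g_k)`: the product over the cycles `(i, σ i, σ² i, …)` of `σ` (fixed points
included) of `T (g_i g_{σ i} g_{σ² i} ⋯)`. Each cycle is written starting from its least element. -/
def cycleTrace (T : G → A) {k : ℕ} (σ : Equiv.Perm (Fin k)) (g : Fin k → G) : A :=
  open scoped Classical in
  ∏ i : Fin k with ∀ j : ℕ, i ≤ (σ ^ j) i,
    T (List.ofFn fun j : Fin (Function.minimalPeriod σ i) => g ((σ ^ (j : ℕ)) i)).prod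

/-- `S_k(T)(g_1, …, g_k) = ∑_σ sgn(σ) T_σ(g_1, …, g_k)`, the sum over all permutations. -/
def pseudoSum (T : G → A) (k : ℕ) (g : Fin k → G) : A :=
  ∑ σ : Equiv.Perm (Fin k), ((Equiv.Perm.sign σ : ℤ) : A) * cycleTrace T σ g

/-- `T : G → A` is a pseudorepresentation of dimension `n` (with `A` of characteristic zero). -/
structure IsPseudorep (T : G → A) (n : ℕ) : Prop where
  map_one : T 1 = n
  map_mul_comm : ∀ g h, T (g * h) = T (h * g)
  pseudoSum_eq_zero : ∀ g : Fin (n + 1) → G, pseudoSum T (n + 1) g = 0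

/-- The characteristic polynomial
`P_{x, T}(X) = ∑_{k = 0}^n ((-1) ^ k / k!) S_k(T)(x, …, x) X ^ (n - k)` of `x` for a
pseudorepresentation `T` of dimension `n` with values in a domain `A`. Its coefficients lie in
`A[1/n!]`, and it is regarded as a polynomial over the fraction field of `A`. -/
def pseudoCharpoly [IsDomain A] (T : G → A) (n : ℕ) (x : G) : Polynomial (FractionRing A) :=
  ∑ k ∈ Finset.range (n + 1), Polynomial.monomial (n - k)
    ((-1) ^ k * ((k.factorial : FractionRing A))⁻¹ *
      algebraMap A (FractionRing A) (pseudoSum T k fun _ => x))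

end Pseudo

/-! ### Coefficient rings -/

section Coefficients

/-- `Q̄(A)`, the algebraic closure of the fraction field of a domain `A`. -/
abbrev QBar (A : Type*) [CommRing A] [IsDomain A] : Type _ := AlgebraicClosure (FractionRing A)

/-- The integral closure of the domain `A` in `Q̄(A)`. -/
abbrev Intal (A : Type*) [CommRing A] [IsDomain A] : Type _ := integralClosure A (QBar A)

variable (p : ℕ)

/-- `A[1/p]`. -/
abbrev InvP (A : Type*) [CommRing A] : Type _ := Localization.Away (p : A)

/-- The map `A[1/p] → B[1/p]` extending `f : A → B`. -/
def invMap {A B : Type*} [CommRing A] [CommRing B] (f : A →+* B) : InvP p A →+* InvP p B :=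
  IsLocalization.Away.lift (p : A) (g := (algebraMap B (InvP p B)).comp f) (by
    rw [RingHom.comp_apply, map_natCast]
    exact IsLocalization.Away.algebraMap_isUnit (p : B))

/-- The map `A[1/p] → F` extending `f : A → F`, where `F` is a field of characteristic zero. -/
def invLift [hp : Fact p.Prime] {A F : Type*} [CommRing A] [Field F] [CharZero F] (f : A →+* F) :
    InvP p A →+* F :=
  IsLocalization.Away.lift (p : A) (g := f) (by
    rw [map_natCast]
    exact (Nat.cast_ne_zero.mpr hp.out.ne_zero).isUnit)

/-- The inclusion of the integral closure of `A` with `p` inverted in `Q̄(A)`. -/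
def intalToBar [Fact p.Prime] (A : Type*) [CommRing A] [IsDomain A] [CharZero A] :
    InvP p (Intal A) →+* QBar A :=
  invLift p (algebraMap (Intal A) (QBar A))

/-- `g` is a lift of `f : A → B` to the integral closures in `Q̄(A)` and `Q̄(B)`. -/
def IsLift {A B : Type*} [CommRing A] [IsDomain A] [CommRing B] [IsDomain B] (f : A →+* B)
    (g : Intal A →+* Intal B) : Prop :=
  ∀ x : A, g (algebraMap A (Intal A) x) = algebraMap B (Intal B) (f x)

/-- `g` is a lift of `f : A → F`, where `F` is an algebraically closed field, to the integral
closure of `A` in `Q̄(A)`. -/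
def IsLiftToField {A F : Type*} [CommRing A] [IsDomain A] [Field F] (f : A →+* F)
    (g : Intal A →+* F) : Prop :=
  ∀ x : A, g (algebraMap A (Intal A) x) = f x

end Coefficients

/-! ### The data of the theorem -/

section Data

variable (ℓ p : ℕ) [Fact ℓ.Prime] [Fact p.Prime]
  (K : Type w) [Field K] [Algebra ℚ_[ℓ] K] [FiniteDimensional ℚ_[ℓ] K]

theorem resCard_cast_ne_zero (F : Type*) [Field F] [CharZero F] : (resCard ℓ K : F) ≠ 0 := by
  obtain ⟨f, -, hf⟩ := exists_resCard_eq ℓ K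
  rw [hf]
  exact Nat.cast_ne_zero.mpr (pow_ne_zero _ (Fact.out : ℓ.Prime).ne_zero)

/-- Positive integers `m`, `t_1 ≤ … ≤ t_m` and irreducible Frobenius-semisimple representations
`r_1, …, r_m` of `W_K` with coefficients in `S^intal[1/p]`, where `S^intal` is the integral closure
of the domain `S` in `Q̄(S)`. (The fraction field of `S^intal[1/p]` is `Q̄(S)`, which is
algebraically closed.) -/
structure SegmentData (φ : weilGroup ℓ K) (S : Type u) [CommRing S] [IsDomain S] [CharZero S] where
  m : ℕ
  m_pos : 0 < m
  t : Fin m → ℕ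
  t_pos : ∀ i, 0 < t i
  t_mono : Monotone t
  d : Fin m → ℕ
  r : ∀ i, weilGroup ℓ K →* Matrix (Fin (d i)) (Fin (d i)) (InvP p (Intal S))
  irreducible : ∀ i, IsIrreducibleFrobSemisimple φ (repMap (intalToBar p S) (r i))

namespace SegmentData

variable {ℓ p K} {φ : weilGroup ℓ K} {S : Type u} [CommRing S] [IsDomain S] [CharZero S]

/-- `⊕_i Sp_{t_i}(g ∘ r_i)` for a homomorphism `g` from `S^intal[1/p]` to a field. -/
def spSum (D : SegmentData ℓ p K φ S) {F : Type*} [Field F] [CharZero F]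
    (g : InvP p (Intal S) →+* F) : WDData ℓ K (Σ i, Fin (D.d i) × Fin (D.t i)) F :=
  WDData.directSum fun i =>
    WDData.sp (D.t i) (repMap g (D.r i)) (resCard_cast_ne_zero ℓ K F)

/-- `T = ∑_i ∑_{j = 1}^{t_i} tr (r_i |Art_K⁻¹|_K ^ (j - 1))`, an identity in
`S^intal[1/p] ⊆ Q̄(S)`, where `|Art_K⁻¹(σ)|_K = q ^ (-v_K(σ))`. -/
def TraceFormula (D : SegmentData ℓ p K φ S) (T : weilGroup ℓ K → S) : Prop :=
  ∀ σ, algebraMap S (QBar S) (T σ) =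
    ∑ i, ∑ j : Fin (D.t i), intalToBar p S ((D.r i σ).trace) *
      ((resCard ℓ K : QBar S) ^ (-weilVal ℓ K σ)) ^ (j : ℕ)

/-- For every Weil-Deligne representation `(r', N')` of rank `n` over `O'[1/p]`, with `O'` a domain
over `ℤ_p`, with trace `res' ∘ T` for an embedding `res' : S → O'`, and with a pure specialization
`f' ∘ (r', N')`, and for all lifts `res'†` of `res'` and `f'†` of `f'` to the integral closures,
the Frobenius-semisimplifications of `(r', N') ⊗ Q̄(O')` and of `f' ∘ (r', N')` are isomorphic to
`⊕_i Sp_{t_i}(res'† ∘ r_i)` and `⊕_i Sp_{t_i}(f'† ∘ res'† ∘ r_i)`. -/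
def Rigidity [Algebra ℤ_[p] S] (D : SegmentData ℓ p K φ S) (T : weilGroup ℓ K → S) (n : ℕ) :
    Prop :=
  ∀ (O' : Type v) [CommRing O'] [IsDomain O'] [CharZero O'] [Algebra ℤ_[p] O']
    (res' : S →ₐ[ℤ_[p]] O') (ρ' : WDData ℓ K (Fin n) (InvP p O'))
    (f' : O' →ₐ[ℤ_[p]] PadicAlgCl p),
    Function.Injective res' → ρ'.IsWeilDeligne →
    (∀ σ, algebraMap O' (InvP p O') (res' (T σ)) = (ρ'.r σ).trace) →
    (ρ'.map (invLift p (f' : O' →+* PadicAlgCl p))).IsPure φ →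
    ∀ (resL : Intal S →+* Intal O') (fL : Intal O' →+* PadicAlgCl p),
      IsLift (res' : S →+* O') resL → IsLiftToField (f' : O' →+* PadicAlgCl p) fL →
      (∃ ρ₁, WDData.IsFrobSemisimplification φ
          (ρ'.map (invLift p (algebraMap O' (QBar O')))) ρ₁ ∧
        ρ₁.Iso (D.spSum ((intalToBar p O').comp (invMap p resL)))) ∧
      (∃ ρ₂, WDData.IsFrobSemisimplification φ
          (ρ'.map (invLift p (f' : O' →+* PadicAlgCl p))) ρ₂ ∧
        ρ₂.Iso (D.spSum ((invLift p fL).comp (invMap p resL))))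

end SegmentData

end Data

end

/-!
Over an algebraically closed field of characteristic zero, a Frobenius-semisimple Weil-Deligne
representation is a direct sum of representations `Sp_t(s)` with `s` irreducible
(`exists_isSegmentBasis`, `iso_directSum_sp_iff`). Such a sum is recorded by the multiset of its
*segments*, the pairs `(tr s, t)`, and its trace by the multiset of the characters
`tr s, tr s |Art_K⁻¹|, …, tr s |Art_K⁻¹| ^ (t - 1)` of all segments. By linear independence of
irreducible characters (`multiset_eq_of_sum_eq`) the trace determines the second multiset. It does
not determine the segments in general, since `N` may be changed without changing the trace; the
theorem holds because purity takes this freedom away.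

*Purity.* If `(r, N)` has a pure specialization, then two segments whose starting points differ by
an unramified twist `|Art_K⁻¹| ^ a` are concentric, i.e. have the same midpoint: the eigenvalues of
`φ` at the start of a segment of length `t` specialize to Weil numbers of weight `w + t - 1`, and
the twist shifts the weight by `-2 a` (`concentricSegments_of_isPure`). A concentric family is
determined by the multiset of its members, because a longest segment can be read off from its two
end points (`eq_of_expandSegments_eq`).

*Coefficients.* For semisimple `φ` with eigenvalues `w i`, the value of `S_k(T)` at `φ` is `k!`
times the `k`-th elementary symmetric polynomial of the `w i` (`pseudoSum_eq_factorial_mul`), so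
that the eigenvalues are the roots of `P_{φ,T}`. They become integral over `S` after multiplication
by `n!`, and all integers prime to `p` are invertible in `ℤ_p`; the same being true for `φ⁻¹`, the
eigenvalues are units of `S^intal[1/p]` (`exists_unit_of_isRoot`). An irreducible representation
with finite image of inertia is the unramified twist, by an eigenvalue of `φ`, of a representation
with finite image, and the latter is defined over the algebraic numbers (`exists_descent`), which
also lie in `S^intal[1/p]`. Hence the segments of `(r, N)` over `Q̄(O)` are defined over
`S^intal[1/p]` (`exists_segmentData`). Representations of this form stay irreducible under *every*
homomorphism to a field (`IsTwistOfFinite.isIrreducible`): irreducible representations over an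
algebraically closed field are absolutely irreducible, and `S^intal[1/p]` contains such a field over
which the representation is defined up to the twist.

*Specialization.* At a pure point the Frobenius-semisimplification is again a sum of segments, a
concentric one, with the same trace as the specialization of the generic segments. Moreover the rank
of `N ^ k` can only drop under specialization. A family whose members are those of a concentric one
and whose `N ^ k` have at least the ranks of the latter has to coincide with it
(`eq_of_expandSegments_eq_of_rank_le`): the ranks bound the lengths of the concentric segments by
the maximal length occurring in the first family, and the longest segments are then split off one
after the other. So the special segments are the specializations of the generic ones
(`segmentMultiset_eq_of_isPure`).

*Conclusion.* The generic segments of any two pure families with pseudorepresentation `T` are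
concentric families over `S^intal[1/p]` with the same trace, hence they agree up to a permutation
(`SegmentData.exists_equiv_of_concentricSegments`); this gives both the assertion for all other
`(r', N')` and uniqueness, as a competing family is forced to be concentric by the given pure point
(`SegmentData.concentricSegments`). The value of a character `r_i` at `σ` is a root of unity times a
power of `r_i(φ)` or of `r_i(φ⁻¹)`, and these are roots of `P_{φ,T}` and `P_{φ⁻¹,T}`; this gives the
integrality assertions (`isIntegral_of_character`).
-/

noncomputable section

/-! ### Multisets of concentric segments -/

section Segments

variable {X : Type*} (sh : ℤ → X → X)

/-- The multiset of all members `x, sh 1 x, …, sh (t - 1) x` of the segments `(x, t)` of `A`. -/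
def expandSegments (A : Multiset (X × ℕ)) : Multiset X :=
  A.bind fun s => (Multiset.range s.2).map fun j : ℕ => sh (j : ℤ) s.1

/-- Segments whose starting points lie in one orbit of the shift have the same midpoint. -/
def ConcentricSegments (A : Multiset (X × ℕ)) : Prop :=
  ∀ s ∈ A, ∀ s' ∈ A, ∀ a : ℤ, s'.1 = sh a s.1 → (s.2 : ℤ) = s'.2 + 2 * a

variable {sh}

theorem mem_expandSegments {A : Multiset (X × ℕ)} {y : X} :
    y ∈ expandSegments sh A ↔ ∃ s ∈ A, ∃ j < s.2, sh (j : ℤ) s.1 = y := by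
  simp [expandSegments, Multiset.mem_bind]

theorem expandSegments_cons (s : X × ℕ) (A : Multiset (X × ℕ)) :
    expandSegments sh (s ::ₘ A) =
      (Multiset.range s.2).map (fun j : ℕ => sh (j : ℤ) s.1) + expandSegments sh A := by
  simp [expandSegments]

theorem expandSegments_zero : expandSegments sh (0 : Multiset (X × ℕ)) = 0 := by
  simp [expandSegments]

theorem ConcentricSegments.of_cons {s : X × ℕ} {A : Multiset (X × ℕ)}
    (h : ConcentricSegments sh (s ::ₘ A)) : ConcentricSegments sh A :=
  fun s hs s' hs' => h s (Multiset.mem_cons_of_mem hs) s' (Multiset.mem_cons_of_mem hs')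

theorem eq_zero_of_expandSegments_eq_zero {A : Multiset (X × ℕ)} (hA : ∀ s ∈ A, 0 < s.2)
    (h : expandSegments sh A = 0) : A = 0 := by
  refine Multiset.eq_zero_of_forall_notMem fun s hs => ?_
  have : sh ((0 : ℕ) : ℤ) s.1 ∈ expandSegments sh A := 
    mem_expandSegments.mpr ⟨s, hs, 0, hA s hs, rfl⟩
  rw [h] at this
  exact Multiset.notMem_zero _ this

/-- The two end points of a segment `s` of maximal length lie on segments of the concentric family
`B`; comparing midpoints, a single segment of `B` contains both, and it has to be `s` itself. -/
theorem ConcentricSegments.mem_of_longest (h0 : ∀ x, sh 0 x = x)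
    (hadd : ∀ a b x, sh (a + b) x = sh a (sh b x)) {B : Multiset (X × ℕ)}
    (hB : ConcentricSegments sh B) {s : X × ℕ} (hs : 0 < s.2)
    (hmem : ∀ j < s.2, sh (j : ℤ) s.1 ∈ expandSegments sh B) (hmax : ∀ u ∈ B, u.2 ≤ s.2) :
    s ∈ B := by
  obtain ⟨u, hu, b, hb, hub⟩ := mem_expandSegments.mp (hmem 0 hs)
  obtain ⟨u', hu', c, hc, huc⟩ := mem_expandSegments.mp (hmem (s.2 - 1) (by omega))
  rw [Nat.cast_zero, h0] at hub
  have key : u'.1 = sh ((b : ℤ) + (s.2 - 1 : ℕ) - c) u.1 := by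
    have h1 : u'.1 = sh (-(c : ℤ)) (sh (c : ℤ) u'.1) := by
      rw [← hadd, neg_add_cancel, h0]
    rw [h1, huc, ← hub, ← hadd, ← hadd]
    congr 1
    ring
  have h1 := hB u hu u' hu' _ key
  have h2 := hmax u hu
  have h3 := hmax u' hu'
  have hb0 : b = 0 := by omega
  have ht : u.2 = s.2 := by omega
  have hx : u.1 = s.1 := by rw [← hub, hb0, Nat.cast_zero, h0]
  have : u = s := Prod.ext hx ht
  exact this ▸ hu

/-- A concentric family of segments is determined by the multiset of its members: a longest segment
of two families with the same members belongs to both and may be removed from both. -/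
theorem eq_of_expandSegments_eq (h0 : ∀ x, sh 0 x = x)
    (hadd : ∀ a b x, sh (a + b) x = sh a (sh b x)) {A B : Multiset (X × ℕ)}
    (hA : ConcentricSegments sh A) (hB : ConcentricSegments sh B) (hA0 : ∀ s ∈ A, 0 < s.2)
    (hB0 : ∀ s ∈ B, 0 < s.2) (h : expandSegments sh A = expandSegments sh B) : A = B := by
  classical
  induction hn : Multiset.card A using Nat.strong_induction_on generalizing A B with
  | _ n ih =>
  subst hn
  by_cases hA1 : A = 0
  · subst hA1
    rw [expandSegments_zero] at h
    exact (eq_zero_of_expandSegments_eq_zero hB0 h.symm).symm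
  -- a longest segment of `A` and `B` together belongs to both
  obtain ⟨s, hsAB, hmax⟩ : ∃ s ∈ A + B, ∀ u ∈ A + B, u.2 ≤ s.2 := by
    obtain ⟨a, ha⟩ := Multiset.exists_mem_of_ne_zero hA1
    obtain ⟨s, hs, hmax⟩ := Finset.exists_max_image (A + B).toFinset (fun u => u.2)
      ⟨a, by simp [ha]⟩
    exact ⟨s, by simpa using hs, fun u hu => hmax u (by simpa using hu)⟩
  have hs : s ∈ A ∧ s ∈ B := by
    rcases Multiset.mem_add.mp hsAB with hs | hs
    · exact ⟨hs, hB.mem_of_longest h0 hadd (hA0 s hs)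
        (fun j hj => h ▸ mem_expandSegments.mpr ⟨s, hs, j, hj, rfl⟩)
        fun u hu => hmax u (Multiset.mem_add.mpr (Or.inr hu))⟩
    · exact ⟨hA.mem_of_longest h0 hadd (hB0 s hs)
        (fun j hj => h ▸ mem_expandSegments.mpr ⟨s, hs, j, hj, rfl⟩)
        fun u hu => hmax u (Multiset.mem_add.mpr (Or.inl hu)), hs⟩
  obtain ⟨A, rfl⟩ := Multiset.exists_cons_of_mem hs.1
  obtain ⟨B, rfl⟩ := Multiset.exists_cons_of_mem hs.2
  rw [expandSegments_cons, expandSegments_cons] at h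
  rw [ih (Multiset.card A) (by simp) hA.of_cons hB.of_cons
    (fun u hu => hA0 u (Multiset.mem_cons_of_mem hu))
    (fun u hu => hB0 u (Multiset.mem_cons_of_mem hu)) (add_left_cancel h) rfl]

/-- Here only `B` is assumed concentric; the inequality says that for every `j` the `j`-th power of
the monodromy operator attached to `A` has at least the rank of the one attached to `B`. -/
theorem eq_of_expandSegments_eq_of_rank_le (h0 : ∀ x, sh 0 x = x)
    (hadd : ∀ a b x, sh (a + b) x = sh a (sh b x)) {A B : Multiset (X × ℕ)} (d : X → ℕ)
    (hB : ConcentricSegments sh B) (hA0 : ∀ s ∈ A, 0 < s.2)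
    (hB0 : ∀ s ∈ B, 0 < s.2) (hd : ∀ s ∈ B, 0 < d s.1)
    (h : expandSegments sh A = expandSegments sh B)
    (hrank : ∀ j, (B.map fun s => d s.1 * (s.2 - j)).sum ≤ (A.map fun s => d s.1 * (s.2 - j)).sum) :
    A = B := by
  classical
  induction hn : Multiset.card A using Nat.strong_induction_on generalizing A B with
  | _ n ih =>
  subst hn
  by_cases hA1 : A = 0
  · subst hA1
    rw [expandSegments_zero] at h
    exact (eq_zero_of_expandSegments_eq_zero hB0 h.symm).symm
  obtain ⟨s, hsA, hmaxA⟩ : ∃ s ∈ A, ∀ u ∈ A, u.2 ≤ s.2 := by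
    obtain ⟨a, ha⟩ := Multiset.exists_mem_of_ne_zero hA1
    obtain ⟨s, hs, hmax⟩ := Finset.exists_max_image A.toFinset (fun u => u.2) ⟨a, by simp [ha]⟩
    exact ⟨s, by simpa using hs, fun u hu => hmax u (by simpa using hu)⟩
  -- a longer segment of `B` would contribute to the rank of the power with exponent `s.2`, which
  -- vanishes for `A`
  have hmax : ∀ u ∈ B, u.2 ≤ s.2 := by
    intro u hu
    by_contra! hlt
    have h1 : (A.map fun v => d v.1 * (v.2 - s.2)).sum = 0 := by
      refine Multiset.sum_eq_zero fun y hy => ?_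
      obtain ⟨v, hv, rfl⟩ := Multiset.mem_map.mp hy
      rw [Nat.sub_eq_zero_of_le (hmaxA v hv), mul_zero]
    have h2 : d u.1 * (u.2 - s.2) ≤ (B.map fun v => d v.1 * (v.2 - s.2)).sum :=
      Multiset.single_le_sum (fun _ _ => Nat.zero_le _) _
        (Multiset.mem_map_of_mem (fun v : X × ℕ => d v.1 * (v.2 - s.2)) hu)
    have h3 : 0 < d u.1 * (u.2 - s.2) := Nat.mul_pos (hd u hu) (by omega)
    have := hrank s.2
    omega
  have hsB : s ∈ B := hB.mem_of_longest h0 hadd (hA0 s hsA)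
    (fun j hj => h ▸ mem_expandSegments.mpr ⟨s, hsA, j, hj, rfl⟩) hmax
  obtain ⟨A, rfl⟩ := Multiset.exists_cons_of_mem hsA
  obtain ⟨B, rfl⟩ := Multiset.exists_cons_of_mem hsB
  rw [expandSegments_cons, expandSegments_cons] at h
  rw [ih (Multiset.card A) (by simp) hB.of_cons
    (fun u hu => hA0 u (Multiset.mem_cons_of_mem hu))
    (fun u hu => hB0 u (Multiset.mem_cons_of_mem hu))
    (fun u hu => hd u (Multiset.mem_cons_of_mem hu)) (add_left_cancel h)
    (fun j => by simpa using hrank j) rfl]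

end Segments

/-! ### Irreducible matrix representations and their characters -/

section Density

variable {F R ι : Type*} [Field F] [IsAlgClosed F] [Ring R] [Algebra F R] [Finite ι]
  {M : ι → Type*} [∀ i, AddCommGroup (M i)] [∀ i, Module F (M i)] [∀ i, Module R (M i)]
  [∀ i, IsScalarTower F R (M i)] [∀ i, FiniteDimensional F (M i)] [∀ i, IsSimpleModule R (M i)]

/-- Density theorem: over an algebraically closed field, an algebra acts on finitely many pairwise
non-isomorphic simple modules through all families of endomorphisms. -/
theorem exists_smul_eq_of_pairwise_not_iso
    (hne : ∀ i j, i ≠ j → IsEmpty (M i ≃ₗ[R] M j)) (E : ∀ i, Module.End F (M i)) :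
    ∃ a : R, ∀ i (m : M i), a • m = E i m := by
  classical
  have := Fintype.ofFinite ι
  -- an endomorphism of the product of the modules acts on each factor by a scalar
  have hscal : ∀ f : Module.End R (∀ i, M i), ∀ j, ∃ c : F, ∀ x, f x j = c • x j := by
    intro f j
    have hij : ∀ i, i ≠ j → ∀ y : M i, f (Pi.single i y) j = 0 := by
      intro i hi y
      let h : M i →ₗ[R] M j := (LinearMap.proj j).comp (f.comp (LinearMap.single R M i))
      have : h = 0 := by
        rcases h.bijective_or_eq_zero with hb | h0
        · exact ((hne i j hi).false (LinearEquiv.ofBijective h hb)).elim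
        · exact h0
      exact LinearMap.congr_fun this y
    let h : Module.End R (M j) := (LinearMap.proj j).comp (f.comp (LinearMap.single R M j))
    obtain ⟨c, hc⟩ :=
      (IsSimpleModule.algebraMap_end_bijective_of_isAlgClosed (A := R) (V := M j) F).2 h
    refine ⟨c, fun x => ?_⟩
    have hx : x = ∑ i, Pi.single i (x i) := (Finset.univ_sum_single x).symm
    have : f x j = ∑ i, f (Pi.single i (x i)) j := by
      conv_lhs => rw [hx, map_sum, Finset.sum_apply]
    rw [this, Finset.sum_eq_single j (fun i _ hi => hij i hi _) (by simp)]
    have := LinearMap.congr_fun hc (x j)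
    exact this.symm
  let T : Module.End (Module.End R (∀ i, M i)) (∀ i, M i) :=
    { toFun x i := E i (x i)
      map_add' x y := by ext i; simp
      map_smul' f x := by
        ext i
        obtain ⟨c, hc⟩ := hscal f i
        simp [hc] }
  have hfin : Module.Finite F (∀ i, M i) := inferInstance
  obtain ⟨s, hs⟩ := hfin.fg_top
  obtain ⟨a, ha⟩ := jacobson_density (R := R) T s
  have hall : ∀ x : ∀ i, M i, T x = a • x := by
    intro x
    have hx : x ∈ Submodule.span F (s : Set (∀ i, M i)) := hs ▸ Submodule.mem_top
    induction hx using Submodule.span_induction with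
    | mem m hm => exact ha m hm
    | zero => simp
    | add x y _ _ hx hy => rw [map_add, hx, hy, smul_add]
    | smul c x _ hx =>
      have : T (c • x) = c • T x := by ext i; simp [T]
      rw [this, hx]
      ext i
      exact (smul_comm a c (x i)).symm
  refine ⟨a, fun i m => ?_⟩
  have := congrFun (hall (Pi.single i m)) i
  simpa [T] using this.symm

end Density

section MatrixRep

variable {G F ι κ : Type*} [Group G] [Fintype ι] [DecidableEq ι] [Fintype κ] [DecidableEq κ]

/-- Isomorphism of matrix representations of a group. -/
def SimRep {A : Type*} [CommRing A] (r : G →* Matrix ι ι A) (r' : G →* Matrix κ κ A) : Prop :=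
  ∃ (P : Matrix ι κ A) (Q : Matrix κ ι A), P * Q = 1 ∧ Q * P = 1 ∧ ∀ g, r g * P = P * r' g

theorem SimRep.symm {A : Type*} [CommRing A] {r : G →* Matrix ι ι A} {r' : G →* Matrix κ κ A}
    (h : SimRep r r') : SimRep r' r := by
  obtain ⟨P, Q, hPQ, hQP, h⟩ := h
  refine ⟨Q, P, hQP, hPQ, fun g => ?_⟩
  calc r' g * Q = Q * P * r' g * Q := by rw [hQP, Matrix.one_mul]
    _ = Q * (r g * P) * Q := by rw [h, Matrix.mul_assoc Q P]
    _ = Q * r g := by rw [Matrix.mul_assoc, Matrix.mul_assoc, hPQ, Matrix.mul_one]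

theorem SimRep.trace_eq {A : Type*} [CommRing A] {r : G →* Matrix ι ι A} {r' : G →* Matrix κ κ A}
    (h : SimRep r r') (g : G) : (r g).trace = (r' g).trace := by
  obtain ⟨P, Q, hPQ, hQP, h⟩ := h
  calc (r g).trace = (r g * P * Q).trace := by rw [Matrix.mul_assoc, hPQ, Matrix.mul_one]
    _ = (r' g).trace := by rw [h, Matrix.mul_assoc, Matrix.trace_mul_comm, Matrix.mul_assoc, hQP,
      Matrix.mul_one]

variable [Field F]

/-- A matrix representation as a representation on column vectors. -/
def matRep (r : G →* Matrix ι ι F) : Representation F G (ι → F) :=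
  ((Matrix.toLinAlgEquiv' : Matrix ι ι F ≃ₐ[F] ((ι → F) →ₗ[F] (ι → F))) :
    Matrix ι ι F →* ((ι → F) →ₗ[F] (ι → F))).comp r

theorem matRep_apply (r : G →* Matrix ι ι F) (g : G) (v : ι → F) :
    matRep r g v = (r g).mulVec v := rfl

theorem matRep_isIrreducible_iff (r : G →* Matrix ι ι F) :
    (matRep r).IsIrreducible ↔ Nonempty ι ∧
      ∀ p : Submodule F (ι → F), (∀ g, ∀ v ∈ p, (r g).mulVec v ∈ p) → p = ⊥ ∨ p = ⊤ := by
  constructor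
  · intro h
    refine ⟨?_, fun p hp => ?_⟩
    · by_contra hι
      rw [not_nonempty_iff] at hι
      obtain ⟨x, y, hxy⟩ := h.toNontrivial
      exact hxy (Subrepresentation.toSubmodule_injective (Subsingleton.elim _ _))
    · rcases h.eq_bot_or_eq_top ⟨p, fun g v hv => hp g v hv⟩ with h | h
      · exact Or.inl (congrArg Subrepresentation.toSubmodule h)
      · exact Or.inr (congrArg Subrepresentation.toSubmodule h)
  · rintro ⟨hι, h⟩
    have : Nontrivial (Subrepresentation (matRep r)) := by
      refine ⟨⊥, ⊤, fun hbt => ?_⟩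
      have : (⊥ : Submodule F (ι → F)) = ⊤ := congrArg Subrepresentation.toSubmodule hbt
      exact bot_ne_top this
    refine ⟨fun p => ?_⟩
    rcases h p.toSubmodule (fun g v hv => p.apply_mem_toSubmodule g hv) with h | h
    · exact Or.inl (Subrepresentation.toSubmodule_injective h)
    · exact Or.inr (Subrepresentation.toSubmodule_injective h)

theorem matRep_asAlgebraHom (r : G →* Matrix ι ι F) (a : MonoidAlgebra F G) (v : ι → F) :
    (matRep r).asAlgebraHom a v = (MonoidAlgebra.lift F (Matrix ι ι F) G r a).mulVec v := by
  induction a using MonoidAlgebra.induction_linear with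
  | zero => simp
  | add x y hx hy => rw [map_add, map_add, LinearMap.add_apply, hx, hy, Matrix.add_mulVec]
  | single g c =>
    rw [Representation.asAlgebraHom_single, MonoidAlgebra.lift_single, LinearMap.smul_apply,
      Matrix.smul_mulVec]
    rfl

theorem matRep_asModule_smul (r : G →* Matrix ι ι F) (a : MonoidAlgebra F G)
    (v : (matRep r).asModule) :
    a • v = (MonoidAlgebra.lift F (Matrix ι ι F) G r a).mulVec v :=
  matRep_asAlgebraHom r a v

theorem matRep_asModule_single_smul (r : G →* Matrix ι ι F) (g : G) (v : (matRep r).asModule) :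
    MonoidAlgebra.single g (1 : F) • v = (r g).mulVec v :=
  (matRep_asAlgebraHom r _ v).trans (by rw [MonoidAlgebra.lift_single, one_smul])

variable [IsAlgClosed F]

/-- The density theorem for matrix representations: an element of the group algebra may be
prescribed in finitely many pairwise non-isomorphic irreducible representations. -/
theorem exists_sum_smul_eq_of_pairwise_not_simRep {I : Type*} [Finite I] {d : I → ℕ}
    (r : ∀ i, G →* Matrix (Fin (d i)) (Fin (d i)) F) (hr : ∀ i, (matRep (r i)).IsIrreducible)
    (hne : ∀ i j, i ≠ j → ¬ SimRep (r i) (r j)) (E : ∀ i, Matrix (Fin (d i)) (Fin (d i)) F) :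
    ∃ a : MonoidAlgebra F G, ∀ i, MonoidAlgebra.lift F _ G (r i) a = E i := by
  have hsimple : ∀ i, IsSimpleModule (MonoidAlgebra F G) (matRep (r i)).asModule := fun i =>
    (Representation.irreducible_iff_isSimpleModule_asModule _).mp (hr i)
  have hne' : ∀ i j, i ≠ j →
      IsEmpty ((matRep (r i)).asModule ≃ₗ[MonoidAlgebra F G] (matRep (r j)).asModule) := by
    refine fun i j hij => ⟨fun e => hne j i hij.symm ?_⟩
    let e' : (Fin (d i) → F) ≃ₗ[F] (Fin (d j) → F) := e.restrictScalars F
    have hcomm : ∀ g v, e' ((r i g).mulVec v) = (r j g).mulVec (e' v) := by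
      intro g v
      have h1 := e.map_smul (MonoidAlgebra.single g 1) v
      have h2 := congrArg e (matRep_asModule_single_smul (r i) g v)
      exact h2.symm.trans (h1.trans (matRep_asModule_single_smul (r j) g (e v)))
    refine ⟨LinearMap.toMatrix' e'.toLinearMap, LinearMap.toMatrix' e'.symm.toLinearMap, ?_, ?_, ?_⟩
    · rw [← LinearMap.toMatrix'_comp]; simp
    · rw [← LinearMap.toMatrix'_comp]; simp
    · intro g
      apply Matrix.mulVec_injective
      funext v
      rw [← Matrix.mulVec_mulVec, ← Matrix.mulVec_mulVec, LinearMap.toMatrix'_mulVec,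
        LinearMap.toMatrix'_mulVec]
      exact (hcomm g v).symm
  have : ∀ i, FiniteDimensional F (matRep (r i)).asModule := fun i =>
    inferInstanceAs (FiniteDimensional F (Fin (d i) → F))
  obtain ⟨a, ha⟩ := exists_smul_eq_of_pairwise_not_iso (F := F) (R := MonoidAlgebra F G)
    (M := fun i => (matRep (r i)).asModule) hne' (fun i => Matrix.toLin' (E i))
  refine ⟨a, fun i => ?_⟩
  apply Matrix.mulVec_injective
  funext v
  exact (matRep_asModule_smul (r i) a v).symm.trans (ha i v)

/-- The characters of pairwise non-isomorphic irreducible representations of a group over an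
algebraically closed field are linearly independent. -/
theorem linearIndependent_trace_of_pairwise_not_simRep {I : Type*} [Finite I] {d : I → ℕ}
    (r : ∀ i, G →* Matrix (Fin (d i)) (Fin (d i)) F) (hr : ∀ i, (matRep (r i)).IsIrreducible)
    (hne : ∀ i j, i ≠ j → ¬ SimRep (r i) (r j)) :
    LinearIndependent F fun i => fun g => (r i g).trace := by
  classical
  have := Fintype.ofFinite I
  rw [Fintype.linearIndependent_iff]
  intro c hc i
  obtain ⟨z⟩ := ((matRep_isIrreducible_iff (r i)).mp (hr i)).1
  obtain ⟨a, ha⟩ := exists_sum_smul_eq_of_pairwise_not_simRep r hr hne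
    (Pi.single i (Matrix.single z z 1))
  have h : ∑ j, c j * (MonoidAlgebra.lift F _ G (r j) a).trace = 0 := by
    clear ha
    induction a using MonoidAlgebra.induction_linear with
    | zero => simp
    | add x y hx hy =>
      simp only [map_add, Matrix.trace_add, mul_add, Finset.sum_add_distrib, hx, hy, add_zero]
    | single g b =>
      have := congrFun hc g
      simp only [Finset.sum_apply, Pi.smul_apply, smul_eq_mul, Pi.zero_apply] at this
      simp only [MonoidAlgebra.lift_single, Matrix.trace_smul, smul_eq_mul]
      calc _ = b * ∑ j, c j * (r j g).trace := by
            rw [Finset.mul_sum]; exact Finset.sum_congr rfl fun j _ => by ring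
        _ = 0 := by rw [this, mul_zero]
  simp only [ha] at h
  rw [Finset.sum_eq_single i] at h
  · simpa using h
  · intro j _ hj
    rw [Pi.single_eq_of_ne hj, Matrix.trace_zero, mul_zero]
  · simp

/-- An irreducible representation over an algebraically closed field is determined by its character,
in any characteristic. -/
theorem simRep_of_trace_eq {d d' : ℕ} {r : G →* Matrix (Fin d) (Fin d) F}
    {r' : G →* Matrix (Fin d') (Fin d') F} (hr : (matRep r).IsIrreducible)
    (hr' : (matRep r').IsIrreducible) (h : ∀ g, (r g).trace = (r' g).trace) : SimRep r r' := by
  by_contra hne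
  have := linearIndependent_trace_of_pairwise_not_simRep (I := Bool)
    (d := fun b => if b then d else d') (fun b => match b with
      | true => r
      | false => r') (by rintro (_ | _) <;> assumption) (by
      rintro (_ | _) (_ | _) hb
      · exact absurd rfl hb
      · exact fun h => hne h.symm
      · exact hne
      · exact absurd rfl hb)
  exact Bool.noConfusion (this.injective (a₁ := true) (a₂ := false) (funext h))

/-- The characters of irreducible representations of `G` over `F`. -/
def irrCharSet (G F : Type*) [Group G] [Field F] : Set (G → F) :=
  {x | ∃ (d : ℕ) (r : G →* Matrix (Fin d) (Fin d) F), (matRep r).IsIrreducible ∧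
    x = fun g => (r g).trace}

theorem linearIndependent_irrCharSet :
    LinearIndependent F (Subtype.val : irrCharSet G F → G → F) := by
  rw [linearIndependent_iff_finset_linearIndependent]
  intro s
  choose d r hr hx using fun x : s => x.1.2
  have := linearIndependent_trace_of_pairwise_not_simRep r hr fun i j hij h => hij (by
    apply Subtype.ext; apply Subtype.ext
    rw [hx i, hx j]
    exact funext h.trace_eq)
  convert this using 1
  exact funext hx

/-- In characteristic zero, a sum of irreducible characters determines its summands. -/
theorem multiset_eq_of_sum_eq [CharZero F] {A B : Multiset (G → F)}
    (hA : ∀ x ∈ A, x ∈ irrCharSet G F) (hB : ∀ x ∈ B, x ∈ irrCharSet G F)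
    (h : A.sum = B.sum) : A = B := by
  classical
  lift A to Multiset (irrCharSet G F) using hA
  lift B to Multiset (irrCharSet G F) using hB
  congr 1
  have key : ∀ C : Multiset (irrCharSet G F), (C.map (fun x : irrCharSet G F => (x : G → F))).sum =
      Finsupp.linearCombination F (Subtype.val : irrCharSet G F → G → F)
        ((Multiset.toFinsupp C).mapRange (fun n : ℕ => (n : F)) Nat.cast_zero) := by
    intro C
    induction C using Multiset.induction_on with
    | empty => simp
    | cons x C ih =>
      rw [Multiset.map_cons, Multiset.sum_cons, ih, ← Multiset.singleton_add, map_add,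
        Finsupp.mapRange_add (by simp), map_add, Multiset.toFinsupp_singleton,
        Finsupp.mapRange_single, Finsupp.linearCombination_single, Nat.cast_one, one_smul]
  have h' := h
  rw [key, key] at h'
  have h2 := linearIndependent_irrCharSet h'
  apply Multiset.toFinsupp.injective
  ext x
  have := DFunLike.congr_fun h2 x
  simpa using this

end MatrixRep

/-! ### The multiplicative Jordan decomposition -/

section Jordan

variable {F V : Type*} [Field F] [AddCommGroup V] [Module F V]

/-- `f = s u = u s` with `s` semisimple and `u` unipotent. -/
structure IsMulJordan (f s u : Module.End F V) : Prop where
  eq_mul : f = s * u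
  eq_mul' : f = u * s
  semisimple : s.IsSemisimple
  unipotent : IsNilpotent (u - 1)

theorem IsMulJordan.commute {f s u : Module.End F V} (h : IsMulJordan f s u) : Commute s u :=
  h.eq_mul.symm.trans h.eq_mul'

theorem IsMulJordan.commute_left {f s u : Module.End F V} (h : IsMulJordan f s u) :
    Commute f s := by
  rw [h.eq_mul]
  exact (Commute.refl s).mul_left h.commute.symm

theorem IsMulJordan.isNilpotent_sub {f s u : Module.End F V} (h : IsMulJordan f s u) :
    IsNilpotent (f - s) := by
  rw [h.eq_mul, ← mul_sub_one]
  exact (h.commute.sub_right (Commute.one_right s)).isNilpotent_mul_left h.unipotent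

/-- In characteristic zero a unipotent element has the same commutant as any of its powers. -/
theorem commute_of_commute_pow [CharZero F] {u X : Module.End F V} (hu : IsNilpotent (u - 1))
    {M : ℕ} (hM : 0 < M) (h : Commute (u ^ M) X) : Commute u X := by
  -- `X` commutes with all powers `n ^ k` of `n = u - 1`, by descending induction on `k`
  set n := u - 1 with hn
  have hun : u = 1 + n := by rw [hn]; abel
  obtain ⟨m, hm⟩ := hu
  have key : ∀ j k, 1 ≤ k → m ≤ j + k → Commute (n ^ k) X := by
    intro j
    induction j with
    | zero =>
      intro k _ hk
      rw [pow_eq_zero_of_le (by omega) hm]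
      exact Commute.zero_left X
    | succ j ih =>
      intro k hk1 hk
      by_cases hk' : m ≤ j + k
      · exact ih k hk1 hk'
      have hhigh : ∀ i, k < i → Commute (n ^ i) X := fun i hi => ih i (by omega) (by omega)
      -- `(u ^ M - 1) ^ k` is a nonzero multiple of `n ^ k` up to higher powers of `n`
      let W : Polynomial F := (∑ i ∈ Finset.range M, (1 + Polynomial.X) ^ i) ^ k
      have hW0 : W.coeff 0 = (M : F) ^ k := by
        rw [Polynomial.coeff_zero_eq_eval_zero]
        simp [W, Polynomial.eval_finsetSum]
      have hW : n ^ k * Polynomial.aeval n W = (u ^ M - 1) ^ k := by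
        have h1 : Commute n (∑ i ∈ Finset.range M, u ^ i) :=
          Commute.sum_right _ _ _ fun i _ =>
            ((Commute.refl u).sub_left (Commute.one_left u)).pow_right i
        rw [← geom_sum_mul, ← hn, h1.symm.mul_pow, ← (h1.pow_pow k k).eq]
        simp [W, hun]
      have hQ : Commute (n ^ (k + 1) * Polynomial.aeval n W.divX) X := by
        rw [Polynomial.aeval_eq_sum_range, Finset.mul_sum]
        refine Commute.sum_left _ _ _ fun i _ => ?_
        rw [mul_smul_comm, ← pow_add]
        exact (hhigh _ (by omega)).smul_left _
      have h2 : n ^ k * Polynomial.aeval n W =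
          n ^ (k + 1) * Polynomial.aeval n W.divX + ((M : F) ^ k) • n ^ k := by
        conv_lhs => rw [← Polynomial.divX_mul_X_add W, hW0]
        rw [map_add, map_mul, Polynomial.aeval_X, Polynomial.aeval_C, mul_add, pow_succ]
        have hc : Commute (Polynomial.aeval n W.divX) n := by
          simpa using (Commute.all W.divX (Polynomial.X : Polynomial F)).map (Polynomial.aeval n)
        rw [hc.eq, ← mul_assoc, Algebra.algebraMap_eq_smul_one, mul_smul_comm, mul_one]
      have h3 : Commute (((M : F) ^ k) • n ^ k) X := by
        rw [eq_sub_of_add_eq' (h2.symm.trans hW)]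
        exact ((h.sub_left (Commute.one_left X)).pow_left k).sub_left hQ
      have hM0 : (M : F) ^ k ≠ 0 := pow_ne_zero _ (Nat.cast_ne_zero.mpr hM.ne')
      have := h3.smul_left ((M : F) ^ k)⁻¹
      rwa [smul_smul, inv_mul_cancel₀ hM0, one_smul] at this
  have := key m 1 le_rfl (by omega)
  rw [pow_one] at this
  rw [hun]
  exact (Commute.one_left X).add_left this

variable [IsAlgClosed F] [FiniteDimensional F V]

/-- On a generalised eigenspace of `f` the semisimple part of `f` is a scalar, so that a map which
intertwines `f` and `f'` intertwines their semisimple parts. -/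
theorem IsMulJordan.intertwine {f s u f' s' u' X : Module.End F V} (h : IsMulJordan f s u)
    (h' : IsMulJordan f' s' u') (hX : f * X = X * f') : s * X = X * s' := by
  ext x
  have hx : x ∈ ⨆ μ : F, f'.maxGenEigenspace μ := by
    rw [Module.End.iSup_maxGenEigenspace_eq_top]; trivial
  induction hx using Submodule.iSup_induction' with
  | zero => simp
  | add x y _ _ hx hy => rw [map_add, map_add, hx, hy]
  | mem μ x hx =>
    have h1 : s' x = μ • x := Module.End.apply_eq_of_mem_of_comm_of_isFinitelySemisimple_of_isNil
      hx h'.commute_left h'.semisimple.isFinitelySemisimple h'.isNilpotent_sub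
    have hXx : X x ∈ f.maxGenEigenspace μ := by
      rw [Module.End.mem_maxGenEigenspace] at hx ⊢
      obtain ⟨k, hk⟩ := hx
      refine ⟨k, ?_⟩
      have hc : ∀ k : ℕ, (f - μ • 1) ^ k * X = X * (f' - μ • 1) ^ k := by
        intro k
        have h1 : (f - μ • 1) * X = X * (f' - μ • 1) := by
          rw [sub_mul, mul_sub, hX]; simp
        induction k with
        | zero => simp
        | succ k ih => rw [pow_succ, mul_assoc, h1, ← mul_assoc, ih, mul_assoc, ← pow_succ]
      have := LinearMap.congr_fun (hc k) x
      rw [Module.End.mul_apply, Module.End.mul_apply, hk, map_zero] at this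
      exact this
    have h2 : s (X x) = μ • X x :=
      Module.End.apply_eq_of_mem_of_comm_of_isFinitelySemisimple_of_isNil
        hXx h.commute_left h.semisimple.isFinitelySemisimple h.isNilpotent_sub
    rw [Module.End.mul_apply, Module.End.mul_apply, h1, h2, map_smul]

/-- The multiplicative Jordan decomposition of an invertible operator; the unipotent part is `1 +
s⁻¹ n` for the additive decomposition `s + n`. -/
theorem exists_isMulJordan {f : Module.End F V} (hf : IsUnit f) :
    ∃ s u : Module.End F V, IsUnit s ∧ IsUnit u ∧ IsMulJordan f s u := by
  obtain ⟨n, hn, s, hs, hnil, hss, hfns⟩ := f.exists_isNilpotent_isSemisimple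
  have hfs : Commute f s := Algebra.commute_of_mem_adjoin_self hs
  have hfn : Commute f n := Algebra.commute_of_mem_adjoin_self hn
  have hns : Commute n s := by
    have : n = f - s := eq_sub_of_add_eq hfns.symm
    rw [this]
    exact hfs.sub_left (Commute.refl s)
  have hsu : IsUnit s := by
    have : s = f + -n := by rw [hfns]; abel
    rw [this]
    exact hnil.neg.isUnit_add_left_of_commute hf hfn.symm.neg_left
  obtain ⟨s, rfl⟩ := hsu
  have hc : Commute (↑s⁻¹ : Module.End F V) n := hns.symm.units_inv_left
  have hu : IsNilpotent ((↑s⁻¹ : Module.End F V) * n) := hc.isNilpotent_mul_left hnil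
  refine ⟨s, 1 + ↑s⁻¹ * n, s.isUnit, hu.isUnit_one_add, ?_, ?_, hss, by simpa using hu⟩
  · rw [mul_add, mul_one, Units.mul_inv_cancel_left, hfns, add_comm]
  · rw [add_mul, one_mul, hc.eq, mul_assoc, Units.inv_mul, mul_one, hfns, add_comm]

end Jordan

/-! ### Frobenius-semisimplification -/

section FiniteInertia

variable {G : Type*} [Group G] {v : G → ℤ}

theorem valuation_one (hv : ∀ a b, v (a * b) = v a + v b) : v 1 = 0 := by
  have := hv 1 1
  rw [one_mul] at this
  omega

theorem valuation_inv (hv : ∀ a b, v (a * b) = v a + v b) (g : G) : v g⁻¹ = -v g := by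
  have := hv g g⁻¹
  rw [mul_inv_cancel, valuation_one hv] at this
  omega

theorem valuation_zpow (hv : ∀ a b, v (a * b) = v a + v b) (g : G) (n : ℤ) :
    v (g ^ n) = n * v g := by
  induction n with
  | zero => simp [valuation_one hv]
  | succ n ih => rw [zpow_add_one, hv, ih]; ring
  | pred n ih => rw [zpow_sub_one, hv, ih, valuation_inv hv]; ring

/-- Conjugation by the Frobenius permutes the finite image of inertia, hence a power of the
Frobenius acts trivially on it. -/
theorem exists_pow_commute {M : Type*} [Monoid M] (hv : ∀ a b, v (a * b) = v a + v b) (φ : G)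
    (r : G →* M) (hfin : (r '' {g | v g = 0}).Finite) :
    ∃ m : ℕ, 0 < m ∧ ∀ τ, v τ = 0 → Commute (r φ ^ m) (r τ) := by
  have := hfin.to_subtype
  have hmem : ∀ ψ : G, ∀ x : (r '' {g | v g = 0} : Set M),
      r ψ * x * r ψ⁻¹ ∈ r '' {g | v g = 0} := by
    rintro ψ ⟨-, τ, hτ, rfl⟩
    refine ⟨ψ * τ * ψ⁻¹, ?_, by simp⟩
    simp only [Set.mem_ofPred_eq] at hτ ⊢
    rw [hv, hv, valuation_inv hv, hτ]
    ring
  let e : Equiv.Perm (r '' {g | v g = 0} : Set M) :=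
    { toFun x := ⟨r φ * x * r φ⁻¹, hmem φ x⟩
      invFun x := ⟨r φ⁻¹ * x * r φ, by simpa using hmem φ⁻¹ x⟩
      left_inv x := by
        ext
        simp only [← mul_assoc, ← map_mul]
        rw [inv_mul_cancel, map_one, one_mul, mul_assoc, ← map_mul, inv_mul_cancel, map_one,
          mul_one]
      right_inv x := by
        ext
        simp only [← mul_assoc, ← map_mul]
        rw [mul_inv_cancel, map_one, one_mul, mul_assoc, ← map_mul, mul_inv_cancel, map_one,
          mul_one] }
  have he : ∀ (m : ℕ) x, ((e ^ m) x : M) = r φ ^ m * x * r (φ⁻¹) ^ m := by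
    intro m
    induction m with
    | zero => simp
    | succ m ih =>
      intro x
      rw [pow_succ', Equiv.Perm.mul_apply]
      change r φ * ((e ^ m) x : M) * r φ⁻¹ = _
      rw [ih, pow_succ', pow_succ]
      simp only [mul_assoc]
  have := Fintype.ofFinite (r '' {g | v g = 0} : Set M)
  refine ⟨orderOf e, orderOf_pos e, fun τ hτ => ?_⟩
  have h := he (orderOf e) ⟨r τ, τ, hτ, rfl⟩
  rw [pow_orderOf_eq_one, Equiv.Perm.one_apply] at h
  have h2 : r (φ⁻¹) ^ orderOf e * r φ ^ orderOf e = 1 := by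
    rw [← map_pow, ← map_pow, ← map_mul, inv_pow, inv_mul_cancel, map_one]
  change r τ = r φ ^ orderOf e * r τ * r φ⁻¹ ^ orderOf e at h
  calc r φ ^ orderOf e * r τ
      = r φ ^ orderOf e * r τ * (r φ⁻¹ ^ orderOf e * r φ ^ orderOf e) := by rw [h2, mul_one]
    _ = r τ * r φ ^ orderOf e := by rw [← mul_assoc, ← h]

end FiniteInertia

section JordanRep

variable {F V : Type*} [Field F] [IsAlgClosed F] [AddCommGroup V] [Module F V]
  [FiniteDimensional F V]

/-- If `f` commutes with `N` up to a scalar, then the semisimple part does so with the same scalar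
and the unipotent part commutes with `N`. -/
theorem IsMulJordan.commute_unipotent_of_smul {f s u N : Module.End F V} (h : IsMulJordan f s u)
    (hs : IsUnit s) (c : F) (hN : f * N = c • (N * f)) : s * N = c • (N * s) ∧ Commute u N := by
  have h' : IsMulJordan (c • f) (c • s) u := by
    refine ⟨?_, ?_, Module.End.IsSemisimple_smul c h.semisimple, h.unipotent⟩
    · rw [h.eq_mul, smul_mul_assoc]
    · rw [h.eq_mul', mul_smul_comm]
  have hsN : s * N = c • (N * s) := by
    rw [h.intertwine h' (by rw [hN, mul_smul_comm]), mul_smul_comm]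
  refine ⟨hsN, hs.mul_left_cancel ?_⟩
  rw [← mul_assoc, ← mul_assoc, ← h.eq_mul, hN, hsN, smul_mul_assoc, mul_assoc, ← h.eq_mul]

/-- The unipotent part of `f` commutes with everything that a power of `f` commutes with. -/
theorem IsMulJordan.commute_unipotent_of_pow [CharZero F] {f s u X : Module.End F V}
    (h : IsMulJordan f s u) (hs : IsUnit s) {m : ℕ} (hm : 0 < m) (hX : Commute (f ^ m) X) :
    Commute u X := by
  have hum : IsNilpotent (u ^ m - 1) := by
    rw [← geom_sum_mul]
    exact Commute.isNilpotent_mul_left (Commute.sum_left _ _ _ fun i _ =>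
      ((Commute.refl u).pow_left i).sub_right (Commute.one_right _)) h.unipotent
  have h' : IsMulJordan (f ^ m) (s ^ m) (u ^ m) := by
    refine ⟨?_, ?_, h.semisimple.pow m, hum⟩
    · rw [h.eq_mul, h.commute.mul_pow]
    · rw [h.eq_mul', h.commute.symm.mul_pow]
  have h2 := h'.commute_unipotent_of_smul (hs.pow m) 1 (N := X) (by rw [one_smul]; exact hX)
  exact commute_of_commute_pow h.unipotent hm h2.2

theorem IsMulJordan.unique {f s u s' u' : Module.End F V} (h : IsMulJordan f s u)
    (h' : IsMulJordan f s' u') (hs : IsUnit s) : s = s' ∧ u = u' := by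
  have : s = s' := by simpa using h.intertwine h' (X := 1) (by simp)
  refine ⟨this, hs.mul_left_cancel ?_⟩
  rw [← h.eq_mul, this, ← h'.eq_mul]

end JordanRep

section WeilFacts

variable {ℓ : ℕ} [Fact ℓ.Prime] {K : Type*} [Field K] [Algebra ℚ_[ℓ] K] [FiniteDimensional ℚ_[ℓ] K]

theorem inertiaGroup_eq : (inertiaGroup ℓ K : Set (weilGroup ℓ K)) = {σ | weilVal ℓ K σ = 0} := by
  ext σ
  rw [SetLike.mem_coe, inertiaGroup, MonoidHom.mem_ker, Set.mem_ofPred_eq]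
  change galActRes ℓ K σ = 1 ↔ _
  rw [← geomFrob_zpow_weilVal]
  constructor
  · intro h
    exact geomFrob_zpow_injective ℓ K (by simpa using h)
  · intro h
    rw [h, zpow_zero]

variable (ℓ K)

/-- The character `σ ↦ q ^ (-v(σ))` of the Weil group, `|Art⁻¹|` for the normalisation sending
uniformizers to geometric Frobenii. -/
def normChar (F : Type*) [Field F] [CharZero F] : weilGroup ℓ K →* F where
  toFun σ := (resCard ℓ K : F) ^ (-weilVal ℓ K σ)
  map_one' := by rw [valuation_one (weilVal_mul ℓ K), neg_zero, zpow_zero]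
  map_mul' σ τ := by
    rw [weilVal_mul, neg_add, zpow_add₀ (resCard_cast_ne_zero ℓ K F)]

theorem normChar_apply (F : Type*) [Field F] [CharZero F] (σ : weilGroup ℓ K) :
    normChar ℓ K F σ = (resCard ℓ K : F) ^ (-weilVal ℓ K σ) := rfl

theorem normChar_ne_zero (F : Type*) [Field F] [CharZero F] (σ : weilGroup ℓ K) :
    normChar ℓ K F σ ≠ 0 := zpow_ne_zero _ (resCard_cast_ne_zero ℓ K F)

theorem one_lt_resCard : 1 < resCard ℓ K := by
  obtain ⟨f, hf0, hf⟩ := exists_resCard_eq ℓ K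
  rw [hf]
  exact Nat.one_lt_pow hf0 (Fact.out : ℓ.Prime).one_lt

variable {ℓ K}

/-- Over a field of characteristic zero the defining relation, which has no denominators, can be
divided by powers of `q`. -/
theorem WDData.IsWeilDeligne.mul_eq {ι F : Type*} [Fintype ι] [DecidableEq ι] [Field F] [CharZero F]
    {ρ : WDData ℓ K ι F} (h : ρ.IsWeilDeligne) (σ : weilGroup ℓ K) :
    ρ.r σ * ρ.N = normChar ℓ K F σ • (ρ.N * ρ.r σ) := by
  have hq := resCard_cast_ne_zero ℓ K F
  have h1 := congrArg (fun X => ((resCard ℓ K : F) ^ (weilVal ℓ K σ).toNat)⁻¹ • X) (h.relation σ)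
  simp only [smul_smul] at h1
  rw [inv_mul_cancel₀ (pow_ne_zero _ hq), one_smul] at h1
  rw [h1, normChar_apply, ← zpow_natCast, ← zpow_natCast, ← zpow_neg, ← zpow_add₀ hq]
  congr 2
  omega

theorem WDData.IsWeilDeligne.of_mul_eq {ι F : Type*} [Fintype ι] [DecidableEq ι] [Field F]
    [CharZero F] {ρ : WDData ℓ K ι F} (hN : IsNilpotent ρ.N)
    (hfin : (ρ.r '' (inertiaGroup ℓ K : Set (weilGroup ℓ K))).Finite)
    (h : ∀ σ, ρ.r σ * ρ.N = normChar ℓ K F σ • (ρ.N * ρ.r σ)) : ρ.IsWeilDeligne := by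
  refine ⟨hN, hfin, fun σ => ?_⟩
  have hq := resCard_cast_ne_zero ℓ K F
  rw [h, smul_smul, normChar_apply, ← zpow_natCast, ← zpow_natCast, ← zpow_add₀ hq]
  congr 2
  omega

theorem WDData.IsWeilDeligne.map {ι A B : Type*} [Fintype ι] [DecidableEq ι] [CommRing A]
    [CommRing B] {ρ : WDData ℓ K ι A} (h : ρ.IsWeilDeligne) (g : A →+* B) :
    (ρ.map g).IsWeilDeligne := by
  refine ⟨h.nilpotent.map g.mapMatrix, ?_, fun σ => ?_⟩
  · have : ⇑(ρ.map g).r = g.mapMatrix ∘ ρ.r := rfl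
    rw [this, Set.image_comp]
    exact h.finite_inertia.image _
  · have := congrArg (fun X => X.map g) (h.relation σ)
    simp only [Matrix.map_smul' g _ _ (map_mul g), Matrix.map_mul, map_pow, map_natCast] at this
    exact this

end WeilFacts

section FrobSS

variable {ℓ : ℕ} [Fact ℓ.Prime] {K : Type*} [Field K] [Algebra ℚ_[ℓ] K] [FiniteDimensional ℚ_[ℓ] K]
  {ι F : Type*} [Fintype ι] [DecidableEq ι] [Field F]
  {φ : weilGroup ℓ K} {ρ ρ' : WDData ℓ K ι F}

theorem isUnit_of_monoidHom {G M : Type*} [Group G] [Monoid M] (r : G →* M) (g : G) :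
    IsUnit (r g) := (Group.isUnit g).map r

theorem WDData.IsFrobSemisimplification.semisimple (hφ : weilVal ℓ K φ = 1)
    (h' : WDData.IsFrobSemisimplification φ ρ ρ') :
    Module.End.IsSemisimple (Matrix.toLin' (ρ'.r φ)) := by
  obtain ⟨s, u, h1, h2, hs, hu, hr, hN⟩ := h'
  have : ρ'.r φ = s := by
    rw [hr, h1, hφ, mul_assoc, zpow_neg_one, Units.mul_inv, mul_one]
  rwa [this]

variable [IsAlgClosed F]

/-- The Frobenius-semisimplification is unique on the nose, and not only up to isomorphism, by the
uniqueness of the Jordan decomposition of `r(φ)`. -/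
theorem WDData.IsFrobSemisimplification.unique {ρ₁ ρ₂ : WDData ℓ K ι F}
    (h₁ : WDData.IsFrobSemisimplification φ ρ ρ₁) (h₂ : WDData.IsFrobSemisimplification φ ρ ρ₂) :
    ρ₁ = ρ₂ := by
  let e := (Matrix.toLinAlgEquiv' : Matrix ι ι F ≃ₐ[F] ((ι → F) →ₗ[F] (ι → F)))
  obtain ⟨s₁, u₁, h1, h2, hs, hu, hr, hN⟩ := h₁
  obtain ⟨s₂, u₂, h1', h2', hs', hu', hr', hN'⟩ := h₂
  have hJ : IsMulJordan (e (ρ.r φ)) (e s₁) (e u₁) :=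
    ⟨by rw [h1, map_mul], by rw [h2, map_mul], hs, by
      have := hu.map e
      rwa [map_sub, map_one] at this⟩
  have hJ' : IsMulJordan (e (ρ.r φ)) (e s₂) (e u₂) :=
    ⟨by rw [h1', map_mul], by rw [h2', map_mul], hs', by
      have := hu'.map e
      rwa [map_sub, map_one] at this⟩
  have hsu : IsUnit (e s₁) := by
    have h3 : IsUnit (s₁ * u₁) := h1 ▸ isUnit_of_monoidHom ρ.r φ
    have hc : Commute s₁ (u₁ : Matrix ι ι F) := h1.symm.trans h2
    exact (hc.isUnit_mul_iff.mp h3).1.map e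
  have hu12 : u₁ = u₂ := Units.ext (e.injective (hJ.unique hJ' hsu).2)
  obtain ⟨r₁, N₁⟩ := ρ₁
  obtain ⟨r₂, N₂⟩ := ρ₂
  obtain rfl : N₁ = N₂ := hN.trans hN'.symm
  obtain rfl : r₁ = r₂ := MonoidHom.ext fun σ => by
    have := hr σ
    rw [hu12] at this
    exact this.trans (hr' σ).symm
  rfl

variable [CharZero F]

/-- The unipotent part `u` of `r(φ)` commutes with the whole Weil-Deligne representation. It
commutes with the image of inertia because a power of `r(φ)` does. -/
theorem WDData.IsWeilDeligne.commute_unipotent (hφ : weilVal ℓ K φ = 1) (h : ρ.IsWeilDeligne)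
    {s u : Matrix ι ι F} (h1 : ρ.r φ = s * u) (h2 : ρ.r φ = u * s)
    (hs : Module.End.IsSemisimple (Matrix.toLin' s)) (hu : IsNilpotent (u - 1)) :
    (∀ σ, Commute u (ρ.r σ)) ∧ Commute u ρ.N ∧ s * ρ.N = normChar ℓ K F φ • (ρ.N * s) := by
  let e := (Matrix.toLinAlgEquiv' : Matrix ι ι F ≃ₐ[F] ((ι → F) →ₗ[F] (ι → F)))
  have hcomm : ∀ {x y : Matrix ι ι F}, Commute (e x) (e y) → Commute x y := fun {x y} hxy =>
    e.injective (by rw [map_mul, map_mul]; exact hxy)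
  have hJ : IsMulJordan (e (ρ.r φ)) (e s) (e u) :=
    ⟨by rw [h1, map_mul], by rw [h2, map_mul], hs, by
      have := hu.map e
      rwa [map_sub, map_one] at this⟩
  have hsu : IsUnit (e s) := by
    have h3 : IsUnit (s * u) := h1 ▸ isUnit_of_monoidHom ρ.r φ
    have hc : Commute s u := h1.symm.trans h2
    exact (hc.isUnit_mul_iff.mp h3).1.map e
  have hφu : Commute u (ρ.r φ) := by
    have hc : Commute s u := h1.symm.trans h2
    rw [h1]
    exact hc.symm.mul_right (Commute.refl u)
  obtain ⟨m, hm, hcm⟩ := exists_pow_commute (weilVal_mul ℓ K) φ ρ.r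
    (inertiaGroup_eq (ℓ := ℓ) (K := K) ▸ h.finite_inertia)
  have hI : ∀ τ, weilVal ℓ K τ = 0 → Commute u (ρ.r τ) := fun τ hτ =>
    hcomm (hJ.commute_unipotent_of_pow hsu hm (by
      rw [← map_pow]
      exact (hcm τ hτ).map e))
  refine ⟨fun σ => ?_, ?_⟩
  · have hσ : σ = φ ^ weilVal ℓ K σ * (φ ^ (-weilVal ℓ K σ) * σ) := by
      rw [← mul_assoc, ← zpow_add]; simp
    rw [hσ, map_mul]
    refine Commute.mul_right ?_ (hI _ ?_)
    · have hz : ∀ z : ℤ, Commute u (ρ.r (φ ^ z)) := by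
        intro z
        have h3 : Commute u (ρ.r φ⁻¹) := by
          have : Commute u (((Units.map ρ.r (toUnits φ))⁻¹ : (Matrix ι ι F)ˣ) : Matrix ι ι F) :=
            Commute.units_inv_right hφu
          exact this
        rcases Int.eq_nat_or_neg z with ⟨k, rfl | rfl⟩
        · rw [zpow_natCast, map_pow]; exact hφu.pow_right k
        · rw [zpow_neg, zpow_natCast, ← inv_pow, map_pow]; exact h3.pow_right k
      exact hz _
    · rw [weilVal_mul, valuation_zpow (weilVal_mul ℓ K), hφ]; ring
  · have := hJ.commute_unipotent_of_smul hsu (normChar ℓ K F φ) (N := e ρ.N) (by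
      rw [← map_mul, h.mul_eq, map_smul, map_mul])
    refine ⟨hcomm this.2, e.injective ?_⟩
    rw [map_mul, map_smul, map_mul, this.1]

theorem commute_unipotent_zpow {R : Type*} [Monoid R] {u : Rˣ} {x : R} (h : Commute (u : R) x)
    (n : ℤ) : Commute ((u ^ n : Rˣ) : R) x := by
  rcases Int.eq_nat_or_neg n with ⟨k, rfl | rfl⟩
  · rw [zpow_natCast, Units.val_pow_eq_pow_val]; exact h.pow_left k
  · rw [zpow_neg, zpow_natCast, ← inv_pow, Units.val_pow_eq_pow_val]
    exact h.units_inv_left.pow_left k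

theorem isNilpotent_unipotent_zpow {R : Type*} [Ring R] {u : Rˣ} (h : IsNilpotent ((u : R) - 1))
    (n : ℤ) : IsNilpotent (((u ^ n : Rˣ) : R) - 1) := by
  have hpow : ∀ {w : R}, IsNilpotent (w - 1) → ∀ k : ℕ, IsNilpotent (w ^ k - 1) := by
    intro w hw k
    rw [← geom_sum_mul]
    exact Commute.isNilpotent_mul_left (Commute.sum_left _ _ _ fun i _ =>
      ((Commute.refl w).pow_left i).sub_right (Commute.one_right _)) hw
  have hinv : IsNilpotent (((u⁻¹ : Rˣ) : R) - 1) := by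
    have : ((u⁻¹ : Rˣ) : R) - 1 = -(((u⁻¹ : Rˣ) : R) * ((u : R) - 1)) := by
      rw [mul_sub, Units.inv_mul, mul_one, neg_sub]
    rw [this]
    exact (Commute.isNilpotent_mul_left
      (((Commute.refl (u : R)).units_inv_left).sub_right (Commute.one_right _)) h).neg
  rcases Int.eq_nat_or_neg n with ⟨k, rfl | rfl⟩
  · rw [zpow_natCast, Units.val_pow_eq_pow_val]; exact hpow h k
  · rw [zpow_neg, zpow_natCast, ← inv_pow, Units.val_pow_eq_pow_val]; exact hpow hinv k

/-- The Frobenius-semisimplification `σ ↦ r(σ) u ^ (-v(σ))`, a homomorphism since `u` is central. -/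
theorem WDData.IsWeilDeligne.exists_frobSemisimplification (hφ : weilVal ℓ K φ = 1)
    (h : ρ.IsWeilDeligne) : ∃ ρ', WDData.IsFrobSemisimplification φ ρ ρ' := by
  let e := (Matrix.toLinAlgEquiv' : Matrix ι ι F ≃ₐ[F] ((ι → F) →ₗ[F] (ι → F)))
  obtain ⟨s, u, hsu, huu, hJ⟩ := exists_isMulJordan (f := e (ρ.r φ))
    ((isUnit_of_monoidHom ρ.r φ).map e)
  obtain ⟨s, rfl⟩ := e.surjective s
  obtain ⟨u, rfl⟩ := e.surjective u
  have huu : IsUnit u := by simpa using huu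
  obtain ⟨u, rfl⟩ := huu
  have h1 : ρ.r φ = s * u := e.injective (by rw [hJ.eq_mul, map_mul])
  have h2 : ρ.r φ = u * s := e.injective (by rw [hJ.eq_mul', map_mul])
  have hu : IsNilpotent ((u : Matrix ι ι F) - 1) := by
    have := hJ.unipotent.map e.symm
    rwa [map_sub, map_one, AlgEquiv.symm_apply_apply] at this
  obtain ⟨hc, -, -⟩ := h.commute_unipotent hφ h1 h2 hJ.semisimple hu
  refine ⟨⟨{ toFun σ := ρ.r σ * ((u ^ (-weilVal ℓ K σ) : (Matrix ι ι F)ˣ) : Matrix ι ι F)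
             map_one' := ?_
             map_mul' σ τ := ?_ }, ρ.N⟩, s, u, h1, h2, hJ.semisimple, hu, fun σ => rfl, rfl⟩
  · rw [valuation_one (weilVal_mul ℓ K)]; simp
  · rw [weilVal_mul, neg_add, zpow_add, Units.val_mul, map_mul, mul_assoc, mul_assoc]
    congr 1
    rw [← mul_assoc, ← mul_assoc, (commute_unipotent_zpow (hc τ) _).eq]

theorem WDData.IsFrobSemisimplification.isWeilDeligne (hφ : weilVal ℓ K φ = 1)
    (h : ρ.IsWeilDeligne) (h' : WDData.IsFrobSemisimplification φ ρ ρ') :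
    ρ'.IsWeilDeligne := by
  obtain ⟨s, u, h1, h2, hs, hu, hr, hN⟩ := h'
  obtain ⟨hc, hcN, -⟩ := h.commute_unipotent hφ h1 h2 hs hu
  refine .of_mul_eq (hN ▸ h.nilpotent) ?_ fun σ => ?_
  · convert h.finite_inertia using 1
    refine Set.image_congr fun τ hτ => ?_
    rw [inertiaGroup_eq] at hτ
    rw [hr, show weilVal ℓ K τ = 0 from hτ]
    simp
  · rw [hr, hN, mul_assoc, (commute_unipotent_zpow hcN _).eq, ← mul_assoc, h.mul_eq,
      smul_mul_assoc, mul_assoc]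

/-- The traces are unchanged since `r(σ)` and `r(σ) u ^ (-v(σ))` differ by a nilpotent matrix. -/
theorem WDData.IsFrobSemisimplification.trace_eq (hφ : weilVal ℓ K φ = 1)
    (h : ρ.IsWeilDeligne) (h' : WDData.IsFrobSemisimplification φ ρ ρ') (σ : weilGroup ℓ K) :
    (ρ'.r σ).trace = (ρ.r σ).trace := by
  obtain ⟨s, u, h1, h2, hs, hu, hr, hN⟩ := h'
  obtain ⟨hc, -, -⟩ := h.commute_unipotent hφ h1 h2 hs hu
  rw [← sub_eq_zero, ← Matrix.trace_sub, hr, ← mul_sub_one]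
  refine IsNilpotent.eq_zero (Matrix.isNilpotent_trace_of_isNilpotent ?_)
  exact Commute.isNilpotent_mul_left (((commute_unipotent_zpow (hc σ) _).symm).sub_right
    (Commute.one_right _)) (isNilpotent_unipotent_zpow hu _)

end FrobSS

/-! ### Semisimplicity of Frobenius-semisimple representations -/

section Complements

variable {G F V : Type*} [Group G] [Field F] [AddCommGroup V] [Module F V]

/-- Stability of a subspace under a group representation. -/
def StableUnder (r : G →* Module.End F V) (p : Submodule F V) : Prop :=
  ∀ g, ∀ x ∈ p, r g x ∈ p

theorem commute_map_zpow {M : Type*} [Monoid M] (r : G →* M) {g : G} {x : M}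
    (h : Commute (r g) x) (n : ℤ) : Commute (r (g ^ n)) x := by
  have := commute_unipotent_zpow (u := Units.map r (toUnits g)) h n
  rwa [← map_zpow, ← map_zpow] at this

/-- Averaging a projection over its conjugates, provided that there are finitely many of these. -/
theorem exists_stable_isCompl_of_finite [CharZero F] {r : G →* Module.End F V} {U : Submodule F V}
    (hU : StableUnder r U) {π : Module.End F V} (hπ : LinearMap.IsProj U π)
    (hfin : (Set.range fun g => r g * π * r g⁻¹).Finite) :
    ∃ W, StableUnder r W ∧ IsCompl U W := by
  classical
  let O := hfin.toFinset
  have hO : ∀ x ∈ O, LinearMap.IsProj U x := by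
    intro x hx
    obtain ⟨g, rfl⟩ := hfin.mem_toFinset.mp hx
    refine ⟨fun y => hU g _ (hπ.map_mem _), fun y hy => ?_⟩
    rw [Module.End.mul_apply, Module.End.mul_apply, hπ.map_id _ (hU _ _ hy),
      ← Module.End.mul_apply, ← map_mul, mul_inv_cancel, map_one, Module.End.one_apply]
  have hcard : (O.card : F) ≠ 0 := by
    rw [Nat.cast_ne_zero, Finset.card_ne_zero]
    exact ⟨_, hfin.mem_toFinset.mpr ⟨1, rfl⟩⟩
  have hconj : ∀ g, r g * (∑ x ∈ O, x) * r g⁻¹ = ∑ x ∈ O, x := by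
    intro g
    rw [Finset.mul_sum, Finset.sum_mul]
    have hmem : ∀ h, ∀ x ∈ O, r h * x * r h⁻¹ ∈ O := by
      intro h x hx
      obtain ⟨k, rfl⟩ := hfin.mem_toFinset.mp hx
      refine hfin.mem_toFinset.mpr ⟨h * k, ?_⟩
      simp only [map_mul, mul_inv_rev, mul_assoc]
    have hinv : ∀ h, ∀ x : Module.End F V, r h⁻¹ * (r h * x * r h⁻¹) * r h = x := by
      intro h x
      rw [← mul_assoc, ← mul_assoc, ← map_mul, inv_mul_cancel, map_one, one_mul, mul_assoc,
        ← map_mul, inv_mul_cancel, map_one, mul_one]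
    refine Finset.sum_bij' (fun x _ => r g * x * r g⁻¹) (fun x _ => r g⁻¹ * x * r g)
      (fun x hx => hmem g x hx) (fun x hx => by simpa using hmem g⁻¹ x hx)
      (fun x _ => hinv g x) (fun x _ => by simpa using hinv g⁻¹ x) (fun x _ => rfl)
  let P : Module.End F V := (O.card : F)⁻¹ • ∑ x ∈ O, x
  have hP : LinearMap.IsProj U P := by
    refine ⟨fun y => ?_, fun y hy => ?_⟩
    · rw [LinearMap.smul_apply, LinearMap.sum_apply]
      exact U.smul_mem _ (U.sum_mem fun x hx => (hO x hx).map_mem y)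
    · rw [LinearMap.smul_apply, LinearMap.sum_apply,
        Finset.sum_congr rfl fun x hx => (hO x hx).map_id y hy, Finset.sum_const,
        ← Nat.cast_smul_eq_nsmul F, smul_smul, inv_mul_cancel₀ hcard, one_smul]
  refine ⟨LinearMap.ker P, fun g x hx => ?_, hP.isCompl⟩
  have hcomm : P * r g = r g * P := by
    have h1 : (∑ x ∈ O, x) * r g = r g * ∑ x ∈ O, x := by
      conv_lhs => rw [← hconj g]
      rw [mul_assoc, ← map_mul, inv_mul_cancel, map_one, mul_one]
    simp only [P, smul_mul_assoc, mul_smul_comm, h1]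
  rw [LinearMap.mem_ker] at hx ⊢
  rw [← Module.End.mul_apply, hcomm, Module.End.mul_apply, hx, map_zero]

variable {v : G → ℤ}

/-- A power `z` of the Frobenius is central in the image; a projection commuting with the
semisimple operator `z` has only finitely many conjugates. -/
theorem exists_stable_isCompl [CharZero F] (hv : ∀ a b, v (a * b) = v a + v b) {φ : G}
    (hφ : v φ = 1) {r : G →* Module.End F V} [FiniteDimensional F V]
    (hfin : (r '' {g | v g = 0}).Finite) (hss : (r φ).IsSemisimple) {U : Submodule F V}
    (hU : StableUnder r U) : ∃ W, StableUnder r W ∧ IsCompl U W := by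
  obtain ⟨m, hm, hcm⟩ := exists_pow_commute hv φ r hfin
  obtain ⟨q, hq, hUq⟩ := Module.End.isSemisimple_iff.mp (hss.pow m) U (by
    rw [← map_pow]; exact fun x hx => hU _ x hx)
  have hπ : LinearMap.IsProj U (U.projection q hUq) :=
    ⟨fun x => Submodule.projection_apply_mem _ _, fun x hx =>
      Submodule.projection_apply_left hUq ⟨x, hx⟩⟩
  set π := U.projection q hUq
  have hzπ : Commute (r (φ ^ m)) π := by
    ext x
    obtain ⟨y, z, rfl⟩ : ∃ y : U, ∃ z : q, (y : V) + z = x := by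
      obtain ⟨y, hy, z, hz, rfl⟩ := Submodule.mem_sup.mp
        (hUq.sup_eq_top ▸ Submodule.mem_top : x ∈ U ⊔ q)
      exact ⟨⟨y, hy⟩, ⟨z, hz⟩, rfl⟩
    have h1 : π y = y := hπ.map_id y y.2
    have h2 : π z = 0 := Submodule.projection_apply_right hUq z
    have h3 : π (r (φ ^ m) y) = r (φ ^ m) y := hπ.map_id _ (hU _ _ y.2)
    have h4 : π (r (φ ^ m) z) = 0 := by
      have : r (φ ^ m) z ∈ q := by rw [map_pow]; exact hq z.2
      exact Submodule.projection_apply_right hUq ⟨_, this⟩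
    rw [Module.End.mul_apply, Module.End.mul_apply, map_add, map_add, map_add, map_add, h1, h2, h3,
      h4, map_zero]
  refine exists_stable_isCompl_of_finite hU hπ ?_
  -- every `g` is `φ ^ i z τ` with `0 ≤ i < m`, `z` a power of `φ ^ m` and `τ` in the kernel of
  -- `v`; the conjugate of `π` under `g` depends only on `i` and on the images of `τ` and `τ⁻¹`
  have hfinite : (Set.image2 (fun (i : ℕ) (w : Module.End F V × Module.End F V) =>
      r (φ ^ i) * (w.1 * π * w.2) * r (φ ^ i)⁻¹) (Set.Iio m)
      ((r '' {g | v g = 0}) ×ˢ (r '' {g | v g = 0}))).Finite :=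
    Set.Finite.image2 _ (Set.finite_Iio m) (hfin.prod hfin)
  refine hfinite.subset ?_
  rintro - ⟨g, rfl⟩
  let τ := φ ^ (-v g) * g
  have hτ : v τ = 0 := by rw [hv, valuation_zpow hv, hφ]; ring
  have hτ' : v τ⁻¹ = 0 := by rw [valuation_inv hv, hτ, neg_zero]
  have hm' : (m : ℤ) ≠ 0 := by exact_mod_cast hm.ne'
  obtain ⟨i, hi⟩ := Int.eq_ofNat_of_zero_le (Int.emod_nonneg (v g) hm')
  have him : i < m := by
    have := Int.emod_lt_of_pos (v g) (by exact_mod_cast hm : (0 : ℤ) < m)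
    omega
  have hg : g = φ ^ i * (φ ^ m) ^ (v g / m) * τ := by
    have : φ ^ i * (φ ^ m) ^ (v g / m) = φ ^ v g := by
      rw [← zpow_natCast, ← zpow_natCast, ← zpow_mul, ← zpow_add, ← hi, Int.emod_add_mul_ediv]
    rw [this, ← mul_assoc, ← zpow_add, add_neg_cancel, zpow_zero, one_mul]
  refine Set.mem_image2.mpr ⟨i, him, (r τ, r τ⁻¹), ⟨⟨τ, hτ, rfl⟩, ⟨τ⁻¹, hτ', rfl⟩⟩, ?_⟩
  have hc : Commute (r (φ ^ m)) (r τ * π * r τ⁻¹) := by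
    refine Commute.mul_right (Commute.mul_right ?_ hzπ) ?_
    · rw [map_pow]; exact hcm τ hτ
    · rw [map_pow]; exact hcm τ⁻¹ hτ'
  have hc2 := commute_map_zpow r hc (v g / m)
  set ζ := (φ ^ m) ^ (v g / m)
  have : r ζ * (r τ * π * r τ⁻¹) * r ζ⁻¹ = r τ * π * r τ⁻¹ := by
    rw [hc2.eq, mul_assoc, ← map_mul, mul_inv_cancel, map_one, mul_one]
  rw [hg]
  simp only
  conv_lhs => rw [← this]
  simp only [map_mul, mul_inv_rev, mul_assoc]

end Complements

/-! ### Decomposition into segments -/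

section Structure

variable {G F V : Type*} [Group G] [Field F] [AddCommGroup V] [Module F V]

theorem exists_minimal_stable {r : G →* Module.End F V} {P : Submodule F V} [FiniteDimensional F P]
    (hP : StableUnder r P) (hP0 : P ≠ ⊥) :
    ∃ U ≤ P, StableUnder r U ∧ U ≠ ⊥ ∧ ∀ W ≤ U, StableUnder r W → W = ⊥ ∨ W = U := by
  induction hn : Module.finrank F P using Nat.strong_induction_on generalizing P with
  | _ n ih =>
  subst hn
  by_cases h : ∀ W ≤ P, StableUnder r W → W = ⊥ ∨ W = P
  · exact ⟨P, le_rfl, hP, hP0, h⟩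
  · push Not at h
    obtain ⟨W, hWP, hW, hW0, hWne⟩ := h
    have : FiniteDimensional F W := Submodule.finiteDimensional_of_le hWP
    obtain ⟨U, hUW, hU⟩ := ih (Module.finrank F W)
      (Submodule.finrank_lt_finrank_of_lt (lt_of_le_of_ne hWP hWne)) hW hW0 rfl
    exact ⟨U, hUW.trans hWP, hU⟩

/-- A basis of a minimal stable subspace gives an irreducible matrix representation. -/
theorem exists_matrix_of_minimal {r : G →* Module.End F V} {U : Submodule F V}
    [FiniteDimensional F U] (hU : StableUnder r U) (hU0 : U ≠ ⊥)
    (hmin : ∀ W ≤ U, StableUnder r W → W = ⊥ ∨ W = U) :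
    ∃ (d : ℕ) (s : G →* Matrix (Fin d) (Fin d) F) (e : Fin d → V), LinearIndependent F e ∧
      Submodule.span F (Set.range e) = U ∧ (∀ g a, r g (e a) = ∑ a', s g a' a • e a') ∧
      (matRep s).IsIrreducible := by
  let b := Module.finBasis F U
  let ru : G →* Module.End F U := Subrepresentation.toRepresentation (ρ := r) ⟨U, hU⟩
  have hru : ∀ g (x : U), ((ru g x : U) : V) = r g x := fun g x => rfl
  let s : G →* Matrix (Fin (Module.finrank F U)) (Fin (Module.finrank F U)) F :=
    ((LinearMap.toMatrixAlgEquiv b : Module.End F U ≃ₐ[F] _) : Module.End F U →* _).comp ru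
  have hs : ∀ g, s g = LinearMap.toMatrix b b (ru g) := fun g => rfl
  let ψ : (Fin (Module.finrank F U) → F) →ₗ[F] V := U.subtype ∘ₗ b.equivFun.symm.toLinearMap
  have hψ : ∀ g x, ψ ((s g).mulVec x) = r g (ψ x) := by
    intro g x
    change ((b.equivFun.symm ((s g).mulVec x) : U) : V) = r g (b.equivFun.symm x : U)
    rw [← hru]
    congr 1
    apply b.equivFun.injective
    rw [LinearEquiv.apply_symm_apply]
    have := LinearMap.toMatrix_mulVec_repr b b (ru g) (b.equivFun.symm x)
    have hx : ⇑(b.repr (b.equivFun.symm x)) = x := b.equivFun.apply_symm_apply x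
    rw [hx] at this
    exact this
  have hψi : Function.Injective ψ := U.injective_subtype.comp b.equivFun.symm.injective
  have hψr : LinearMap.range ψ = U := by
    rw [LinearMap.range_comp, LinearEquiv.range, Submodule.map_top, Submodule.range_subtype]
  refine ⟨Module.finrank F U, s, fun a => b a, ?_, ?_, fun g a => ?_, ?_⟩
  · exact b.linearIndependent.map' U.subtype (Submodule.ker_subtype U)
  · have : (Set.range fun a => (b a : V)) = U.subtype '' Set.range b := by
      rw [← Set.range_comp]; rfl
    rw [this, Submodule.span_image, b.span_eq, Submodule.map_top, Submodule.range_subtype]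
  · have := congrArg Subtype.val (b.sum_repr (ru g (b a)))
    rw [hru] at this
    rw [← this, Submodule.coe_sum]
    exact Finset.sum_congr rfl fun i _ => by rw [hs, LinearMap.toMatrix_apply]; rfl
  · rw [matRep_isIrreducible_iff]
    constructor
    · by_contra hne
      rw [not_nonempty_iff] at hne
      refine hU0 (Submodule.finrank_eq_zero.mp ?_)
      by_contra h0
      exact hne.false ⟨0, Nat.pos_of_ne_zero h0⟩
    · intro p hp
      rcases hmin (p.map ψ) (LinearMap.map_le_range.trans hψr.le) (by
        rintro g - ⟨x, hx, rfl⟩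
        exact ⟨_, hp g x hx, hψ g x⟩) with h | h
      · left
        apply Submodule.map_injective_of_injective hψi
        rw [h, Submodule.map_bot]
      · right
        apply Submodule.map_injective_of_injective hψi
        rw [h, Submodule.map_top, hψr]

/-- A family of vectors `b (i, a, j)` on which a representation and a nilpotent operator act as on
the standard basis of the direct sum of the `Sp_{t i} (s i)`. -/
structure IsSegmentFamily (χ : G →* F) (r : G →* Module.End F V) (N : Module.End F V)
    {ι : Type*} (t d : ι → ℕ) (s : ∀ i, G →* Matrix (Fin (d i)) (Fin (d i)) F)
    (b : (Σ i, Fin (d i) × Fin (t i)) → V) : Prop where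
  act : ∀ g i a j, r g (b ⟨i, (a, j)⟩) = ∑ a', (χ g ^ (j : ℕ) * s i g a' a) • b ⟨i, (a', j)⟩
  mono : ∀ i a j, N (b ⟨i, (a, j)⟩) =
    if h : (j : ℕ) + 1 < t i then b ⟨i, (a, ⟨j + 1, h⟩)⟩ else 0

variable {χ : G →* F} {r : G →* Module.End F V} {N : Module.End F V}

theorem act_mono_pow (hN : ∀ g, r g * N = χ g • (N * r g)) (k : ℕ) (g : G) (x : V) :
    r g ((N ^ k) x) = χ g ^ k • (N ^ k) (r g x) := by
  induction k with
  | zero => simp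
  | succ k ih =>
    have := LinearMap.congr_fun (hN g) ((N ^ k) x)
    rw [Module.End.mul_apply, LinearMap.smul_apply, Module.End.mul_apply, ih, map_smul,
      smul_smul, ← pow_succ'] at this
    rw [pow_succ', Module.End.mul_apply, this, Module.End.mul_apply]

theorem mono_pow_act (hN : ∀ g, r g * N = χ g • (N * r g)) (k : ℕ) (g : G) (x : V) :
    (N ^ k) (r g x) = (χ g ^ k)⁻¹ • r g ((N ^ k) x) := by
  have hχ : χ g ≠ 0 := (isUnit_of_monoidHom χ g).ne_zero
  rw [act_mono_pow hN, smul_smul, inv_mul_cancel₀ (pow_ne_zero _ hχ), one_smul]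

/-- The sum `U + N U + … + N ^ (t - 1) U` is direct and meets the space of all `x` with `N ^ k x ∈
C` for `k < t` in zero, provided that `N ^ (t - 1)` is injective on `U` modulo `C`: applying `N ^ (t
- 1 - j)` isolates the first nonzero summand `N ^ j (u j)`. -/
theorem eq_zero_of_sum_pow_mem {U C : Submodule F V} {t : ℕ}
    (hC : ∀ x ∈ U, (N ^ t) x = 0) (hUC : ∀ x ∈ U, (N ^ (t - 1)) x ∈ C → x = 0) (u : Fin t → V)
    (hu : ∀ j, u j ∈ U) (h : ∀ k < t, (N ^ k) (∑ j : Fin t, (N ^ (j : ℕ)) (u j)) ∈ C) :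
    ∀ j, u j = 0 := by
  have key : ∀ n : ℕ, ∀ j : Fin t, (j : ℕ) = n → u j = 0 := by
    intro n
    induction n using Nat.strong_induction_on with
    | _ n ih =>
    rintro j rfl
    refine hUC _ (hu j) ?_
    have h1 := h (t - 1 - j) (by omega)
    rw [map_sum, Finset.sum_eq_single j] at h1
    · rwa [← Module.End.mul_apply, ← pow_add, Nat.sub_add_cancel (by omega)] at h1
    · intro i _ hij
      rcases lt_or_gt_of_ne (Fin.val_ne_of_ne hij) with hlt | hgt
      · rw [ih i hlt i rfl, map_zero, map_zero]
      · have : t - 1 - j + i = (t - 1 - j + i - t) + t := by omega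
        rw [← Module.End.mul_apply, ← pow_add, this, pow_add, Module.End.mul_apply,
          hC _ (hu i), map_zero]
    · simp
  exact fun j => key j j rfl

/-- The inductive step of the structure theorem splits off the segment generated by an irreducible
subspace `U` on which the top power `N ^ (t - 1)` does not vanish: if `C'` is a stable complement of
`N ^ (t - 1) U`, a stable complement of `U ⊕ N U ⊕ … ⊕ N ^ (t - 1) U` is formed by the vectors `x`
with `N ^ k x ∈ C'` for all `k < t`. -/
theorem exists_segmentFamily_of_stable [FiniteDimensional F V]
    (hN : ∀ g, r g * N = χ g • (N * r g)) (hnil : IsNilpotent N)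
    (hcompl : ∀ U, StableUnder r U → ∃ W, StableUnder r W ∧ IsCompl U W)
    (C : Submodule F V) (hC : StableUnder r C) (hNC : ∀ x ∈ C, N x ∈ C) :
    ∃ (ι : Type) (_ : Fintype ι) (t d : ι → ℕ) (s : ∀ i, G →* Matrix (Fin (d i)) (Fin (d i)) F)
      (b : (Σ i, Fin (d i) × Fin (t i)) → V), (∀ i, 0 < t i) ∧
      (∀ i, (matRep (s i)).IsIrreducible) ∧ IsSegmentFamily χ r N t d s b ∧
      LinearIndependent F b ∧ Submodule.span F (Set.range b) = C := by
  induction hn : Module.finrank F C using Nat.strong_induction_on generalizing C with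
  | _ n ih =>
  subst hn
  by_cases hC0 : C = ⊥
  · subst hC0
    refine ⟨Empty, inferInstance, Empty.elim, Empty.elim, fun i => i.elim, fun x => x.1.elim,
      fun i => i.elim, fun i => i.elim, ⟨fun _ i => i.elim, fun i => i.elim⟩,
      linearIndependent_empty_type, ?_⟩
    rw [Set.range_eq_empty, Submodule.span_empty]
  have hNkC : ∀ k, ∀ x ∈ C, (N ^ k) x ∈ C := by
    intro k
    induction k with
    | zero => exact fun x hx => hx
    | succ k ihk =>
      intro x hx
      rw [pow_succ', Module.End.mul_apply]
      exact hNC _ (ihk x hx)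
  -- `t` is the nilpotency index of `N` on `C`
  have hex : ∃ t, ∀ x ∈ C, (N ^ t) x = 0 := by
    obtain ⟨t, ht⟩ := hnil
    exact ⟨t, fun x _ => by rw [ht]; rfl⟩
  classical
  obtain ⟨t, ht, htmin⟩ : ∃ t, (∀ x ∈ C, (N ^ t) x = 0) ∧ ∀ k < t, ∃ x ∈ C, (N ^ k) x ≠ 0 := by
    refine ⟨Nat.find hex, Nat.find_spec hex, fun k hk => ?_⟩
    have := Nat.find_min hex hk
    push Not at this
    exact this
  have ht0 : 0 < t := by
    by_contra h0
    obtain rfl : t = 0 := by omega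
    exact hC0 ((Submodule.eq_bot_iff _).mpr fun x hx => ht x hx)
  obtain ⟨x0, hx0C, hx0⟩ := htmin (t - 1) (by omega)
  -- `U` is found in a stable complement of the kernel of `N ^ (t - 1)`
  let Z : Submodule F V := LinearMap.ker (N ^ (t - 1))
  have hZ : StableUnder r Z := by
    intro g x hx
    rw [LinearMap.mem_ker] at hx ⊢
    rw [mono_pow_act hN, hx, map_zero, smul_zero]
  -- a minimal stable subspace `U` of `C` on which `N ^ (t - 1)` is injective
  obtain ⟨W, hW, hZW⟩ := hcompl (Z ⊓ C) fun g x hx => ⟨hZ g x hx.1, hC g x hx.2⟩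
  have hWC0 : W ⊓ C ≠ ⊥ := by
    intro h0
    obtain ⟨y, hy, w, hw, hyw⟩ := Submodule.mem_sup.mp
      (hZW.sup_eq_top ▸ Submodule.mem_top : x0 ∈ Z ⊓ C ⊔ W)
    have hwC : w ∈ W ⊓ C := ⟨hw, by
      rw [← eq_sub_iff_add_eq'] at hyw
      rw [hyw]; exact C.sub_mem hx0C hy.2⟩
    rw [h0, Submodule.mem_bot] at hwC
    rw [hwC, add_zero] at hyw
    exact hx0 (hyw ▸ hy.1)
  obtain ⟨U, hUWC, hU, hU0, hUmin⟩ := exists_minimal_stable (r := r) (P := W ⊓ C)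
    (fun g x hx => ⟨hW g x hx.1, hC g x hx.2⟩) hWC0
  have hUC : U ≤ C := hUWC.trans inf_le_right
  have hUinj : ∀ x ∈ U, (N ^ (t - 1)) x = 0 → x = 0 := by
    intro x hx h0
    have : x ∈ Z ⊓ C ⊓ W := ⟨⟨h0, hUC hx⟩, (hUWC hx).1⟩
    rwa [hZW.inf_eq_bot, Submodule.mem_bot] at this
  obtain ⟨C', hC', hUC'⟩ := hcompl (U.map (N ^ (t - 1))) (by
    rintro g - ⟨x, hx, rfl⟩
    rw [act_mono_pow hN, ← map_smul]
    exact ⟨_, U.smul_mem _ (hU g x hx), rfl⟩)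
  let D : Submodule F V := C ⊓ ⨅ k ∈ Finset.range t, C'.comap (N ^ k)
  have hD : ∀ x, x ∈ D ↔ x ∈ C ∧ ∀ k < t, (N ^ k) x ∈ C' := by
    intro x
    simp [D, Submodule.mem_iInf]
  have hUC'0 : ∀ x ∈ U, (N ^ (t - 1)) x ∈ C' → x = 0 := by
    intro x hx h
    refine hUinj x hx ?_
    have : (N ^ (t - 1)) x ∈ U.map (N ^ (t - 1)) ⊓ C' := ⟨⟨x, hx, rfl⟩, h⟩
    rwa [hUC'.inf_eq_bot, Submodule.mem_bot] at this
  have hDstable : StableUnder r D := by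
    intro g x hx
    rw [hD] at hx ⊢
    refine ⟨hC g x hx.1, fun k hk => ?_⟩
    rw [mono_pow_act hN]
    exact C'.smul_mem _ (hC' g _ (hx.2 k hk))
  have hND : ∀ x ∈ D, N x ∈ D := by
    intro x hx
    rw [hD] at hx ⊢
    refine ⟨hNC x hx.1, fun k hk => ?_⟩
    rw [← Module.End.mul_apply, ← pow_succ]
    rcases Nat.lt_or_ge (k + 1) t with hk' | hk'
    · exact hx.2 _ hk'
    · obtain rfl : t = k + 1 := by omega
      rw [ht x hx.1]
      exact C'.zero_mem
  have hDC : D < C := by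
    refine lt_of_le_of_ne inf_le_left fun h => ?_
    obtain ⟨x, hx, hx0⟩ := (Submodule.ne_bot_iff _).mp hU0
    exact hx0 (hUC'0 x hx (((hD x).mp (h ▸ hUC hx)).2 _ (by omega)))
  obtain ⟨ι, _, t', d', s', b', ht', hs', hb', hli', hspan'⟩ :=
    ih _ (Submodule.finrank_lt_finrank_of_lt hDC) D hDstable hND rfl
  obtain ⟨d, s, e, heli, hespan, heact, hirr⟩ := exists_matrix_of_minimal hU hU0 hUmin
  have heU : ∀ a, e a ∈ U := fun a => hespan ▸ Submodule.subset_span ⟨a, rfl⟩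
  let T : Option ι → ℕ := fun o => o.elim t t'
  let DD : Option ι → ℕ := fun o => o.elim d d'
  let SS : ∀ o : Option ι, G →* Matrix (Fin (DD o)) (Fin (DD o)) F := fun o =>
    match o with
    | none => s
    | some i => s' i
  let bb : (Σ o, Fin (DD o) × Fin (T o)) → V := fun x =>
    match x with
    | ⟨none, (a, j)⟩ => (N ^ ((j : Fin t) : ℕ)) (e a)
    | ⟨some i, y⟩ => b' ⟨i, y⟩
  have hb'D : ∀ x, b' x ∈ D := fun x => hspan' ▸ Submodule.subset_span ⟨x, rfl⟩
  refine ⟨Option ι, inferInstance, T, DD, SS, bb, ?_, ?_, ⟨?_, ?_⟩, ?_, ?_⟩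
  · rintro (_ | i)
    · exact ht0
    · exact ht' i
  · rintro (_ | i)
    · exact hirr
    · exact hs' i
  · rintro g (_ | i) a j
    · have : ∀ (a : Fin d) (j : Fin t), r g ((N ^ (j : ℕ)) (e a)) =
          ∑ a', (χ g ^ (j : ℕ) * s g a' a) • (N ^ (j : ℕ)) (e a') := by
        intro a j
        rw [act_mono_pow hN, heact, map_sum, Finset.smul_sum]
        exact Finset.sum_congr rfl fun a' _ => by rw [map_smul, smul_smul]
      exact this a j
    · exact hb'.act g i a j
  · rintro (_ | i) a j
    · have : ∀ (a : Fin d) (j : Fin t), N ((N ^ (j : ℕ)) (e a)) =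
          if (j : ℕ) + 1 < t then (N ^ ((j : ℕ) + 1)) (e a) else 0 := by
        intro a j
        rw [← Module.End.mul_apply, ← pow_succ']
        split_ifs with h
        · rfl
        · have : (j : ℕ) + 1 = t := by omega
          rw [this, ht _ (hUC (heU a))]
      exact this a j
    · exact hb'.mono i a j
  · rw [Fintype.linearIndependent_iff]
    intro c hc
    rw [Fintype.sum_sigma, Fintype.sum_option] at hc
    let c₀ : Fin d × Fin t → F := fun x => c ⟨none, x⟩
    replace hc : ∑ x, c₀ x • (N ^ (x.2 : ℕ)) (e x.1) + ∑ i, ∑ x, c ⟨some i, x⟩ • b' ⟨i, x⟩ = 0 := hc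
    have h1 : ∑ x, c₀ x • (N ^ (x.2 : ℕ)) (e x.1) =
        ∑ j : Fin t, (N ^ (j : ℕ)) (∑ a, c₀ (a, j) • e a) := by
      rw [Fintype.sum_prod_type_right]
      simp only [map_sum, map_smul]
    have h2 : ∑ i, ∑ x, c ⟨some i, x⟩ • b' ⟨i, x⟩ ∈ D :=
      D.sum_mem fun i _ => D.sum_mem fun x _ => D.smul_mem _ (hb'D ⟨i, x⟩)
    have h3 : ∑ j : Fin t, (N ^ (j : ℕ)) (∑ a, c₀ (a, j) • e a) ∈ D := by
      rw [← h1, eq_neg_of_add_eq_zero_left hc]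
      exact D.neg_mem h2
    have h4 := eq_zero_of_sum_pow_mem (U := U) (C := C') (fun x hx => ht x (hUC hx)) hUC'0
      (fun j : Fin t => ∑ a, c₀ (a, j) • e a)
      (fun j => U.sum_mem fun a _ => U.smul_mem _ (heU a)) ((hD _).mp h3).2
    have h5 : ∀ x, c₀ x = 0 := fun x =>
      Fintype.linearIndependent_iff.mp heli (fun a => c₀ (a, x.2)) (h4 x.2) x.1
    rw [Finset.sum_eq_zero fun x _ => by rw [h5 x, zero_smul], zero_add] at hc
    have h7 : ∑ y : (Σ i, Fin (d' i) × Fin (t' i)), c ⟨some y.1, y.2⟩ • b' y = 0 := by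
      rw [Fintype.sum_sigma]
      exact hc
    have h8 := Fintype.linearIndependent_iff.mp hli' (fun y => c ⟨some y.1, y.2⟩) h7
    rintro ⟨_ | i, x⟩
    · exact h5 x
    · exact h8 ⟨i, x⟩
  · apply le_antisymm
    · rw [Submodule.span_le]
      rintro - ⟨⟨_ | i, x⟩, rfl⟩
      · exact hNkC _ _ (hUC (heU x.1))
      · exact ((hD _).mp (hb'D ⟨i, x⟩)).1
    · intro x hx
      -- subtract `N ^ m u` with `u ∈ U` one power at a time
      have key : ∀ m ≤ t, ∃ y ∈ Submodule.span F (Set.range bb), y ∈ C ∧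
          ∀ k, t - m ≤ k → k < t → (N ^ k) (x - y) ∈ C' := by
        intro m
        induction m with
        | zero => exact fun _ => ⟨0, Submodule.zero_mem _, C.zero_mem, fun k h1 h2 => by omega⟩
        | succ m ihm =>
          intro hm
          obtain ⟨y, hy, hyC, hyk⟩ := ihm (by omega)
          obtain ⟨-, ⟨u, hu, rfl⟩, w, hw, huw⟩ := Submodule.mem_sup.mp
            (hUC'.sup_eq_top ▸ Submodule.mem_top :
              (N ^ (t - (m + 1))) (x - y) ∈ U.map (N ^ (t - 1)) ⊔ C')
          refine ⟨y + (N ^ m) u, Submodule.add_mem _ hy ?_, C.add_mem hyC (hNkC _ _ (hUC hu)),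
            fun k hk1 hk2 => ?_⟩
          · rw [← hespan] at hu
            have : Submodule.span F (Set.range e) ≤
                (Submodule.span F (Set.range bb)).comap (N ^ m) := by
              rw [Submodule.span_le]
              rintro - ⟨a, rfl⟩
              exact Submodule.subset_span ⟨⟨none, (a, (⟨m, by omega⟩ : Fin t))⟩, rfl⟩
            exact this hu
          · rw [← sub_sub, map_sub, ← Module.End.mul_apply, ← pow_add]
            rcases Nat.lt_or_ge k (t - m) with hk | hk
            · obtain rfl : k = t - (m + 1) := by omega
              have : t - (m + 1) + m = t - 1 := by omega
              rw [this, ← huw, add_sub_cancel_left]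
              exact hw
            · have : k + m = (k + m - t) + t := by omega
              rw [this, pow_add, Module.End.mul_apply, ht u (hUC hu), map_zero, sub_zero]
              exact hyk k hk hk2
      obtain ⟨y, hy, hyC, hyk⟩ := key t le_rfl
      have hxy : x - y ∈ D := (hD _).mpr ⟨C.sub_mem hx hyC, fun k hk => hyk k (by omega) hk⟩
      rw [← sub_add_cancel x y]
      refine Submodule.add_mem _ ?_ hy
      rw [← hspan'] at hxy
      refine Submodule.span_mono ?_ hxy
      rintro - ⟨z, rfl⟩
      exact ⟨⟨some z.1, z.2⟩, rfl⟩

end Structure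

/-! ### Bases adapted to a decomposition into segments -/

section SegmentBasis

variable {G F V : Type*} [Group G] [Field F] [AddCommGroup V] [Module F V]

/-- A basis on which a representation and a nilpotent operator act as on the standard basis of
the direct sum of the `Sp_{t i} (s i)`. -/
structure IsSegmentBasis (χ : G →* F) (r : G →* Module.End F V) (N : Module.End F V)
    {ι : Type*} (t d : ι → ℕ) (s : ∀ i, G →* Matrix (Fin (d i)) (Fin (d i)) F)
    (b : Module.Basis (Σ i, Fin (d i) × Fin (t i)) F V) : Prop
    extends IsSegmentFamily χ r N t d s b

variable {χ : G →* F} {r : G →* Module.End F V} {N : Module.End F V} {ι : Type*}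
  {t d : ι → ℕ} {s : ∀ i, G →* Matrix (Fin (d i)) (Fin (d i)) F}
  {b : Module.Basis (Σ i, Fin (d i) × Fin (t i)) F V}

theorem IsSegmentBasis.trace_eq [Fintype ι] (h : IsSegmentBasis χ r N t d s b) (g : G) :
    LinearMap.trace F V (r g) = ∑ i, ∑ j : Fin (t i), (s i g).trace * χ g ^ (j : ℕ) := by
  classical
  rw [LinearMap.trace_eq_matrix_trace F b, Matrix.trace, Fintype.sum_sigma]
  refine Finset.sum_congr rfl fun i _ => ?_
  rw [Fintype.sum_prod_type_right]
  refine Finset.sum_congr rfl fun j _ => ?_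
  rw [Matrix.trace, Finset.sum_mul]
  refine Finset.sum_congr rfl fun a _ => ?_
  rw [Matrix.diag_apply, LinearMap.toMatrix_apply, h.act, map_sum, Finsupp.finsetSum_apply,
    Finset.sum_eq_single a]
  · simp [mul_comm]
  · intro a' _ ha'
    rw [map_smul, Finsupp.smul_apply, b.repr_self, Finsupp.single_apply, if_neg, smul_zero]
    intro hh
    simp only [Sigma.mk.injEq, heq_eq_eq, true_and, Prod.mk.injEq, and_true] at hh
    exact ha' hh
  · simp

theorem IsSegmentBasis.mono_pow (h : IsSegmentBasis χ r N t d s b) (k : ℕ) (i : ι) (a : Fin (d i))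
    (j : Fin (t i)) :
    (N ^ k) (b ⟨i, (a, j)⟩) = if h : (j : ℕ) + k < t i then b ⟨i, (a, ⟨j + k, h⟩)⟩ else 0 := by
  induction k with
  | zero => simp
  | succ k ih =>
    rw [pow_succ', Module.End.mul_apply, ih]
    by_cases h1 : (j : ℕ) + k < t i
    · rw [dif_pos h1, h.mono]
      rfl
    · rw [dif_neg h1, map_zero, dif_neg (by omega)]

/-- The `k`-th power of the monodromy operator shortens every segment by `k`. -/
theorem IsSegmentBasis.finrank_range_pow [Fintype ι] (h : IsSegmentBasis χ r N t d s b) (k : ℕ) :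
    Module.finrank F (LinearMap.range (N ^ k)) = ∑ i, d i * (t i - k) := by
  -- the image of `N ^ k` is spanned by the basis vectors at positions `≥ k` of their segments
  let c : (Σ i, Fin (d i) × Fin (t i - k)) → V :=
    fun y => b ⟨y.1, (y.2.1, ⟨y.2.2 + k, by have := y.2.2.2; omega⟩)⟩
  have hc : LinearIndependent F c := by
    refine b.linearIndependent.comp (fun y : (Σ i, Fin (d i) × Fin (t i - k)) =>
      (⟨y.1, (y.2.1, ⟨y.2.2 + k, by have := y.2.2.2; omega⟩)⟩ : Σ i, Fin (d i) × Fin (t i))) ?_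
    rintro ⟨i, a, j⟩ ⟨i', a', j'⟩ hij
    simp only [Sigma.mk.injEq] at hij
    obtain ⟨rfl, hij⟩ := hij
    simp only [heq_eq_eq, Prod.mk.injEq, Fin.mk.injEq, add_left_inj] at hij
    obtain ⟨rfl, hj⟩ := hij
    rw [Fin.ext hj]
  have hrange : LinearMap.range (N ^ k) = Submodule.span F (Set.range c) := by
    rw [LinearMap.range_eq_map, ← b.span_eq, Submodule.map_span, ← Set.range_comp]
    apply le_antisymm
    · rw [Submodule.span_le]
      rintro - ⟨⟨i, a, j⟩, rfl⟩
      rw [Function.comp_apply, h.mono_pow]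
      split_ifs with hj
      · exact Submodule.subset_span ⟨⟨i, (a, ⟨j, by omega⟩)⟩, rfl⟩
      · exact Submodule.zero_mem _
    · rw [Submodule.span_le]
      rintro - ⟨⟨i, a, j⟩, rfl⟩
      refine Submodule.subset_span ⟨⟨i, (a, ⟨j, by omega⟩)⟩, ?_⟩
      rw [Function.comp_apply, h.mono_pow, dif_pos (by simp only; omega)]
  rw [hrange, finrank_span_eq_card hc]
  simp

theorem IsSegmentBasis.repr_mono_pow (h : IsSegmentBasis χ r N t d s b) (k : ℕ) (y : V) (i : ι)
    (a : Fin (d i)) (j : Fin (t i)) :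
    b.repr ((N ^ k) y) ⟨i, (a, j)⟩ =
      if k ≤ j then b.repr y ⟨i, (a, ⟨j - k, by omega⟩)⟩ else 0 := by
  classical
  have hlin : (b.coord ⟨i, (a, j)⟩) ∘ₗ (N ^ k) =
      if k ≤ j then b.coord ⟨i, (a, ⟨j - k, by omega⟩)⟩ else 0 := by
    refine b.ext fun x => ?_
    obtain ⟨i', a', j'⟩ := x
    rw [LinearMap.comp_apply, h.mono_pow]
    by_cases hi : i' = i
    · subst hi
      split_ifs with h1 h2 h2 <;>
        simp only [Module.Basis.coord_apply, Module.Basis.repr_self, Finsupp.single_apply,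
          map_zero, LinearMap.zero_apply, Sigma.mk.injEq, heq_eq_eq, true_and, Prod.mk.injEq,
          Fin.ext_iff]
      · congr 1
        simp only [eq_iff_iff]
        omega
      · rw [if_neg]; omega
      · rw [if_neg]; have := j.2; omega
    · split_ifs <;> simp [hi]
  have := LinearMap.congr_fun hlin y
  rw [LinearMap.comp_apply, Module.Basis.coord_apply] at this
  rw [this]
  split_ifs <;> rfl

/-- A segment basis may be transported along isomorphisms of the representations at the starting
points of the segments. -/
theorem IsSegmentBasis.exists_transport [Finite ι] (h : IsSegmentBasis χ r N t d s b) {κ : Type*}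
    (e : κ ≃ ι) {t' d' : κ → ℕ} {s' : ∀ i, G →* Matrix (Fin (d' i)) (Fin (d' i)) F}
    (ht : ∀ i, t' i = t (e i)) (hs : ∀ i, SimRep (s' i) (s (e i))) :
    ∃ b' : Module.Basis (Σ i, Fin (d' i) × Fin (t' i)) F V, IsSegmentBasis χ r N t' d' s' b' := by
  classical
  have := Fintype.ofFinite ι
  have := Fintype.ofEquiv ι e.symm
  obtain rfl : t' = fun i => t (e i) := funext ht
  choose P Q hPQ hQP hP using hs
  -- the columns of the intertwining matrices give the new basis
  let c : (Σ i, Fin (d' i) × Fin (t (e i))) → V :=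
    fun y => ∑ a', Q y.1 a' y.2.1 • b ⟨e y.1, (a', y.2.2)⟩
  have hc : ∀ i a j, c ⟨i, (a, j)⟩ = ∑ a', Q i a' a • b ⟨e i, (a', j)⟩ := fun i a j => rfl
  have hinv : ∀ i (a' : Fin (d (e i))) (j : Fin (t (e i))),
      b ⟨e i, (a', j)⟩ = ∑ a, P i a a' • c ⟨i, (a, j)⟩ := by
    intro i a' j
    simp only [hc, Finset.smul_sum, smul_smul]
    rw [Finset.sum_comm]
    simp only [← Finset.sum_smul]
    have : ∀ a'', ∑ a, P i a a' * Q i a'' a =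
        (1 : Matrix (Fin (d (e i))) (Fin (d (e i))) F) a'' a' := by
      intro a''
      rw [← hQP i, Matrix.mul_apply]
      exact Finset.sum_congr rfl fun a _ => mul_comm _ _
    simp only [this, Matrix.one_apply, ite_smul, one_smul, zero_smul, Finset.sum_ite_eq',
      Finset.mem_univ, if_true]
  have hd : ∀ i, d' i = d (e i) := by
    intro i
    have h1 := (P i).rank_mul_le_left (Q i)
    have h2 := (Q i).rank_mul_le_left (P i)
    rw [hPQ, Matrix.rank_one, Fintype.card_fin] at h1
    rw [hQP, Matrix.rank_one, Fintype.card_fin] at h2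
    have h3 := (P i).rank_le_width
    have h4 := (Q i).rank_le_width
    omega
  have hspan : ⊤ ≤ Submodule.span F (Set.range c) := by
    rw [← b.span_eq, Submodule.span_le]
    rintro - ⟨⟨i, a, j⟩, rfl⟩
    obtain ⟨i, rfl⟩ := e.surjective i
    rw [SetLike.mem_coe, hinv]
    exact Submodule.sum_mem _ fun a' _ => Submodule.smul_mem _ _ (Submodule.subset_span ⟨_, rfl⟩)
  have hcard : Fintype.card (Σ i, Fin (d' i) × Fin (t (e i))) = Module.finrank F V := by
    rw [Module.finrank_eq_card_basis b, Fintype.card_sigma, Fintype.card_sigma,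
      ← Equiv.sum_comp e]
    simp [hd]
  refine ⟨basisOfTopLeSpanOfCardEqFinrank c hspan hcard, ⟨?_, ?_⟩⟩
  · intro g i a j
    rw [coe_basisOfTopLeSpanOfCardEqFinrank]
    have hQ : ∀ a'' : Fin (d (e i)), ∑ a', s (e i) g a'' a' * Q i a' a =
        ∑ a', Q i a'' a' * s' i g a' a := by
      intro a''
      have h1 : s (e i) g * Q i = Q i * s' i g := by
        calc s (e i) g * Q i = Q i * P i * s (e i) g * Q i := by rw [hQP, Matrix.one_mul]
          _ = Q i * (s' i g * P i) * Q i := by rw [hP, Matrix.mul_assoc (Q i) (P i)]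
          _ = Q i * s' i g := by rw [Matrix.mul_assoc, Matrix.mul_assoc, hPQ, Matrix.mul_one]
      have := congrFun (congrFun h1 a'') a
      rwa [Matrix.mul_apply, Matrix.mul_apply] at this
    calc r g (c ⟨i, (a, j)⟩)
        = ∑ a', ∑ a'', (χ g ^ (j : ℕ) * (s (e i) g a'' a' * Q i a' a)) • b ⟨e i, (a'', j)⟩ := by
          simp only [hc, map_sum, map_smul, h.act, Finset.smul_sum, smul_smul]
          exact Finset.sum_congr rfl fun _ _ => Finset.sum_congr rfl fun _ _ => by congr 1; ring
      _ = ∑ a'', (χ g ^ (j : ℕ) * ∑ a', Q i a'' a' * s' i g a' a) • b ⟨e i, (a'', j)⟩ := by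
          rw [Finset.sum_comm]
          refine Finset.sum_congr rfl fun a'' _ => ?_
          rw [← Finset.sum_smul, ← Finset.mul_sum, hQ]
      _ = _ := by
          simp only [hc, Finset.smul_sum, smul_smul]
          rw [Finset.sum_comm]
          refine Finset.sum_congr rfl fun a'' _ => ?_
          rw [← Finset.sum_smul, Finset.mul_sum]
          congr 1
          exact Finset.sum_congr rfl fun a' _ => by ring
  · intro i a j
    rw [coe_basisOfTopLeSpanOfCardEqFinrank]
    simp only [hc, map_sum, map_smul, h.mono]
    split_ifs with hj
    · rfl
    · simp

/-- The step `t i - 2` of the monodromy filtration has no component in the starting piece of a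
segment of length `t i`. -/
theorem IsSegmentBasis.repr_eq_zero_of_mem_monodromyFiltration (h : IsSegmentBasis χ r N t d s b)
    (i : ι) (hi : 0 < t i) {y : V} (hy : y ∈ monodromyFiltration N (t i - 1 - 1)) (a : Fin (d i)) :
    b.repr y ⟨i, (a, ⟨0, hi⟩)⟩ = 0 := by
  suffices monodromyFiltration N (t i - 1 - 1) ≤ LinearMap.ker (b.coord ⟨i, (a, ⟨0, hi⟩)⟩) from
    this hy
  refine iSup_le fun k => iSup_le fun l => iSup_le fun hkl => ?_
  rintro x ⟨hx, x', rfl⟩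
  rw [LinearMap.mem_ker, Module.Basis.coord_apply]
  rcases Nat.eq_zero_or_pos l with rfl | hl
  · have h1 := h.repr_mono_pow (k + 1) ((N ^ 0) x') i a ⟨k + 1, by omega⟩
    rw [LinearMap.mem_ker.mp hx] at h1
    simpa using h1.symm
  · rw [h.repr_mono_pow, if_neg (by simp only; omega)]

end SegmentBasis

section Matrix

variable {ℓ : ℕ} [Fact ℓ.Prime] {K : Type*} [Field K] [Algebra ℚ_[ℓ] K] [FiniteDimensional ℚ_[ℓ] K]
  {F : Type*} [Field F] [CharZero F] {m : ℕ} {t d : Fin m → ℕ}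
  {s : ∀ i, weilGroup ℓ K →* Matrix (Fin (d i)) (Fin (d i)) F}
  {κ : Type*} [Fintype κ] [DecidableEq κ] {ρ : WDData ℓ K κ F}

/-- A column of the action of `σ` on `⊕ Sp_{t i} (s i)`, written as a linear combination. -/
theorem sum_directSum_sp_r_smul {V : Type*} [AddCommGroup V] [Module F V]
    (b : (Σ i, Fin (d i) × Fin (t i)) → V) (σ : weilGroup ℓ K) (i : Fin m) (a : Fin (d i))
    (j : Fin (t i)) :
    ∑ y, (WDData.directSum fun i => WDData.sp (t i) (s i) (resCard_cast_ne_zero ℓ K F)).r σ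
        y ⟨i, (a, j)⟩ • b y =
      ∑ a', (normChar ℓ K F σ ^ (j : ℕ) * s i σ a' a) • b ⟨i, (a', j)⟩ := by
  have hne : ∀ i' x, i' ≠ i →
      (WDData.directSum fun i => WDData.sp (t i) (s i) (resCard_cast_ne_zero ℓ K F)).r σ
        ⟨i', x⟩ ⟨i, (a, j)⟩ = 0 := fun i' x hi' =>
    Matrix.blockDiagonal'_apply_ne
      (fun i => (WDData.sp (t i) (s i) (resCard_cast_ne_zero ℓ K F)).r σ) _ _ hi'
  have heq : ∀ a' j',
      (WDData.directSum fun i => WDData.sp (t i) (s i) (resCard_cast_ne_zero ℓ K F)).r σ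
        ⟨i, (a', j')⟩ ⟨i, (a, j)⟩ =
      if j' = j then (normChar ℓ K F σ ^ (j' : ℕ) • s i σ) a' a else 0 := fun a' j' =>
    (Matrix.blockDiagonal'_apply_eq
      (fun i => (WDData.sp (t i) (s i) (resCard_cast_ne_zero ℓ K F)).r σ) i _ _).trans
      (Matrix.blockDiagonal_apply (fun j : Fin (t i) => normChar ℓ K F σ ^ (j : ℕ) • s i σ) _ _)
  rw [Fintype.sum_sigma, Finset.sum_eq_single i]
  · rw [Fintype.sum_prod_type]
    refine Finset.sum_congr rfl fun a' _ => ?_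
    simp only [heq, ite_smul, zero_smul, Finset.sum_ite_eq', Finset.mem_univ,
      if_true]
    rfl
  · intro i' _ hi'
    exact Finset.sum_eq_zero fun x _ => by rw [hne i' x hi', zero_smul]
  · simp

/-- A column of the monodromy operator of `⊕ Sp_{t i} (s i)`, written as a linear combination. -/
theorem sum_directSum_sp_N_smul {V : Type*} [AddCommGroup V] [Module F V]
    (b : (Σ i, Fin (d i) × Fin (t i)) → V) (i : Fin m) (a : Fin (d i)) (j : Fin (t i)) :
    ∑ y, (WDData.directSum fun i => WDData.sp (t i) (s i) (resCard_cast_ne_zero ℓ K F)).N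
        y ⟨i, (a, j)⟩ • b y =
      if h : (j : ℕ) + 1 < t i then b ⟨i, (a, ⟨j + 1, h⟩)⟩ else 0 := by
  have hne : ∀ i' x, i' ≠ i →
      (WDData.directSum fun i => WDData.sp (t i) (s i) (resCard_cast_ne_zero ℓ K F)).N
        ⟨i', x⟩ ⟨i, (a, j)⟩ = 0 := fun i' x hi' =>
    Matrix.blockDiagonal'_apply_ne
      (fun i => (WDData.sp (t i) (s i) (resCard_cast_ne_zero ℓ K F)).N) _ _ hi'
  have hN : ∀ x y : Fin (d i) × Fin (t i),
      (WDData.directSum fun i => WDData.sp (t i) (s i) (resCard_cast_ne_zero ℓ K F)).N ⟨i, x⟩ ⟨i, y⟩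
        = if x.1 = y.1 ∧ (x.2 : ℕ) = y.2 + 1 then 1 else 0 := fun x y =>
    Matrix.blockDiagonal'_apply_eq (fun i => (WDData.sp (t i) (s i) (resCard_cast_ne_zero ℓ K F)).N)
      i _ _
  rw [Fintype.sum_sigma, Finset.sum_eq_single i]
  · simp only [hN]
    split_ifs with h
    · rw [Finset.sum_eq_single (a, ⟨j + 1, h⟩)]
      · simp
      · rintro ⟨a', j'⟩ _ hne
        rw [if_neg, zero_smul]
        rintro ⟨rfl, hj⟩
        exact hne (Prod.ext rfl (Fin.ext hj))
      · simp
    · refine Finset.sum_eq_zero fun x _ => ?_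
      rw [if_neg, zero_smul]
      rintro ⟨-, hj⟩
      exact h (hj ▸ x.2.2)
  · intro i' _ hi'
    exact Finset.sum_eq_zero fun x _ => by rw [hne i' x hi', zero_smul]
  · simp

/-- A Weil-Deligne representation is isomorphic to `⊕ Sp_{t i} (s i)` if and only if it has a
segment basis. -/
theorem iso_directSum_sp_iff :
    ρ.Iso (WDData.directSum fun i => WDData.sp (t i) (s i) (resCard_cast_ne_zero ℓ K F)) ↔
      ∃ b, IsSegmentBasis (normChar ℓ K F) (matRep ρ.r) (Matrix.toLin' ρ.N) t d s b := by
  have hmul : ∀ (P : Matrix κ (Σ i, Fin (d i) × Fin (t i)) F)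
      (M : Matrix (Σ i, Fin (d i) × Fin (t i)) (Σ i, Fin (d i) × Fin (t i)) F) y,
      (P * M).col y = ∑ y', M y' y • P.col y' := by
    intro P M y
    ext x
    simp [Matrix.mul_apply, mul_comm]
  have hmul' : ∀ (P : Matrix κ (Σ i, Fin (d i) × Fin (t i)) F) (M : Matrix κ κ F) y,
      (M * P).col y = M.mulVec (P.col y) := fun P M y => rfl
  constructor
  · rintro ⟨P, Q, hPQ, hQP, hr, hN⟩
    let e : ((Σ i, Fin (d i) × Fin (t i)) → F) ≃ₗ[F] (κ → F) :=
      LinearEquiv.ofLinearMap (Matrix.toLin' P) (Matrix.toLin' Q)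
        (by rw [← Matrix.toLin'_mul, hPQ, Matrix.toLin'_one])
        (by rw [← Matrix.toLin'_mul, hQP, Matrix.toLin'_one])
    let b := (Pi.basisFun F (Σ i, Fin (d i) × Fin (t i))).map e
    have hb : ∀ y, b y = P.col y := by
      intro y
      simp [b, e]
    refine ⟨b, ⟨fun σ i a j => ?_, fun i a j => ?_⟩⟩
    · rw [hb, matRep_apply, ← hmul', hr, hmul, sum_directSum_sp_r_smul (fun y => P.col y)]
      simp only [hb]
    · rw [hb, Matrix.toLin'_apply, ← hmul', hN, hmul, sum_directSum_sp_N_smul (fun y => P.col y)]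
      simp only [hb]
  · rintro ⟨b, hb⟩
    let P : Matrix κ (Σ i, Fin (d i) × Fin (t i)) F := Matrix.of fun x y => b y x
    have hP : ∀ y, P.col y = b y := fun y => rfl
    have hPm : P = LinearMap.toMatrix b (Pi.basisFun F κ) LinearMap.id := by
      ext x y
      simp [P, LinearMap.toMatrix_apply]
    refine ⟨P, LinearMap.toMatrix (Pi.basisFun F κ) b LinearMap.id, ?_, ?_, fun σ => ?_, ?_⟩
    · rw [hPm, ← LinearMap.toMatrix_comp]; simp
    · rw [hPm, ← LinearMap.toMatrix_comp]; simp
    · apply Matrix.ext_col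
      rintro ⟨i, a, j⟩
      rw [hmul, hmul', sum_directSum_sp_r_smul, hP]
      exact hb.act σ i a j
    · apply Matrix.ext_col
      rintro ⟨i, a, j⟩
      rw [hmul, hmul', sum_directSum_sp_N_smul, hP]
      exact hb.mono i a j

/-- The structure theorem for Frobenius-semisimple Weil-Deligne representations. -/
theorem exists_isSegmentBasis {φ : weilGroup ℓ K} (hφ : weilVal ℓ K φ = 1) (h : ρ.IsWeilDeligne)
    (hss : Module.End.IsSemisimple (Matrix.toLin' (ρ.r φ))) :
    ∃ (ι : Type) (_ : Fintype ι) (t d : ι → ℕ)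
      (s : ∀ i, weilGroup ℓ K →* Matrix (Fin (d i)) (Fin (d i)) F)
      (b : Module.Basis (Σ i, Fin (d i) × Fin (t i)) F (κ → F)), (∀ i, 0 < t i) ∧
      (∀ i, (matRep (s i)).IsIrreducible) ∧
      IsSegmentBasis (normChar ℓ K F) (matRep ρ.r) (Matrix.toLin' ρ.N) t d s b := by
  have hN : ∀ σ, matRep ρ.r σ * Matrix.toLin' ρ.N =
      normChar ℓ K F σ • (Matrix.toLin' ρ.N * matRep ρ.r σ) := by
    intro σ
    have := congrArg Matrix.toLin' (h.mul_eq σ)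
    rw [map_smul, Matrix.toLin'_mul, Matrix.toLin'_mul] at this
    exact this
  have hnil : IsNilpotent (Matrix.toLin' ρ.N) :=
    h.nilpotent.map (Matrix.toLinAlgEquiv' : Matrix κ κ F ≃ₐ[F] ((κ → F) →ₗ[F] (κ → F)))
  have hfin : (matRep ρ.r '' {σ | weilVal ℓ K σ = 0}).Finite := by
    have : ⇑(matRep ρ.r) = Matrix.toLinAlgEquiv' ∘ ρ.r := rfl
    rw [this, Set.image_comp, ← inertiaGroup_eq]
    exact h.finite_inertia.image _
  obtain ⟨ι, _, t, d, s, b, ht, hs, hb, hli, hspan⟩ := exists_segmentFamily_of_stable hN hnil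
    (fun U hU => exists_stable_isCompl (weilVal_mul ℓ K) hφ hfin hss hU) ⊤
    (fun _ _ _ => Submodule.mem_top) (fun _ _ => Submodule.mem_top)
  refine ⟨ι, inferInstance, t, d, s, Module.Basis.mk hli hspan.ge, ht, hs, ⟨?_⟩⟩
  rw [Module.Basis.coe_mk]
  exact hb

end Matrix

/-! ### Descent of irreducible representations to unramified twists of finite representations -/

section Twist

variable {G : Type*} [Group G] {v : G → ℤ}

/-- The unramified twist `σ ↦ u ^ v(σ) • s(σ)`, with coefficients extended along `j`. -/
def twistRep (hv : ∀ a b, v (a * b) = v a + v b) {A k : Type*} [CommRing A] [CommRing k]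
    (u : Aˣ) (j : k →+* A) {d : ℕ} (s : G →* Matrix (Fin d) (Fin d) k) :
    G →* Matrix (Fin d) (Fin d) A where
  toFun σ := ((u ^ v σ : Aˣ) : A) • j.mapMatrix (s σ)
  map_one' := by rw [valuation_one hv, map_one, map_one]; simp
  map_mul' σ τ := by
    rw [hv, zpow_add, Units.val_mul, map_mul, map_mul, smul_mul_smul_comm]

variable (hv : ∀ a b, v (a * b) = v a + v b) {A k : Type*} [CommRing A]

theorem twistRep_apply [CommRing k] (u : Aˣ) (j : k →+* A) {d : ℕ}
    (s : G →* Matrix (Fin d) (Fin d) k) (σ : G) :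
    twistRep hv u j s σ = ((u ^ v σ : Aˣ) : A) • (s σ).map j := rfl

theorem twistRep_map [CommRing k] (u : Aˣ) (j : k →+* A) {d : ℕ}
    (s : G →* Matrix (Fin d) (Fin d) k) {B : Type*} [CommRing B] (g : A →+* B) (σ : G) :
    (twistRep hv u j s σ).map g = twistRep hv (Units.map (g : A →* B) u) (g.comp j) s σ := by
  rw [twistRep_apply, twistRep_apply, Matrix.map_smul' g _ _ (map_mul g), Matrix.map_map,
    ← map_zpow]
  rfl

variable [Field k] {d : ℕ} {s : G →* Matrix (Fin d) (Fin d) k}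

theorem isSemisimple_of_pow_eq_one {F : Type*} [Field F] [CharZero F] {X : Matrix (Fin d) (Fin d) F}
    {m : ℕ} (hm : 0 < m) (h : X ^ m = 1) : Module.End.IsSemisimple (Matrix.toLin' X) := by
  refine Module.End.isSemisimple_of_squarefree_aeval_eq_zero
    (p := (Polynomial.X ^ m - 1 : Polynomial F)) ?_ ?_
  · refine Polynomial.Separable.squarefree ?_
    rw [Polynomial.X_pow_sub_one_separable_iff]
    exact Nat.cast_ne_zero.mpr hm.ne'
  · have : Matrix.toLin' X ^ m = 1 := by
      rw [← Matrix.toLin'_pow, h]; exact Matrix.toLin'_one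
    simp [this]

theorem twistRep_isSemisimple {F : Type*} [Field F] [CharZero F] (u : Fˣ)
    (j : k →+* F) (hfin : (Set.range s).Finite) (g : G) :
    Module.End.IsSemisimple (Matrix.toLin' (twistRep hv u j s g)) := by
  rw [twistRep_apply, map_smul]
  refine Module.End.IsSemisimple_smul _ ?_
  obtain ⟨m, n, hmn, h⟩ : ∃ m n : ℕ, m < n ∧ s g ^ m = s g ^ n := by
    have : (Set.range fun m : ℕ => s g ^ m).Finite := hfin.subset (by
      rintro - ⟨m, rfl⟩
      exact ⟨g ^ m, map_pow s g m⟩)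
    obtain ⟨m, -, n, -, hne, h⟩ := Set.infinite_univ.exists_ne_map_eq_of_mapsTo
      (f := fun m : ℕ => s g ^ m) (fun m _ => Set.mem_range_self m) this
    rcases lt_or_gt_of_ne hne with h1 | h1
    · exact ⟨m, n, h1, h⟩
    · exact ⟨n, m, h1, h.symm⟩
  have h1 : s g ^ (n - m) = 1 := by
    refine ((isUnit_of_monoidHom s g).pow m).mul_left_cancel ?_
    rw [← pow_add, mul_one, Nat.add_sub_cancel' hmn.le, h]
  refine isSemisimple_of_pow_eq_one (m := n - m) (by omega) ?_
  change (j.mapMatrix (s g)) ^ (n - m) = 1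
  rw [← map_pow, h1, map_one]

variable [IsAlgClosed k]

/-- By the density theorem, irreducibility over an algebraically closed field persists under
extension of scalars. -/
theorem twistRep_isIrreducible {F : Type*} [Field F] (hs : (matRep s).IsIrreducible) (u : Fˣ)
    (j : k →+* F) : (matRep (twistRep hv u j s)).IsIrreducible := by
  rw [matRep_isIrreducible_iff]
  refine ⟨((matRep_isIrreducible_iff s).mp hs).1, fun p hp => ?_⟩
  have hp1 : ∀ g, ∀ y ∈ p, ((s g).map j).mulVec y ∈ p := by
    intro g y hy
    have := p.smul_mem ((u ^ (-v g) : Fˣ) : F) (hp g y hy)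
    rwa [twistRep_apply, Matrix.smul_mulVec, smul_smul, ← Units.val_mul, ← zpow_add,
      neg_add_cancel, zpow_zero, Units.val_one, one_smul] at this
  have hp2 : ∀ x : MonoidAlgebra k G, ∀ y ∈ p,
      ((MonoidAlgebra.lift k _ G s x).map j).mulVec y ∈ p := by
    intro x y hy
    induction x using MonoidAlgebra.induction_linear with
    | zero => simp [Matrix.map_zero]
    | add x x' hx hx' =>
      rw [map_add, Matrix.map_add j (map_add j), Matrix.add_mulVec]
      exact p.add_mem hx hx'
    | single g c =>
      rw [MonoidAlgebra.lift_single, Matrix.map_smul' j _ _ (map_mul j), Matrix.smul_mulVec]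
      exact p.smul_mem _ (hp1 g y hy)
  by_cases hp0 : p = ⊥
  · exact Or.inl hp0
  right
  obtain ⟨y, hy, hy0⟩ := (Submodule.ne_bot_iff _).mp hp0
  obtain ⟨i, hi⟩ := Function.ne_iff.mp hy0
  -- matrix units in the image of the group algebra move a nonzero coordinate of `y` to any place
  have hsingle : ∀ l, Pi.single l (1 : F) ∈ p := by
    intro l
    obtain ⟨x, hx⟩ := exists_sum_smul_eq_of_pairwise_not_simRep (I := Unit) (d := fun _ => d)
      (fun _ => s) (fun _ => hs) (fun i j hij => absurd (Subsingleton.elim i j) hij)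
      (fun _ => Matrix.single l i 1)
    have h1 := p.smul_mem (y i)⁻¹ (hp2 x y hy)
    rw [hx ()] at h1
    convert h1 using 1
    ext l'
    simp only [Matrix.mulVec, dotProduct, Matrix.map_apply, Matrix.single_apply, Pi.smul_apply,
      smul_eq_mul]
    rw [Finset.sum_eq_single i]
    · by_cases hl : l = l'
      · subst hl
        simp [inv_mul_cancel₀ hi]
      · simp [hl, Ne.symm hl]
    · intro b _ hb
      simp [hb.symm]
    · simp
  rw [eq_top_iff]
  intro y _
  rw [← Finset.univ_sum_single y]
  refine p.sum_mem fun l _ => ?_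
  have := p.smul_mem (y l) (hsingle l)
  rwa [← Pi.single_smul, smul_eq_mul, mul_one] at this

end Twist

section Descent

variable {G F : Type*} [Group G] [Field F] {v : G → ℤ}

/-- The matrices of a representation in another basis form an isomorphic representation. -/
theorem simRep_of_basis {ι κ : Type*} [Fintype ι] [DecidableEq ι] [Fintype κ] [DecidableEq κ]
    {r : G →* Matrix ι ι F} {r' : G →* Matrix κ κ F} (b : Module.Basis κ F (ι → F))
    (h : ∀ g a, (r g).mulVec (b a) = ∑ a', r' g a' a • b a') : SimRep r r' := by
  let P : Matrix ι κ F := Matrix.of fun x y => b y x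
  have hPm : P = LinearMap.toMatrix b (Pi.basisFun F ι) LinearMap.id := by
    ext x y
    simp [P, LinearMap.toMatrix_apply]
  refine ⟨P, LinearMap.toMatrix (Pi.basisFun F ι) b LinearMap.id, ?_, ?_, fun g => ?_⟩
  · rw [hPm, ← LinearMap.toMatrix_comp]; simp
  · rw [hPm, ← LinearMap.toMatrix_comp]; simp
  · ext x a
    have := congrFun (h g a) x
    rw [Finset.sum_apply] at this
    rw [Matrix.mul_apply, Matrix.mul_apply]
    refine this.trans (Finset.sum_congr rfl fun a' _ => ?_)
    rw [Pi.smul_apply, smul_eq_mul, mul_comm]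
    rfl

/-- A power of the Frobenius acts on an irreducible representation by a scalar. -/
theorem exists_pow_eq_smul_one {d : ℕ} {r : G →* Matrix (Fin d) (Fin d) F}
    (hv : ∀ a b, v (a * b) = v a + v b) {φ : G} (hφ : v φ = 1)
    (hr : (matRep r).IsIrreducible) (hfin : (r '' {g | v g = 0}).Finite) {α : F} {x : Fin d → F}
    (hx : x ≠ 0) (hα : (r φ).mulVec x = α • x) : ∃ m : ℕ, 0 < m ∧ r φ ^ m = α ^ m • 1 := by
  obtain ⟨m, hm, hcm⟩ := exists_pow_commute hv φ r hfin
  have hc : ∀ g, Commute (r φ ^ m) (r g) := by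
    intro g
    have hg : g = φ ^ v g * (φ ^ (-v g) * g) := by
      rw [← mul_assoc, ← zpow_add]; simp
    rw [hg, map_mul]
    refine Commute.mul_right ?_ (hcm _ ?_)
    · rw [← map_pow]
      exact (commute_map_zpow r ((Commute.refl φ).pow_right m |>.map r) _).symm
    · rw [hv, valuation_zpow hv, hφ]; ring
  have hpow : ∀ n : ℕ, (r φ ^ n).mulVec x = α ^ n • x := by
    intro n
    induction n with
    | zero => simp
    | succ n ih => rw [pow_succ, ← Matrix.mulVec_mulVec, hα, Matrix.mulVec_smul, ih, smul_smul,
        pow_succ, mul_comm]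
  refine ⟨m, hm, ?_⟩
  let p : Submodule F (Fin d → F) :=
    LinearMap.eqLocus (Matrix.toLin' (r φ ^ m)) (α ^ m • LinearMap.id)
  have hmem : ∀ y, y ∈ p ↔ (r φ ^ m).mulVec y = α ^ m • y := fun y => Iff.rfl
  have hp : p = ⊤ := by
    refine (((matRep_isIrreducible_iff r).mp hr).2 p fun g y hy => ?_).resolve_left fun h => hx ?_
    · rw [hmem] at hy ⊢
      rw [Matrix.mulVec_mulVec, (hc g).eq, ← Matrix.mulVec_mulVec, hy, Matrix.mulVec_smul]
    · rw [← Submodule.mem_bot F, ← h]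
      exact hpow m
  apply Matrix.mulVec_injective
  funext y
  rw [(hmem y).mp (hp ▸ Submodule.mem_top), Matrix.smul_mulVec, Matrix.one_mulVec]

/-- An irreducible representation with finite image over `F` is defined over any algebraically
closed subfield `k`: a `k`-basis of a minimal `k`-subspace stable under the group is an `F`-basis of
the whole space, by the density theorem over `k`. -/
theorem exists_descent_of_finite_range {d : ℕ} {r : G →* Matrix (Fin d) (Fin d) F}
    (hr : (matRep r).IsIrreducible) (hfin : (Set.range r).Finite) {k : Type*} [Field k]
    [IsAlgClosed k] (j : k →+* F) :
    ∃ (d' : ℕ) (s : G →* Matrix (Fin d') (Fin d') k), (matRep s).IsIrreducible ∧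
      (Set.range s).Finite ∧ SimRep r
        ((j.mapMatrix : Matrix (Fin d') (Fin d') k →+* Matrix (Fin d') (Fin d') F).toMonoidHom.comp
          s) := by
  let _ : Algebra k F := j.toAlgebra
  have hjs : ∀ (c : k) (y : Fin d → F), c • y = j c • y := fun c y => by
    ext i
    exact Algebra.smul_def c (y i)
  let rk : G →* Module.End k (Fin d → F) :=
    { toFun g := (Matrix.toLin' (r g)).restrictScalars k
      map_one' := by ext; simp
      map_mul' g h := by
        apply LinearMap.ext; intro y
        simp [Matrix.mulVec_mulVec] }
  have hrk : ∀ g y, rk g y = (r g).mulVec y := fun g y => rfl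
  obtain ⟨z⟩ := ((matRep_isIrreducible_iff r).mp hr).1
  -- the `k`-span of the orbit of a vector is finite-dimensional because the image is finite
  let x : Fin d → F := Pi.single z 1
  let U₀ : Submodule k (Fin d → F) := Submodule.span k (Set.range fun g => rk g x)
  have hx : x ∈ U₀ := Submodule.subset_span ⟨1, by simp⟩
  have hfin₀ : FiniteDimensional k U₀ := by
    refine FiniteDimensional.span_of_finite k ?_
    refine (hfin.image fun M => M.mulVec x).subset ?_
    rintro - ⟨g, rfl⟩
    exact ⟨r g, ⟨g, rfl⟩, rfl⟩
  have hU₀ : StableUnder rk U₀ := by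
    intro g y hy
    have : U₀ ≤ U₀.comap (rk g) := by
      rw [Submodule.span_le]
      rintro - ⟨h, rfl⟩
      exact Submodule.subset_span ⟨g * h, by simp [map_mul]⟩
    exact this hy
  have hU₀0 : U₀ ≠ ⊥ := by
    intro h
    rw [h, Submodule.mem_bot] at hx
    have := congrFun hx z
    simp [x] at this
  obtain ⟨U, hUU₀, hU, hU0, hUmin⟩ := exists_minimal_stable hU₀ hU₀0
  have : FiniteDimensional k U := Submodule.finiteDimensional_of_le hUU₀
  obtain ⟨d', s, e, heli, hespan, heact, hirr⟩ := exists_matrix_of_minimal hU hU0 hUmin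
  have heact' : ∀ g a, (r g).mulVec (e a) = ∑ a', j (s g a' a) • e a' := by
    intro g a
    rw [← hrk, heact]
    exact Finset.sum_congr rfl fun a' _ => hjs _ _
  obtain ⟨z'⟩ := ((matRep_isIrreducible_iff s).mp hirr).1
  have hspan : Submodule.span F (Set.range e) = ⊤ := by
    refine (((matRep_isIrreducible_iff r).mp hr).2 _ fun g y hy => ?_).resolve_left
      fun h => ?_
    · have : Submodule.span F (Set.range e) ≤
          (Submodule.span F (Set.range e)).comap (Matrix.toLin' (r g)) := by
        rw [Submodule.span_le]
        rintro - ⟨a, rfl⟩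
        rw [SetLike.mem_coe, Submodule.mem_comap, Matrix.toLin'_apply, heact']
        exact Submodule.sum_mem _ fun a' _ =>
          Submodule.smul_mem _ _ (Submodule.subset_span ⟨a', rfl⟩)
      exact this hy
    · have : e z' ∈ Submodule.span F (Set.range e) := Submodule.subset_span ⟨z', rfl⟩
      rw [h, Submodule.mem_bot] at this
      exact heli.ne_zero z' this
  have hli : LinearIndependent F e := by
    rw [Fintype.linearIndependent_iff]
    intro c hc a
    -- an element of the group algebra over `k` that maps `e a` to `e a` and kills the other vectors
    obtain ⟨X, hX⟩ := exists_sum_smul_eq_of_pairwise_not_simRep (I := Unit) (d := fun _ => d')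
      (fun _ => s) (fun _ => hirr) (fun i j hij => absurd (Subsingleton.elim i j) hij)
      (fun _ => Matrix.single a a 1)
    have key : ∀ X : MonoidAlgebra k G,
        ∑ b, c b • ∑ a', j (MonoidAlgebra.lift k _ G s X a' b) • e a' = 0 := by
      intro X
      induction X using MonoidAlgebra.induction_linear with
      | zero => simp
      | add X Y hX hY =>
        simp only [map_add, Matrix.add_apply, add_smul, Finset.sum_add_distrib, smul_add, hX, hY,
          add_zero]
      | single g b =>
        have h1 : ∀ b',
            ∑ a', j (MonoidAlgebra.lift k _ G s (MonoidAlgebra.single g b) a' b') • e a' =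
              j b • (r g).mulVec (e b') := by
          intro b'
          rw [heact', Finset.smul_sum]
          refine Finset.sum_congr rfl fun a' _ => ?_
          rw [MonoidAlgebra.lift_single, Matrix.smul_apply, smul_eq_mul, map_mul, smul_smul]
        simp only [h1, smul_comm _ (j b), ← Finset.smul_sum]
        have h2 := congrArg (r g).mulVec hc
        rw [Matrix.mulVec_zero, Matrix.mulVec_sum] at h2
        simp only [Matrix.mulVec_smul] at h2
        rw [h2, smul_zero]
    have h1 := key X
    rw [hX ()] at h1
    rw [Finset.sum_eq_single a, Finset.sum_eq_single a] at h1
    · simp only [Matrix.single_apply_same, map_one, one_smul] at h1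
      exact (smul_eq_zero.mp h1).resolve_right (heli.ne_zero a)
    · intro b _ hb
      simp [hb.symm]
    · simp
    · intro b _ hb
      simp [hb.symm]
    · simp
  refine ⟨d', s, hirr, ?_, simRep_of_basis (Module.Basis.mk hli hspan.ge) fun g a => ?_⟩
  · -- the matrix `s g` is determined by `r g`
    choose f hf using fun M : Set.range r => M.2
    have := hfin.to_subtype
    refine (Set.finite_range fun M : Set.range r => s (f M)).subset ?_
    rintro - ⟨g, rfl⟩
    refine ⟨⟨r g, g, rfl⟩, ?_⟩
    ext a' a
    have h1 := heact (f ⟨r g, g, rfl⟩) a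
    have h2 := heact g a
    rw [hrk] at h1 h2
    rw [hf ⟨r g, g, rfl⟩, h2, ← sub_eq_zero, ← Finset.sum_sub_distrib] at h1
    simp only [← sub_smul] at h1
    have := Fintype.linearIndependent_iff.mp heli _ h1 a'
    exact (sub_eq_zero.mp this).symm
  · rw [Module.Basis.mk_apply, heact']
    exact Finset.sum_congr rfl fun a' _ => by rw [Module.Basis.mk_apply]; rfl

/-- An irreducible representation with finite image of inertia is an unramified twist of a
representation with finite image, defined over a given algebraically closed subfield. -/
theorem exists_descent {d : ℕ} {r : G →* Matrix (Fin d) (Fin d) F}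
    (hv : ∀ a b, v (a * b) = v a + v b) {φ : G} (hφ : v φ = 1)
    (hr : (matRep r).IsIrreducible) (hfin : (r '' {g | v g = 0}).Finite) {α : Fˣ} {x : Fin d → F}
    (hx : x ≠ 0) (hα : (r φ).mulVec x = (α : F) • x) {k : Type*} [Field k] [IsAlgClosed k]
    (j : k →+* F) :
    ∃ (d' : ℕ) (s : G →* Matrix (Fin d') (Fin d') k), (matRep s).IsIrreducible ∧
      (Set.range s).Finite ∧ SimRep r (twistRep hv α j s) := by
  obtain ⟨m, hm, hz⟩ := exists_pow_eq_smul_one hv hφ hr hfin hx hα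
  -- after the twist by `α⁻¹`, a power of `φ` acts trivially and the whole image is finite
  let r₀ := twistRep hv α⁻¹ (RingHom.id F) r
  have hr₀ : ∀ g, r₀ g = ((α ^ (-v g) : Fˣ) : F) • r g := by
    intro g
    rw [zpow_neg, ← inv_zpow]
    change ((α⁻¹ ^ v g : Fˣ) : F) • (r g).map id = ((α⁻¹ ^ v g : Fˣ) : F) • r g
    rw [Matrix.map_id]
  have hrr₀ : ∀ g, r g = ((α ^ v g : Fˣ) : F) • r₀ g := by
    intro g
    rw [hr₀, smul_smul, ← Units.val_mul, ← zpow_add]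
    simp
  have hirr : (matRep r₀).IsIrreducible := by
    rw [matRep_isIrreducible_iff] at hr ⊢
    refine ⟨hr.1, fun p hp => hr.2 p fun g y hy => ?_⟩
    rw [hrr₀, Matrix.smul_mulVec]
    exact p.smul_mem _ (hp g y hy)
  have hφm : r₀ (φ ^ m) = 1 := by
    have h1 : v (φ ^ m) = m := by
      have := valuation_zpow hv φ m
      rwa [zpow_natCast, hφ, mul_one] at this
    rw [hr₀, h1, map_pow, hz, smul_smul, zpow_neg, zpow_natCast, ← Units.val_pow_eq_pow_val,
      Units.inv_mul, one_smul]
  have hfin₀ : (Set.range r₀).Finite := by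
    have h1 : (Set.image2 (fun (i : ℕ) (w : Matrix (Fin d) (Fin d) F) => r₀ φ ^ i * w) (Set.Iio m)
        (r '' {g | v g = 0})).Finite := Set.Finite.image2 _ (Set.finite_Iio m) hfin
    refine h1.subset ?_
    rintro - ⟨g, rfl⟩
    have hm' : (m : ℤ) ≠ 0 := by exact_mod_cast hm.ne'
    obtain ⟨i, hi⟩ := Int.eq_ofNat_of_zero_le (Int.emod_nonneg (v g) hm')
    have him : i < m := by
      have := Int.emod_lt_of_pos (v g) (by exact_mod_cast hm : (0 : ℤ) < m)
      omega
    have hτ : v (φ ^ (-v g) * g) = 0 := by rw [hv, valuation_zpow hv, hφ]; ring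
    have hg : g = φ ^ i * (φ ^ m) ^ (v g / m) * (φ ^ (-v g) * g) := by
      have : φ ^ i * (φ ^ m) ^ (v g / m) = φ ^ v g := by
        rw [← zpow_natCast, ← zpow_natCast, ← zpow_mul, ← zpow_add, ← hi, Int.emod_add_mul_ediv]
      rw [this, ← mul_assoc, ← zpow_add, add_neg_cancel, zpow_zero, one_mul]
    refine Set.mem_image2.mpr ⟨i, him, r (φ ^ (-v g) * g), ⟨_, hτ, rfl⟩, ?_⟩
    have h2 : r₀ ((φ ^ m) ^ (v g / m)) = 1 := by
      have : ∀ n : ℕ, r₀ ((φ ^ m) ^ n) = 1 := fun n => by rw [map_pow, hφm, one_pow]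
      have hinv : r₀ (φ ^ m)⁻¹ = 1 := by
        have := map_mul r₀ (φ ^ m) (φ ^ m)⁻¹
        rw [mul_inv_cancel, map_one, hφm, one_mul] at this
        exact this.symm
      rcases Int.eq_nat_or_neg (v g / m) with ⟨n, h | h⟩
      · rw [h, zpow_natCast]; exact this n
      · rw [h, zpow_neg, zpow_natCast, ← inv_pow, map_pow, hinv, one_pow]
    have h3 : r₀ (φ ^ (-v g) * g) = r (φ ^ (-v g) * g) := by
      rw [hr₀, hτ]; simp
    conv_rhs => rw [hg, map_mul, map_mul, h2, mul_one, map_pow, h3]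
  obtain ⟨d', s, hs, hsfin, P, Q, hPQ, hQP, hP⟩ := exists_descent_of_finite_range hirr hfin₀ j
  refine ⟨d', s, hs, hsfin, P, Q, hPQ, hQP, fun g => ?_⟩
  rw [hrr₀, Matrix.smul_mul, hP, twistRep_apply, Matrix.mul_smul]
  rfl

end Descent

/-! ### Characteristic polynomials of pseudorepresentations -/

section PermSum

open Finset

/-- The sum of `∏ i, w (f i)` over all functions `f` that are constant on the cycles of `σ` factors
over the cycles of `σ`, each represented by its least element. -/
theorem prod_cycles_sum_pow {R ι : Type*} [CommRing R] [Fintype ι] [DecidableEq ι] {k : ℕ}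
    (σ : Equiv.Perm (Fin k)) (w : ι → R) :
    (open scoped Classical in
      ∏ i : Fin k with ∀ j : ℕ, i ≤ (σ ^ j) i, ∑ a, w a ^ Function.minimalPeriod σ i) =
      ∑ f : Fin k → ι with f ∘ σ = f, ∏ i, w (f i) := by
  classical
  let L : Finset (Fin k) := univ.filter fun i => ∀ j : ℕ, i ≤ (σ ^ j) i
  -- `c j` is the least element of the cycle of `j`
  let C : Fin k → Finset (Fin k) := fun j => univ.filter fun i => σ.SameCycle j i
  have hC : ∀ j, (C j).Nonempty := fun j =>
    ⟨j, mem_filter.mpr ⟨mem_univ _, Equiv.Perm.SameCycle.refl _ _⟩⟩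
  let c : Fin k → Fin k := fun j => (C j).min' (hC j)
  have hcj : ∀ j, σ.SameCycle j (c j) := fun j => (mem_filter.mp ((C j).min'_mem (hC j))).2
  have hcmin : ∀ j i, σ.SameCycle j i → c j ≤ i := fun j i h =>
    (C j).min'_le i (by simpa [C] using h)
  have hceq : ∀ j i, σ.SameCycle j i → c j = c i := fun j i h =>
    le_antisymm (hcmin j _ (h.trans (hcj i))) (hcmin i _ (h.symm.trans (hcj j)))
  have hLc : ∀ i, i ∈ L ↔ c i = i := by
    intro i
    refine ⟨fun h => le_antisymm (hcmin i i (Equiv.Perm.SameCycle.refl _ _)) ?_, fun h => ?_⟩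
    · obtain ⟨j, hj⟩ := (hcj i).exists_nat_pow_eq
      rw [← hj]
      exact (mem_filter.mp h).2 j
    · refine mem_filter.mpr ⟨mem_univ _, fun j => ?_⟩
      conv_lhs => rw [← h]
      exact hcmin i _ ⟨j, by simp⟩
  have hcc : ∀ j, c (c j) = c j := fun j => (hceq _ _ (hcj j)).symm
  have hcL : ∀ j, c j ∈ L := fun j => (hLc _).mpr (hcc j)
  have hcard : ∀ i ∈ L, (univ.filter fun j => c j = i).card = Function.minimalPeriod σ i := by
    intro i hi
    have him : (univ.filter fun j => c j = i) =
        (range (Function.minimalPeriod σ i)).image fun m => σ^[m] i := by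
      ext j
      simp only [mem_filter, mem_univ, true_and, mem_image, mem_range]
      constructor
      · intro h
        obtain ⟨m, hm⟩ := (h ▸ hcj j : σ.SameCycle j i).symm.exists_nat_pow_eq
        refine ⟨m % Function.minimalPeriod σ i, Nat.mod_lt _ ?_, ?_⟩
        · exact Function.minimalPeriod_pos_of_mem_periodicPts
            (Function.Injective.mem_periodicPts σ.injective i)
        · rw [Function.iterate_mod_minimalPeriod_eq, ← hm, Equiv.Perm.iterate_eq_pow]
      · rintro ⟨m, -, rfl⟩
        rw [← (hLc i).mp hi]
        conv_rhs => rw [hceq i (σ^[m] i) ⟨m, by simp [Equiv.Perm.iterate_eq_pow]⟩]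
        rw [(hLc i).mp hi]
    rw [him, card_image_of_injOn, card_range]
    intro a ha b hb h
    exact Function.iterate_injOn_Iio_minimalPeriod (mem_range.mp ha) (mem_range.mp hb) h
  have hprod : ∀ g : Fin k → ι,
      ∏ i, w (g (c i)) = ∏ i ∈ L, w (g i) ^ Function.minimalPeriod σ i := by
    intro g
    rw [← prod_fiberwise_of_maps_to (s := univ) (t := L) (g := c) fun j _ => hcL j]
    refine prod_congr rfl fun i hi => ?_
    rw [← hcard i hi, ← prod_const]
    exact prod_congr rfl fun j hj => by rw [(mem_filter.mp hj).2]
  have hfix : ∀ f : Fin k → ι, f ∘ σ = f → ∀ i, f (c i) = f i := by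
    intro f hf i
    obtain ⟨m, hm⟩ := (hcj i).exists_nat_pow_eq
    rw [← hm]
    clear hm
    induction m with
    | zero => simp
    | succ m ih => rw [pow_succ', Equiv.Perm.mul_apply, ← ih]; exact congrFun hf _
  change ∏ i ∈ L, ∑ a, w a ^ Function.minimalPeriod σ i = _
  rw [← prod_coe_sort L (fun i => ∑ a, w a ^ Function.minimalPeriod σ i),
    prod_univ_sum, Fintype.piFinset_univ]
  refine sum_bij' (fun g _ => fun i => g ⟨c i, hcL i⟩) (fun f _ => fun i => f i) ?_ ?_ ?_ ?_ ?_
  · intro g _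
    refine mem_filter.mpr ⟨mem_univ _, ?_⟩
    funext i
    have : c (σ i) = c i := (hceq _ _ ⟨1, by simp⟩).symm
    simp only [Function.comp_apply, this]
  · intro f _; exact mem_univ _
  · intro g _
    funext i
    have := (hLc i).mp i.2
    simp only [this]
  · intro f hf
    funext i
    exact hfix f (mem_filter.mp hf).2 i
  · intro g _
    by_cases hk : Nonempty L
    · obtain ⟨l⟩ := hk
      let g' : Fin k → ι := fun i => if h : i ∈ L then g ⟨i, h⟩ else g l
      have h1 : ∀ i : L, g i = g' i := fun i => by simp [g']
      have h2 : ∀ i, g ⟨c i, hcL i⟩ = g' (c i) := fun i => by simp [g', hcL]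
      simp only [h1]
      rw [hprod g', prod_coe_sort L fun i => w (g' i) ^ Function.minimalPeriod σ i]
    · have : IsEmpty L := not_nonempty_iff.mp hk
      have : IsEmpty (Fin k) := ⟨fun i => this.false ⟨c i, hcL i⟩⟩
      simp

/-- The alternating sum over the permutations fixing a function `f` under precomposition vanishes
unless `f` is injective. -/
theorem sum_sign_filter_comp_eq {ι : Type*} [DecidableEq ι] {k : ℕ} (f : Fin k → ι) :
    ∑ σ ∈ (univ : Finset (Equiv.Perm (Fin k))).filter (fun σ : Equiv.Perm (Fin k) => f ∘ ⇑σ = f),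
      (Equiv.Perm.sign σ : ℤ) =
      if Function.Injective f then 1 else 0 := by
  split_ifs with hf
  · rw [sum_eq_single_of_mem 1 (by simp)]
    · simp
    · intro σ hσ hne
      refine absurd (Equiv.ext fun i => hf ?_) hne
      exact congrFun (mem_filter.mp hσ).2 i
  · rw [Function.Injective] at hf
    push Not at hf
    obtain ⟨i, j, hij, hne⟩ := hf
    -- multiplication by a transposition that fixes `f` cancels permutations of opposite signs
    have hsw : f ∘ Equiv.swap i j = f := by
      funext l
      simp only [Function.comp_apply, Equiv.swap_apply_def]
      split_ifs with h1 h2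
      · rw [h1, hij]
      · rw [h2, hij]
      · rfl
    refine sum_involution (fun σ _ => Equiv.swap i j * σ) ?_ ?_ ?_ ?_
    · intro σ _
      simp [Equiv.Perm.sign_swap hne]
    · intro σ _ _ h
      have := mul_eq_right.mp h
      exact hne (Equiv.swap_eq_one_iff.mp this)
    · intro σ hσ
      refine mem_filter.mpr ⟨mem_univ _, ?_⟩
      rw [Equiv.Perm.coe_mul, ← Function.comp_assoc, hsw, (mem_filter.mp hσ).2]
    · intro σ _
      simp [← mul_assoc]

/-- A set with `k` elements has `k!` enumerations by `Fin k`. -/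
theorem card_filter_injective_image_eq {ι : Type*} [Fintype ι] [DecidableEq ι] {k : ℕ}
    {s : Finset ι} (hs : s.card = k) :
    (univ.filter fun f : Fin k → ι => Function.Injective f ∧ univ.image f = s).card =
      k.factorial := by
  classical
  rw [← Fintype.card_subtype, ← Fintype.card_fin k, Fintype.card_fin k]
  have e : Fin k ≃ s := (Fintype.equivFinOfCardEq (by simpa using hs)).symm
  have hk : Fintype.card (Fin k ≃ s) = k.factorial := by
    rw [Fintype.card_equiv e, Fintype.card_fin]
  rw [← hk]
  refine Fintype.card_congr
    { toFun := fun f => Equiv.ofBijective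
        (fun i => (⟨f.1 i, f.2.2.subset (mem_image_of_mem _ (mem_univ i))⟩ : s)) ⟨?_, ?_⟩
      invFun := fun e => ⟨fun i => e i, Subtype.val_injective.comp e.injective, ?_⟩
      left_inv := fun f => rfl
      right_inv := fun e => by ext; rfl }
  · intro a b hab
    exact f.2.1 (congrArg Subtype.val hab)
  · rintro ⟨x, hx⟩
    rw [← f.2.2] at hx
    obtain ⟨i, -, hi⟩ := mem_image.mp hx
    exact ⟨i, Subtype.ext hi⟩
  · ext x
    simp only [mem_image, mem_univ, true_and]
    constructor
    · rintro ⟨i, rfl⟩; exact (e i).2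
    · intro hx; exact ⟨e.symm ⟨x, hx⟩, by simp⟩

/-- If `T(x ^ m)` is the `m`-th power sum of the `w i`, then `S_k(T)(x, …, x)` is `k!` times their
`k`-th elementary symmetric polynomial. -/
theorem pseudoSum_eq_factorial_mul {G R ι : Type*} [Group G] [CommRing R] [Fintype ι]
    [DecidableEq ι] {T : G → R} {x : G} {w : ι → R}
    (h : ∀ m : ℕ, T (x ^ m) = ∑ i, w i ^ m) (k : ℕ) :
    pseudoSum T k (fun _ => x) =
      k.factorial * ∑ s ∈ powersetCard k (univ : Finset ι), ∏ i ∈ s, w i := by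
  classical
  have h1 : ∀ σ : Equiv.Perm (Fin k), cycleTrace T σ (fun _ => x) =
      ∑ f : Fin k → ι with f ∘ σ = f, ∏ i, w (f i) := by
    intro σ
    rw [← prod_cycles_sum_pow σ w, cycleTrace]
    refine prod_congr rfl fun i _ => ?_
    rw [← h]
    simp
  simp only [pseudoSum, h1, sum_filter, mul_sum]
  rw [sum_comm]
  have h2 : ∀ f : Fin k → ι, (∑ σ : Equiv.Perm (Fin k), ((Equiv.Perm.sign σ : ℤ) : R) *
      (if f ∘ σ = f then ∏ i, w (f i) else 0)) =
      if Function.Injective f then ∏ i, w (f i) else 0 := by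
    intro f
    have := congrArg (fun z : ℤ => (z : R) * ∏ i, w (f i)) (sum_sign_filter_comp_eq f)
    simp only [Int.cast_sum, sum_filter, sum_mul] at this
    convert this using 1
    · refine sum_congr rfl fun σ _ => ?_
      split_ifs <;> simp
    · split_ifs <;> simp
  simp only [h2]
  rw [← sum_filter, ← sum_fiberwise_of_maps_to (t := powersetCard k (univ : Finset ι))
    (g := fun f => univ.image f)]
  · refine sum_congr rfl fun s hs => ?_
    rw [filter_filter, ← card_filter_injective_image_eq (mem_powersetCard.mp hs).2, ← nsmul_eq_mul]
    refine sum_eq_card_nsmul fun f hf => ?_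
    obtain ⟨-, hfi, rfl⟩ := mem_filter.mp hf
    rw [prod_image fun a _ b _ hab => hfi hab]
  · intro f hf
    refine mem_powersetCard.mpr ⟨subset_univ _, ?_⟩
    rw [card_image_of_injective _ (mem_filter.mp hf).2, card_univ, Fintype.card_fin]

end PermSum

section Charpoly

open Polynomial

variable {G : Type*} [Group G]

theorem map_pseudoSum {A B : Type*} [CommRing A] [CommRing B] (g : A →+* B) (T : G → A) (k : ℕ)
    (x : Fin k → G) : g (pseudoSum T k x) = pseudoSum (fun σ => g (T σ)) k x := by
  simp [pseudoSum, cycleTrace, map_sum, map_mul, map_prod]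

theorem pseudoSum_zero {A : Type*} [CommRing A] (T : G → A) (x : Fin 0 → G) :
    pseudoSum T 0 x = 1 := by
  simp [pseudoSum, cycleTrace]

variable {S : Type*} [CommRing S] [IsDomain S]

/-- If `T(x ^ m)` is the `m`-th power sum of `w 0, …, w (n - 1)`, then the characteristic polynomial
of `x` is `∏ (X - w i)`. -/
theorem map_pseudoCharpoly_eq_prod [CharZero S] {T : G → S} {n : ℕ} {x : G} {F : Type*}
    [Field F] [CharZero F] (g : FractionRing S →+* F) {w : Fin n → F}
    (h : ∀ m : ℕ, g (algebraMap S _ (T (x ^ m))) = ∑ i, w i ^ m) :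
    (pseudoCharpoly T n x).map g = ∏ i, (X - C (w i)) := by
  have h1 : ∀ k, g (algebraMap S _ (pseudoSum T k fun _ => x)) =
      k.factorial * ∑ s ∈ Finset.powersetCard k (Finset.univ : Finset (Fin n)), ∏ i ∈ s, w i := by
    intro k
    rw [← RingHom.comp_apply, map_pseudoSum]
    exact pseudoSum_eq_factorial_mul h k
  have h2 := Multiset.prod_X_sub_X_eq_sum_esymm (Finset.univ.val.map w)
  rw [Multiset.map_map, Multiset.card_map] at h2
  have h3 : (Multiset.map ((fun t => X - C t) ∘ w) Finset.univ.val).prod = ∏ i, (X - C (w i)) := rfl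
  rw [← h3, h2, pseudoCharpoly, Polynomial.map_sum]
  simp only [Finset.card_val, Finset.card_univ, Fintype.card_fin, Finset.esymm_map_val,
    Polynomial.map_monomial, map_mul, map_pow, map_neg, map_one, map_inv₀, map_natCast, h1]
  refine Finset.sum_congr rfl fun k _ => ?_
  have hk : (k.factorial : F) ≠ 0 := Nat.cast_ne_zero.mpr k.factorial_ne_zero
  rw [mul_assoc ((-1 : F) ^ k), inv_mul_cancel_left₀ hk, ← C_mul_X_pow_eq_monomial, C_mul]
  simp only [map_pow, map_neg, map_one, mul_assoc]

/-- The denominators of the characteristic polynomial are cleared by `n!`. -/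
theorem factorial_mul_pseudoCharpoly [CharZero S] {T : G → S} {n : ℕ} {x : G} :
    C (n.factorial : FractionRing S) * pseudoCharpoly T n x =
      (∑ k ∈ Finset.range (n + 1), monomial (n - k) ((-1) ^ k *
        (n.descFactorial (n - k) : S) * pseudoSum T k fun _ => x)).map
          (algebraMap S (FractionRing S)) := by
  rw [pseudoCharpoly, Finset.mul_sum, Polynomial.map_sum]
  refine Finset.sum_congr rfl fun k hk => ?_
  have hk' : (k.factorial : FractionRing S) ≠ 0 := Nat.cast_ne_zero.mpr k.factorial_ne_zero
  have hkn : k ≤ n := Nat.lt_succ_iff.mp (Finset.mem_range.mp hk)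
  have h1 := Nat.factorial_mul_descFactorial (Nat.sub_le n k)
  rw [Nat.sub_sub_self hkn] at h1
  rw [Polynomial.map_monomial, C_mul_monomial, ← h1]
  congr 1
  simp only [map_mul, map_pow, map_neg, map_one, map_natCast, Nat.cast_mul]
  field_simp

theorem coeff_pseudoCharpoly_self (T : G → S) (n : ℕ) (x : G) :
    (pseudoCharpoly T n x).coeff n = 1 := by
  rw [pseudoCharpoly, finsetSum_coeff, Finset.sum_eq_single 0]
  · simp [pseudoSum_zero]
  · intro k hk hk0
    rw [coeff_monomial, if_neg]
    have := Finset.mem_range.mp hk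
    omega
  · simp

theorem natDegree_pseudoCharpoly_le (T : G → S) (n : ℕ) (x : G) :
    (pseudoCharpoly T n x).natDegree ≤ n := by
  refine natDegree_sum_le_of_forall_le _ _ fun k _ => ?_
  exact (natDegree_monomial_le _).trans (Nat.sub_le n k)

theorem pseudoCharpoly_natDegree (T : G → S) (n : ℕ) (x : G) :
    (pseudoCharpoly T n x).natDegree = n :=
  natDegree_eq_of_le_of_coeff_ne_zero (natDegree_pseudoCharpoly_le T n x) (by
    rw [coeff_pseudoCharpoly_self]; exact one_ne_zero)

theorem pseudoCharpoly_monic (T : G → S) (n : ℕ) (x : G) : (pseudoCharpoly T n x).Monic := by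
  rw [Monic, leadingCoeff, pseudoCharpoly_natDegree, coeff_pseudoCharpoly_self]

/-- A root of the characteristic polynomial becomes integral over `S` after multiplication by
`n!`. -/
theorem isIntegral_factorial_mul_of_isRoot [CharZero S] {T : G → S} {n : ℕ} {x : G} {L : Type*}
    [Field L] [Algebra (FractionRing S) L] [Algebra S L] [IsScalarTower S (FractionRing S) L]
    {y : L} (hy : aeval y (pseudoCharpoly T n x) = 0) : IsIntegral S ((n.factorial : L) * y) := by
  set P : S[X] := ∑ k ∈ Finset.range (n + 1), monomial (n - k) ((-1) ^ k *
        (n.descFactorial (n - k) : S) * pseudoSum T k fun _ => x) with hP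
  have hPmap : P.map (algebraMap S (FractionRing S)) =
    C (n.factorial : FractionRing S) * pseudoCharpoly T n x := factorial_mul_pseudoCharpoly.symm
  have hinj := IsFractionRing.injective S (FractionRing S)
  have hfac : (n.factorial : FractionRing S) ≠ 0 := Nat.cast_ne_zero.mpr n.factorial_ne_zero
  have hlc : P.leadingCoeff = n.factorial := by
    apply hinj
    rw [← leadingCoeff_map_of_injective hinj, hPmap, leadingCoeff_mul, leadingCoeff_C,
      (pseudoCharpoly_monic T n x).leadingCoeff, mul_one, map_natCast]
  have h0 : aeval y P = 0 := by
    rw [← aeval_map_algebraMap (FractionRing S), hPmap, map_mul, hy, mul_zero]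
  have := isIntegral_leadingCoeff_smul P y h0
  rwa [hlc, Algebra.smul_def, map_natCast] at this

/-- A root of the characteristic polynomial is integral if the coefficients are. -/
theorem isIntegral_of_isRoot_of_coeff {T : G → S} {n : ℕ} {x : G} {L : Type*} [Field L]
    [Algebra (FractionRing S) L] [Algebra S L] [IsScalarTower S (FractionRing S) L] {y : L}
    (hy : aeval y (pseudoCharpoly T n x) = 0)
    (hc : ∀ k, IsIntegral S ((pseudoCharpoly T n x).coeff k)) : IsIntegral S y := by
  have hmem : ∀ k, (pseudoCharpoly T n x).coeff k ∈
      (algebraMap (integralClosure S (FractionRing S)) (FractionRing S)).range := fun k =>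
    ⟨⟨_, hc k⟩, rfl⟩
  have hlift : pseudoCharpoly T n x ∈
      lifts (algebraMap (integralClosure S (FractionRing S)) (FractionRing S)) :=
    (lifts_iff_coeff_lifts _).mpr hmem
  obtain ⟨P, hP, -, hPm⟩ := lifts_and_natDegree_eq_and_monic hlift (pseudoCharpoly_monic T n x)
  have h1 : IsIntegral (integralClosure S (FractionRing S)) y := by
    refine ⟨P, hPm, ?_⟩
    rw [← hP, aeval_def, eval₂_map] at hy
    exact hy
  exact isIntegral_trans (A := integralClosure S (FractionRing S)) y h1

end Charpoly

section Eigen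

theorem exists_eigenbasis {F : Type*} [Field F] [IsAlgClosed F] {n : ℕ}
    {X : Matrix (Fin n) (Fin n) F} (hX : Module.End.IsSemisimple (Matrix.toLin' X)) :
    ∃ (b : Module.Basis (Fin n) F (Fin n → F)) (w : Fin n → F),
      ∀ i, X.mulVec (b i) = w i • b i := by
  let E : Set (Fin n → F) := {y | ∃ μ : F, X.mulVec y = μ • y}
  have hE : ⊤ ≤ Submodule.span F E := by
    rw [← Module.End.IsSemisimple.iSup_eigenspace_eq_top hX]
    refine iSup_le fun μ y hy => Submodule.subset_span ⟨μ, ?_⟩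
    exact Module.End.mem_eigenspace_iff.mp hy
  let b₀ := Module.Basis.ofSpan hE
  have hb₀ : ∀ i, b₀ i ∈ E := fun i => Module.Basis.ofSpan_subset hE ⟨i, rfl⟩
  have := Module.Finite.finite_basis b₀
  have := Fintype.ofFinite
    ((linearIndepOn_empty F (id : (Fin n → F) → _)).extend (Set.empty_subset E))
  let b : Module.Basis (Fin n) F (Fin n → F) := b₀.reindex (Fintype.equivFinOfCardEq (by
    rw [← Module.finrank_eq_card_basis b₀, Module.finrank_fin_fun]))
  have hb : ∀ i, ∃ μ : F, X.mulVec (b i) = μ • b i := fun i => by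
    rw [Module.Basis.reindex_apply]; exact hb₀ _
  choose w hw using hb
  exact ⟨b, w, hw⟩

variable {F : Type*} [Field F] {n : ℕ} {X : Matrix (Fin n) (Fin n) F}
  {b : Module.Basis (Fin n) F (Fin n → F)} {w : Fin n → F}

theorem trace_pow_of_eigenbasis (hw : ∀ i, X.mulVec (b i) = w i • b i) (m : ℕ) :
    (X ^ m).trace = ∑ i, w i ^ m := by
  have hpow : ∀ i, (X ^ m).mulVec (b i) = w i ^ m • b i := by
    intro i
    induction m with
    | zero => simp
    | succ m ih =>
      rw [pow_succ, ← Matrix.mulVec_mulVec, hw, Matrix.mulVec_smul, ih, smul_smul, ← pow_succ']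
  rw [← Matrix.trace_toLin'_eq, LinearMap.trace_eq_matrix_trace F b, Matrix.trace]
  refine Finset.sum_congr rfl fun i _ => ?_
  rw [Matrix.diag_apply, LinearMap.toMatrix_apply, Matrix.toLin'_apply, hpow, map_smul]
  simp

theorem exists_eq_of_eigenbasis (hw : ∀ i, X.mulVec (b i) = w i • b i) {α : F} {y : Fin n → F}
    (hy : y ≠ 0) (hα : X.mulVec y = α • y) : ∃ i, w i = α := by
  by_contra hne
  push Not at hne
  refine hy (b.repr.map_eq_zero_iff.mp (Finsupp.ext fun i => ?_))
  have h1 := congrArg (fun z => b.repr z i) hα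
  have h2 : b.repr (X.mulVec y) i = w i * b.repr y i := by
    conv_lhs => rw [← b.sum_repr y]
    simp only [Matrix.mulVec_sum, Matrix.mulVec_smul, hw, map_sum, map_smul, Finsupp.coe_finsetSum,
      Finset.sum_apply, Finsupp.smul_apply, b.repr_self, smul_eq_mul]
    rw [Finset.sum_eq_single i]
    · simp [mul_comm]
    · intro j _ hj; simp [hj]
    · simp
  simp only [h2, map_smul, Finsupp.smul_apply, smul_eq_mul] at h1
  have h3 : (w i - α) * b.repr y i = 0 := by rw [sub_mul, h1, sub_self]
  exact (mul_eq_zero.mp h3).resolve_left (sub_ne_zero.mpr (hne i))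

/-- If the traces of a semisimple representation of `G` come from `T`, then the eigenvalues of an
element are roots of its characteristic polynomial with respect to `T`. -/
theorem isRoot_pseudoCharpoly {G S : Type*} [Group G] [CommRing S] [IsDomain S] [CharZero S]
    [CharZero F] [IsAlgClosed F] {T : G → S} {g : FractionRing S →+* F}
    {r : G →* Matrix (Fin n) (Fin n) F} (h : ∀ x, g (algebraMap S _ (T x)) = (r x).trace) {x : G}
    (hx : Module.End.IsSemisimple (Matrix.toLin' (r x))) {α : Fˣ} {y : Fin n → F} (hy : y ≠ 0)
    (hα : (r x).mulVec y = (α : F) • y) :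
    ((pseudoCharpoly T n x).map g).IsRoot α ∧
      ((pseudoCharpoly T n x⁻¹).map g).IsRoot ((α⁻¹ : Fˣ) : F) := by
  -- in an eigenbasis the traces of the powers are power sums of the eigenvalues
  obtain ⟨b, w, hw⟩ := exists_eigenbasis hx
  have hinv : r x⁻¹ * r x = 1 := by rw [← map_mul, inv_mul_cancel, map_one]
  have hw0 : ∀ i, w i ≠ 0 := by
    intro i h0
    have h1 := congrArg (r x⁻¹).mulVec (hw i)
    rw [Matrix.mulVec_mulVec, hinv, Matrix.one_mulVec, h0, zero_smul, Matrix.mulVec_zero] at h1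
    exact b.ne_zero i h1
  have hw' : ∀ i, (r x⁻¹).mulVec (b i) = (w i)⁻¹ • b i := by
    intro i
    have h1 := congrArg (fun z => (w i)⁻¹ • (r x⁻¹).mulVec z) (hw i)
    simp only [Matrix.mulVec_mulVec, hinv, Matrix.one_mulVec, Matrix.mulVec_smul, smul_smul,
      inv_mul_cancel₀ (hw0 i), one_smul] at h1
    exact h1.symm
  obtain ⟨i, hi⟩ := exists_eq_of_eigenbasis hw hy hα
  constructor
  · rw [map_pseudoCharpoly_eq_prod g (w := w) fun m => by
      rw [h, map_pow, trace_pow_of_eigenbasis hw]]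
    rw [Polynomial.IsRoot, Polynomial.eval_prod]
    exact Finset.prod_eq_zero (Finset.mem_univ i) (by simp [hi])
  · rw [map_pseudoCharpoly_eq_prod g (w := fun i => (w i)⁻¹) fun m => by
      rw [h, map_pow, trace_pow_of_eigenbasis hw']]
    rw [Polynomial.IsRoot, Polynomial.eval_prod]
    exact Finset.prod_eq_zero (Finset.mem_univ i) (by simp [hi])

end Eigen

/-! ### Coefficient rings and lifts to integral closures -/

section InvP

variable {p : ℕ}

@[simp]
theorem invMap_algebraMap {A B : Type*} [CommRing A] [CommRing B] (f : A →+* B) (a : A) :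
    invMap p f (algebraMap A (InvP p A) a) = algebraMap B (InvP p B) (f a) :=
  IsLocalization.Away.lift_eq _ _ _

theorem invP_ringHom_ext {A B : Type*} [CommRing A] [CommRing B] {g h : InvP p A →+* B}
    (H : ∀ a, g (algebraMap A (InvP p A) a) = h (algebraMap A (InvP p A) a)) : g = h :=
  IsLocalization.ringHom_ext (Submonoid.powers (p : A)) (RingHom.ext H)

variable [hp : Fact p.Prime]

@[simp]
theorem invLift_algebraMap {A F : Type*} [CommRing A] [Field F] [CharZero F] (f : A →+* F) (a : A) :
    invLift p f (algebraMap A (InvP p A) a) = f a :=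
  IsLocalization.Away.lift_eq _ _ _

theorem invLift_injective {A F : Type*} [CommRing A] [Field F] [CharZero F] {f : A →+* F}
    (hf : Function.Injective f) : Function.Injective (invLift p f) := by
  rw [injective_iff_map_eq_zero]
  intro z hz
  obtain ⟨n, a, h⟩ := IsLocalization.Away.surj (p : A) z
  have h1 := congrArg (invLift p f) h
  rw [map_mul, hz, zero_mul, invLift_algebraMap] at h1
  rw [(map_eq_zero_iff f hf).mp h1.symm, map_zero] at h
  have hu := (IsLocalization.Away.algebraMap_isUnit (S := InvP p A) (p : A)).pow n
  exact hu.mul_left_eq_zero.mp h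

end InvP

section IntalToBar

variable {p : ℕ} [hp : Fact p.Prime] {S : Type*} [CommRing S] [IsDomain S] [CharZero S]

instance : CharZero (FractionRing S) :=
  charZero_of_injective_algebraMap (IsFractionRing.injective S (FractionRing S))

theorem intalToBar_injective : Function.Injective (intalToBar p S) :=
  invLift_injective Subtype.val_injective

@[simp]
theorem intalToBar_algebraMap (a : Intal S) :
    intalToBar p S (algebraMap (Intal S) (InvP p (Intal S)) a) = a :=
  invLift_algebraMap _ a

variable [Algebra ℤ_[p] S]

/-- An element of `Q̄(S)` that becomes integral after multiplication by a nonzero integer lies in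
`S^intal[1/p]`, since every integer prime to `p` is invertible in `ℤ_p ⊆ S`. -/
theorem mem_range_intalToBar {N : ℕ} (hN : N ≠ 0) {y : QBar S}
    (hy : IsIntegral S ((N : QBar S) * y)) : y ∈ (intalToBar p S).range := by
  have hN' : (N : ℤ_[p]) ≠ 0 := Nat.cast_ne_zero.mpr hN
  set u := PadicInt.unitCoeff hN' with hu
  set e := (N : ℤ_[p]).valuation with he
  have hspec : (N : ℤ_[p]) = (u : ℤ_[p]) * (p : ℤ_[p]) ^ e := PadicInt.unitCoeff_spec hN'
  let g : ℤ_[p] →+* QBar S := (algebraMap S (QBar S)).comp (algebraMap ℤ_[p] S)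
  have h1 : g ((u⁻¹ : ℤ_[p]ˣ) : ℤ_[p]) * (N : QBar S) = (p : QBar S) ^ e := by
    rw [← map_natCast g N, ← map_mul, hspec, ← mul_assoc, Units.inv_mul, one_mul, map_pow,
      map_natCast]
  have h2 : IsIntegral S ((p : QBar S) ^ e * y) := by
    rw [← h1, mul_assoc]
    exact (isIntegral_algebraMap (A := QBar S)).mul hy
  obtain ⟨v, hv⟩ :=
    (IsLocalization.Away.algebraMap_isUnit (S := InvP p (Intal S)) (p : Intal S)).pow e
  refine ⟨algebraMap (Intal S) _ ⟨_, h2⟩ * ((v⁻¹ : (InvP p (Intal S))ˣ) : InvP p (Intal S)), ?_⟩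
  have h3 : intalToBar p S v = (p : QBar S) ^ e := by
    rw [hv, map_pow, intalToBar_algebraMap]
    simp
  have hp0 : (p : QBar S) ^ e ≠ 0 := pow_ne_zero _ (Nat.cast_ne_zero.mpr hp.out.ne_zero)
  have h4 : intalToBar p S v *
      intalToBar p S ((v⁻¹ : (InvP p (Intal S))ˣ) : InvP p (Intal S)) = 1 := by
    rw [← map_mul, Units.mul_inv, map_one]
  rw [h3] at h4
  rw [map_mul, intalToBar_algebraMap]
  change (p : QBar S) ^ e * y * _ = y
  rw [mul_right_comm, h4, one_mul]

/-- The multiplier of an algebraic number does not depend on the ring over which integrality is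
considered. -/
theorem exists_isIntegral_natCast_mul {L : Type*} [Field L] [Algebra ℚ L] {y : L}
    (hy : IsAlgebraic ℚ y) : ∃ N : ℕ, N ≠ 0 ∧
      ∀ (S : Type*) [CommRing S] [Algebra S L], IsIntegral S ((N : L) * y) := by
  have hy' : IsAlgebraic ℤ y := (IsFractionRing.isAlgebraic_iff ℤ ℚ L).mpr hy
  obtain ⟨N, hN, hint⟩ := hy'.exists_integral_multiple
  refine ⟨N.natAbs, Int.natAbs_ne_zero.mpr hN, fun S _ _ => ?_⟩
  have hint' : IsIntegral S ((N : L) * y) := by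
    rw [zsmul_eq_mul] at hint
    exact hint.map_of_comp_eq (Int.castRingHom S) (RingHom.id L) (Subsingleton.elim _ _)
  rcases Int.natAbs_eq N with h | h
  · rw [h] at hint'; simpa using hint'
  · rw [h] at hint'; simpa using hint'.neg

/-- The algebraic numbers in `Q̄(S)` lie in `S^intal[1/p]`. -/
theorem nonempty_ringHom_algebraicClosure_rat (p : ℕ) [Fact p.Prime] (S : Type*) [CommRing S]
    [IsDomain S] [CharZero S] [Algebra ℤ_[p] S] :
    Nonempty (algebraicClosure ℚ (QBar S) →+* InvP p (Intal S)) := by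
  have hj : ∀ x : algebraicClosure ℚ (QBar S), (x : QBar S) ∈ (intalToBar p S).range := by
    intro x
    obtain ⟨N, hN, h⟩ := exists_isIntegral_natCast_mul (mem_algebraicClosure_iff.mp x.2)
    exact mem_range_intalToBar hN (h S)
  let e := RingEquiv.ofLeftInverse (f := intalToBar p S) (g := Function.invFun (intalToBar p S))
    (Function.leftInverse_invFun intalToBar_injective)
  exact ⟨e.symm.toRingHom.comp
    ((algebraMap (algebraicClosure ℚ (QBar S)) (QBar S)).codRestrict _ hj)⟩

end IntalToBar

section Lifts

variable {p : ℕ} [Fact p.Prime] {S O : Type*} [CommRing S] [IsDomain S] [CommRing O] [IsDomain O]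
  {res : S →+* O}

theorem isAlgebraic_qBar (S : Type*) [CommRing S] [IsDomain S] : Algebra.IsAlgebraic S (QBar S) :=
  IsFractionRing.comap_isAlgebraic_iff.mpr
    (inferInstance : Algebra.IsAlgebraic (FractionRing S) (QBar S))

theorem algebraMap_qBar_injective (S : Type*) [CommRing S] [IsDomain S] :
    Function.Injective (algebraMap S (QBar S)) := by
  rw [IsScalarTower.algebraMap_eq S (FractionRing S) (QBar S)]
  exact (algebraMap (FractionRing S) (QBar S)).injective.comp (IsFractionRing.injective _ _)

theorem algebraMap_intal_injective (S : Type*) [CommRing S] [IsDomain S] :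
    Function.Injective (algebraMap S (Intal S)) := fun _ _ h =>
  algebraMap_qBar_injective S (congrArg (algebraMap (Intal S) (QBar S)) h)

theorem isFractionRing_intal (S : Type*) [CommRing S] [IsDomain S] :
    IsFractionRing (Intal S) (QBar S) :=
  have := isAlgebraic_qBar S
  integralClosure.isFractionRing_of_algebraic fun _ hx =>
    (map_eq_zero_iff _ (algebraMap_qBar_injective S)).mp hx

theorem IsLift.injective {resL : Intal S →+* Intal O} (h : IsLift res resL)
    (hres : Function.Injective res) : Function.Injective resL := by
  rw [RingHom.injective_iff_ker_eq_bot]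
  refine Ideal.eq_bot_of_comap_eq_bot (R := S) ?_
  rw [eq_bot_iff]
  intro x hx
  rw [Ideal.mem_comap, RingHom.mem_ker, h] at hx
  exact hres (algebraMap_intal_injective O (by rw [hx, map_zero, map_zero]))

/-- An injective homomorphism lifts to the integral closures, by an embedding of the algebraic
closures of the fraction fields. -/
theorem exists_isLift (hres : Function.Injective res) :
    ∃ resL : Intal S →+* Intal O, IsLift res resL := by
  let i : FractionRing S →+* QBar O :=
    (algebraMap (FractionRing O) (QBar O)).comp (IsFractionRing.map (K := FractionRing S)
      (L := FractionRing O) hres)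
  let _ : Algebra (FractionRing S) (QBar O) := i.toAlgebra
  have : Module.IsTorsionFree (FractionRing S) (QBar O) :=
    Module.isTorsionFree_iff_algebraMap_injective.mpr i.injective
  let R : QBar S →ₐ[FractionRing S] QBar O := IsAlgClosed.lift
  have hR : ∀ x, R (algebraMap S (QBar S) x) = algebraMap O (QBar O) (res x) := by
    intro x
    rw [IsScalarTower.algebraMap_apply S (FractionRing S) (QBar S), R.commutes]
    change algebraMap (FractionRing O) (QBar O) (IsFractionRing.map hres _) = _
    rw [IsFractionRing.map, IsLocalization.map_eq, ← IsScalarTower.algebraMap_apply]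
  have hint : ∀ z : Intal S, R z ∈ integralClosure O (QBar O) := by
    intro z
    have h1 : IsIntegral S (z : QBar S) := z.2
    exact h1.map_of_comp_eq res (R : QBar S →+* QBar O) (RingHom.ext fun x => (hR x).symm)
  refine ⟨((R : QBar S →+* QBar O).comp (algebraMap (Intal S) (QBar S))).codRestrict
    (integralClosure O (QBar O)) hint, fun x => Subtype.ext ?_⟩
  exact hR x

/-- A homomorphism to an algebraically closed field lifts to the integral closure: by lying over
there is a prime above its kernel, and the residue extension is integral and so embeds into the
field. -/
theorem exists_isLiftToField {F : Type*} [Field F] [IsAlgClosed F] (f : O →+* F) :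
    ∃ fL : Intal O →+* F, IsLiftToField f fL := by
  have hP : (RingHom.ker f).IsPrime := RingHom.ker_isPrime f
  obtain ⟨Q, -, hQ, hQP⟩ := Ideal.exists_ideal_over_prime_of_isIntegral (S := Intal O)
    (RingHom.ker f) ⊥ (by
      intro x hx
      rw [Ideal.mem_comap, Ideal.mem_bot] at hx
      rw [algebraMap_intal_injective O (hx.trans (map_zero _).symm)]
      exact Ideal.zero_mem _)
  let P := RingHom.ker f
  let i : O ⧸ P →+* Intal O ⧸ Q := Ideal.quotientMap Q (algebraMap O (Intal O)) hQP.ge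
  let _ : Algebra (O ⧸ P) (Intal O ⧸ Q) := i.toAlgebra
  let _ : Algebra (O ⧸ P) F := (RingHom.kerLift f).toAlgebra
  have hi : Function.Injective i := Ideal.quotientMap_injective' hQP.le
  have h1 : Module.IsTorsionFree (O ⧸ P) (Intal O ⧸ Q) :=
    Module.isTorsionFree_iff_algebraMap_injective.mpr hi
  have h2 : Module.IsTorsionFree (O ⧸ P) F :=
    Module.isTorsionFree_iff_algebraMap_injective.mpr (RingHom.kerLift_injective f)
  have h3 : Algebra.IsIntegral (O ⧸ P) (Intal O ⧸ Q) := by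
    refine ⟨fun y => ?_⟩
    obtain ⟨z, rfl⟩ := Ideal.Quotient.mk_surjective y
    exact (Algebra.IsIntegral.isIntegral (R := O) z).map_of_comp_eq (Ideal.Quotient.mk P)
      (Ideal.Quotient.mk Q) rfl
  have h4 : Algebra.IsAlgebraic (O ⧸ P) (Intal O ⧸ Q) := Algebra.IsIntegral.isAlgebraic
  let R : Intal O ⧸ Q →ₐ[O ⧸ P] F := IsAlgClosed.lift
  refine ⟨(R : Intal O ⧸ Q →+* F).comp (Ideal.Quotient.mk Q), fun x => ?_⟩
  have := R.commutes (Ideal.Quotient.mk P x)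
  exact this

variable [CharZero S] [CharZero O]

/-- A lift of an injective homomorphism extends to the algebraic closures of the fraction fields. -/
theorem IsLift.exists_qBar_ringHom {resL : Intal S →+* Intal O} (h : IsLift res resL)
    (hres : Function.Injective res) :
    ∃ R : QBar S →+* QBar O, R.comp (intalToBar p S) = (intalToBar p O).comp (invMap p resL) ∧
      ∀ x, R (algebraMap S (QBar S) x) = algebraMap O (QBar O) (res x) := by
  have := isFractionRing_intal S
  have hinj : Function.Injective ((algebraMap (Intal O) (QBar O)).comp resL) :=
    Subtype.val_injective.comp (h.injective hres)
  refine ⟨IsFractionRing.lift hinj, invP_ringHom_ext fun a => ?_, fun x => ?_⟩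
  · rw [RingHom.comp_apply, RingHom.comp_apply, intalToBar_algebraMap, invMap_algebraMap,
      intalToBar_algebraMap]
    exact IsFractionRing.lift_algebraMap hinj a
  · rw [IsScalarTower.algebraMap_apply S (Intal S) (QBar S), IsFractionRing.lift_algebraMap,
      RingHom.comp_apply, h, ← IsScalarTower.algebraMap_apply]

/-- A root `α` of the characteristic polynomial of `x`, for which `α⁻¹` is a root of that of `x⁻¹`,
comes from a unit of `S^intal[1/p]`. -/
theorem exists_unit_of_isRoot [Algebra ℤ_[p] S] {G : Type*} [Group G] {T : G → S} {n : ℕ} {x : G}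
    {L : Type*} [Field L] {R : QBar S →+* L} {α : Lˣ}
    (h : (((pseudoCharpoly T n x).map (algebraMap (FractionRing S) (QBar S))).map R).IsRoot α)
    (h' : (((pseudoCharpoly T n x⁻¹).map (algebraMap (FractionRing S) (QBar S))).map R).IsRoot
      ((α⁻¹ : Lˣ) : L)) :
    ∃ a : (InvP p (Intal S))ˣ, R (intalToBar p S a) = α := by
  have key : ∀ (y : G) (γ : L),
      (((pseudoCharpoly T n y).map (algebraMap (FractionRing S) (QBar S))).map R).IsRoot γ →
      ∃ b : InvP p (Intal S), R (intalToBar p S b) = γ := by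
    intro y γ hγ
    have hm := (pseudoCharpoly_monic T n y).map (algebraMap (FractionRing S) (QBar S))
    have h1 : γ ∈ (((pseudoCharpoly T n y).map
        (algebraMap (FractionRing S) (QBar S))).map R).roots :=
      (Polynomial.mem_roots (hm.map R).ne_zero).mpr hγ
    rw [(IsAlgClosed.splits _).roots_map, Multiset.mem_map] at h1
    obtain ⟨β, hβ, rfl⟩ := h1
    have h2 : Polynomial.aeval β (pseudoCharpoly T n y) = 0 := by
      have := (Polynomial.mem_roots hm.ne_zero).mp hβ
      rwa [Polynomial.IsRoot, Polynomial.eval_map_algebraMap] at this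
    obtain ⟨b, hb⟩ := mem_range_intalToBar (p := p) n.factorial_ne_zero
      (isIntegral_factorial_mul_of_isRoot h2)
    exact ⟨b, by rw [hb]⟩
  obtain ⟨b, hb⟩ := key _ _ h
  obtain ⟨b', hb'⟩ := key _ _ h'
  have hbb : b * b' = 1 := by
    apply (R.injective.comp intalToBar_injective)
    simp only [Function.comp_apply, map_mul, map_one, hb, hb', Units.mul_inv]
  exact ⟨Units.mkOfMulEqOne b b' hbb, hb⟩

end Lifts

/-! ### Eigenvalues, ranks and extension of scalars -/

section MatrixLemmas

variable {F : Type*} [Field F]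

theorem isRoot_charpoly_iff {n : Type*} [Fintype n] [DecidableEq n] {X : Matrix n n F} {μ : F} :
    X.charpoly.IsRoot μ ↔ ∃ v : n → F, v ≠ 0 ∧ X.mulVec v = μ • v := by
  rw [Polynomial.IsRoot, Matrix.eval_charpoly, ← Matrix.exists_mulVec_eq_zero_iff]
  refine exists_congr fun v => and_congr_right fun _ => ?_
  rw [Matrix.sub_mulVec, sub_eq_zero, eq_comm]
  simp

theorem exists_eigenvector [IsAlgClosed F] {n : Type*} [Fintype n] [DecidableEq n] [Nonempty n]
    (X : Matrix n n F) : ∃ (μ : F) (v : n → F), v ≠ 0 ∧ X.mulVec v = μ • v := by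
  obtain ⟨μ, hμ⟩ := IsAlgClosed.exists_root X.charpoly (by
    rw [Matrix.charpoly_degree_eq_dim]
    exact_mod_cast Fintype.card_ne_zero)
  exact ⟨μ, isRoot_charpoly_iff.mp hμ⟩

/-- Conjugate matrices have the same characteristic polynomial; the equality of the sizes, obtained
from the trace of the identity, is part of the conclusion. -/
theorem charpoly_eq_of_mul_eq_mul [CharZero F] {d d' : ℕ} {X : Matrix (Fin d) (Fin d) F}
    {Y : Matrix (Fin d') (Fin d') F} {P : Matrix (Fin d) (Fin d') F} {Q : Matrix (Fin d') (Fin d) F}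
    (hPQ : P * Q = 1) (hQP : Q * P = 1) (h : X * P = P * Y) : X.charpoly = Y.charpoly := by
  have h1 := Matrix.trace_mul_comm P Q
  rw [hPQ, hQP, Matrix.trace_one, Matrix.trace_one, Fintype.card_fin, Fintype.card_fin,
    Nat.cast_inj] at h1
  subst h1
  have h2 : P * Y * Q = X := by rw [← h, mul_assoc, hPQ, mul_one]
  rw [← h2, Matrix.charpoly_mul_comm, ← mul_assoc, hQP, one_mul]

/-- A matrix of rank `k` has a nonzero `k × k` minor. -/
theorem exists_submatrix_det_ne_zero {m n : Type*} [Fintype m] [Fintype n] (X : Matrix m n F) :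
    ∃ (k : ℕ) (a : Fin k → m) (c : Fin k → n), k = X.rank ∧ (X.submatrix a c).det ≠ 0 := by
  obtain ⟨κ, a, ha, hspan, hli⟩ := exists_linearIndependent' F X.row
  have := Finite.of_injective a ha
  have := Fintype.ofFinite κ
  have h1 : (X.submatrix a id).rank = Fintype.card κ := LinearIndependent.rank_matrix hli
  have h1' : X.rank = Fintype.card κ := by
    rw [X.rank_eq_finrank_span_row, ← hspan, finrank_span_eq_card hli]
  obtain ⟨κ', c, hc, hspan', hli'⟩ := exists_linearIndependent' F (X.submatrix a id).col
  have := Finite.of_injective c hc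
  have := Fintype.ofFinite κ'
  have h2 : Fintype.card κ = Fintype.card κ' := by
    rw [← h1, Matrix.rank_eq_finrank_span_cols, ← hspan', finrank_span_eq_card hli']
  let e := (Fintype.equivFin κ).symm
  let e' : Fin (Fintype.card κ) ≃ κ' := (Fintype.equivFinOfCardEq h2.symm).symm
  refine ⟨Fintype.card κ, a ∘ e, c ∘ e', h1'.symm, ?_⟩
  have h3 : LinearIndependent F (X.submatrix a (c ∘ e')).col := hli'.comp e' e'.injective
  have h4 : LinearIndependent F (X.submatrix (a ∘ e) (c ∘ e')).col := by
    have := h3.map' (LinearEquiv.funCongrLeft F F e).toLinearMap (LinearEquiv.ker _)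
    exact this
  have h5 := Matrix.linearIndependent_cols_iff_isUnit.mp h4
  exact ((Matrix.isUnit_iff_isUnit_det _).mp h5).ne_zero

/-- The rank does not increase under specialization, since a nonzero minor of the specialization is
the image of a nonzero minor. -/
theorem rank_map_le_rank_map {B L : Type*} [CommRing B] [Field L] {m n : Type*} [Fintype m]
    [Fintype n] (X : Matrix m n B) {g : B →+* L} (hg : Function.Injective g) (h : B →+* F) :
    (X.map h).rank ≤ (X.map g).rank := by
  obtain ⟨k, a, c, hk, hdet⟩ := exists_submatrix_det_ne_zero (X.map h)
  have h1 : (X.submatrix a c).det ≠ 0 := by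
    intro h0
    apply hdet
    change (h.mapMatrix (X.submatrix a c)).det = 0
    rw [← RingHom.map_det, h0, map_zero]
  have h2 : ((X.map g).submatrix a c).det ≠ 0 := by
    change (g.mapMatrix (X.submatrix a c)).det ≠ 0
    rw [← RingHom.map_det]
    exact (map_ne_zero_iff g hg).mpr h1
  calc (X.map h).rank = k := hk.symm
    _ = ((X.map g).submatrix a c).rank := by rw [Matrix.rank_of_det_ne_zero h2, Fintype.card_fin]
    _ ≤ (X.map g).rank := Matrix.rank_submatrix_le _ _ _

end MatrixLemmas

/-! ### Segments of characters -/

section CharSegments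

variable {ℓ : ℕ} [Fact ℓ.Prime] {K : Type*} [Field K] [Algebra ℚ_[ℓ] K] [FiniteDimensional ℚ_[ℓ] K]
variable {F : Type*} [Field F]

/-- The twist of a function on the Weil group by the `a`-th power of `|Art_K⁻¹|_K`. -/
def charShift [CharZero F] (a : ℤ) (x : weilGroup ℓ K → F) : weilGroup ℓ K → F :=
  fun σ => x σ * normChar ℓ K F σ ^ a

theorem charShift_zero [CharZero F] (x : weilGroup ℓ K → F) : charShift 0 x = x := by
  funext σ
  simp [charShift]

theorem charShift_add [CharZero F] (a b : ℤ) (x : weilGroup ℓ K → F) :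
    charShift (a + b) x = charShift a (charShift b x) := by
  funext σ
  rw [charShift, charShift, charShift, zpow_add₀ (normChar_ne_zero ℓ K F σ)]
  ring

/-- The multiset of segments `(tr s_i, t_i)` attached to `⊕ Sp_{t_i}(s_i)`. -/
def segmentMultiset {ι : Type*} [Fintype ι] (t : ι → ℕ) {d : ι → ℕ}
    (s : ∀ i, weilGroup ℓ K →* Matrix (Fin (d i)) (Fin (d i)) F) :
    Multiset ((weilGroup ℓ K → F) × ℕ) :=
  Finset.univ.val.map fun i => (fun σ => (s i σ).trace, t i)

section

variable {ι : Type*} [Fintype ι] {t d : ι → ℕ}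
  {s : ∀ i, weilGroup ℓ K →* Matrix (Fin (d i)) (Fin (d i)) F}

theorem mem_segmentMultiset {x : (weilGroup ℓ K → F) × ℕ} :
    x ∈ segmentMultiset t s ↔ ∃ i, (fun σ => (s i σ).trace, t i) = x := by
  simp [segmentMultiset]

theorem pos_of_mem_segmentMultiset (ht : ∀ i, 0 < t i) {x : (weilGroup ℓ K → F) × ℕ}
    (hx : x ∈ segmentMultiset t s) : 0 < x.2 := by
  obtain ⟨i, rfl⟩ := mem_segmentMultiset.mp hx
  exact ht i

/-- Two finite families with the same multiset of values are reindexings of each other. -/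
theorem exists_equiv_of_map_univ_eq {α β γ : Type*} [Fintype α] [Fintype β] {f : α → γ} {g : β → γ}
    (h : (Finset.univ.val.map f : Multiset γ) = Finset.univ.val.map g) :
    ∃ e : α ≃ β, ∀ a, g (e a) = f a := by
  classical
  have hcard : ∀ c, Fintype.card {a // f a = c} = Fintype.card {b // g b = c} := by
    intro c
    have := congrArg (Multiset.count c) h
    rw [Multiset.count_map, Multiset.count_map] at this
    rw [Fintype.card_subtype, Fintype.card_subtype]
    simp only [eq_comm (a := c)] at this
    exact this
  let e : ∀ c, {a // f a = c} ≃ {b // g b = c} := fun c => Fintype.equivOfCardEq (hcard c)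
  exact ⟨Equiv.ofFiberEquiv e, fun a => Equiv.ofFiberEquiv_map e a⟩

theorem exists_equiv_of_segmentMultiset_eq {κ : Type*} [Fintype κ] {t' d' : κ → ℕ}
    {s' : ∀ i, weilGroup ℓ K →* Matrix (Fin (d' i)) (Fin (d' i)) F}
    (h : segmentMultiset t' s' = segmentMultiset t s) :
    ∃ e : κ ≃ ι, ∀ i, t' i = t (e i) ∧ ∀ σ, (s' i σ).trace = (s (e i) σ).trace := by
  obtain ⟨e, he⟩ := exists_equiv_of_map_univ_eq h
  refine ⟨e, fun i => ?_⟩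
  have := he i
  rw [Prod.mk.injEq] at this
  exact ⟨this.2.symm, fun σ => (congrFun this.1 σ).symm⟩

variable [CharZero F]

/-- The twist of a representation by the `a`-th power of `|Art_K⁻¹|_K`. -/
def normTwist {d : ℕ} (a : ℤ) (s : weilGroup ℓ K →* Matrix (Fin d) (Fin d) F) :
    weilGroup ℓ K →* Matrix (Fin d) (Fin d) F :=
  twistRep (weilVal_mul ℓ K) (Units.mk0 (resCard ℓ K : F) (resCard_cast_ne_zero ℓ K F) ^ (-a))
    (RingHom.id F) s

theorem normTwist_apply {d : ℕ} (a : ℤ) (s : weilGroup ℓ K →* Matrix (Fin d) (Fin d) F)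
    (σ : weilGroup ℓ K) : normTwist a s σ = normChar ℓ K F σ ^ a • s σ := by
  rw [normTwist, twistRep_apply, normChar_apply]
  have : (s σ).map (RingHom.id F) = s σ := Matrix.map_id _
  rw [this]
  congr 1
  rw [← zpow_mul, ← zpow_mul]
  simp only [Units.val_zpow_eq_zpow_val, Units.val_mk0]
  congr 1
  ring

theorem trace_normTwist {d : ℕ} (a : ℤ) (s : weilGroup ℓ K →* Matrix (Fin d) (Fin d) F) :
    (fun σ => (normTwist a s σ).trace) = charShift a fun σ => (s σ).trace := by
  funext σ
  rw [normTwist_apply, Matrix.trace_smul, smul_eq_mul, charShift, mul_comm]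

theorem sum_expandSegments_segmentMultiset (σ : weilGroup ℓ K) :
    (expandSegments charShift (segmentMultiset t s)).sum σ =
      ∑ i, ∑ j : Fin (t i), (s i σ).trace * normChar ℓ K F σ ^ (j : ℕ) := by
  rw [expandSegments, Multiset.sum_bind, segmentMultiset, Multiset.map_map]
  change (∑ i, ((Multiset.range (t i)).map fun j : ℕ =>
    charShift (j : ℤ) fun σ => (s i σ).trace).sum) σ = _
  rw [Finset.sum_apply]
  refine Finset.sum_congr rfl fun i _ => ?_
  rw [Fin.sum_univ_eq_sum_range fun j => (s i σ).trace * normChar ℓ K F σ ^ j]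
  change (∑ j ∈ Finset.range (t i), charShift (j : ℤ) fun σ => (s i σ).trace) σ = _
  rw [Finset.sum_apply]
  exact Finset.sum_congr rfl fun j _ => by rw [charShift, zpow_natCast]

variable [IsAlgClosed F]

theorem normTwist_isIrreducible {d : ℕ} {s : weilGroup ℓ K →* Matrix (Fin d) (Fin d) F}
    (hs : (matRep s).IsIrreducible) (a : ℤ) : (matRep (normTwist a s)).IsIrreducible :=
  twistRep_isIrreducible _ hs _ _

/-- All members of the segments of `⊕ Sp_{t_i}(s_i)` are irreducible characters. -/
theorem expandSegments_segmentMultiset_subset (hs : ∀ i, (matRep (s i)).IsIrreducible) :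
    ∀ x ∈ expandSegments charShift (segmentMultiset t s), x ∈ irrCharSet (weilGroup ℓ K) F := by
  intro x hx
  obtain ⟨y, hy, j, -, rfl⟩ := mem_expandSegments.mp hx
  obtain ⟨i, rfl⟩ := mem_segmentMultiset.mp hy
  exact ⟨d i, normTwist j (s i), normTwist_isIrreducible (hs i) _, (trace_normTwist _ _).symm⟩

/-- By linear independence of irreducible characters, the trace of `⊕ Sp_{t_i}(s_i)` determines the
multiset of all members of its segments. -/
theorem expandSegments_eq_of_trace_eq (hs : ∀ i, (matRep (s i)).IsIrreducible) {κ : Type*}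
    [Fintype κ] {t' d' : κ → ℕ} {s' : ∀ i, weilGroup ℓ K →* Matrix (Fin (d' i)) (Fin (d' i)) F}
    (hs' : ∀ i, (matRep (s' i)).IsIrreducible)
    (h : ∀ σ, ∑ i, ∑ j : Fin (t i), (s i σ).trace * normChar ℓ K F σ ^ (j : ℕ) =
      ∑ i, ∑ j : Fin (t' i), (s' i σ).trace * normChar ℓ K F σ ^ (j : ℕ)) :
    expandSegments charShift (segmentMultiset t s) =
      expandSegments charShift (segmentMultiset t' s') :=
  multiset_eq_of_sum_eq (expandSegments_segmentMultiset_subset hs)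
    (expandSegments_segmentMultiset_subset hs') (funext fun σ => by
      rw [sum_expandSegments_segmentMultiset, sum_expandSegments_segmentMultiset, h])

end

end CharSegments

/-! ### Weights -/

section Weights

/-- Multiplication by `q ^ a` changes the weight by `2 a`. The weights are compared through the
absolute value of one complex root of the minimal polynomial. -/
theorem IsWeilNumber.weight_eq {F : Type*} [Field F] [CharZero F] {q : ℕ} (hq : 1 < q) {w w' : ℤ}
    {α : F} (h : IsWeilNumber q w α) {a : ℤ} (h' : IsWeilNumber q w' ((q : F) ^ a * α)) :
    w' = w + 2 * a := by
  obtain ⟨z, hz⟩ := IsAlgClosed.exists_aeval_eq_zero ℂ (minpoly ℚ α)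
    (minpoly.degree_pos h.algebraic.isIntegral).ne'
  have h1 := h.norm_eq z hz
  have h2 : Polynomial.aeval ((q : ℂ) ^ a * z) (minpoly ℚ ((q : F) ^ a * α)) = 0 := by
    set P := (minpoly ℚ ((q : F) ^ a * α)).comp (Polynomial.C ((q : ℚ) ^ a) * Polynomial.X)
    have hP : minpoly ℚ α ∣ P := by
      refine minpoly.dvd ℚ α ?_
      rw [Polynomial.aeval_comp]
      simp
    obtain ⟨Q, hQ⟩ := hP
    have h3 : Polynomial.aeval z P = 0 := by rw [hQ, map_mul, hz, zero_mul]
    rw [Polynomial.aeval_comp] at h3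
    simpa using h3
  have h3 := h'.norm_eq _ h2
  have hq0 : (0 : ℝ) < q := by positivity
  rw [norm_mul, norm_zpow, Complex.norm_natCast, h1, ← Real.rpow_intCast, ← Real.rpow_add hq0] at h3
  have h4 : (a : ℝ) + w / 2 = w' / 2 :=
    (Real.rpow_right_inj hq0 (by exact_mod_cast hq.ne')).mp h3
  have h5 : (w' : ℝ) = w + 2 * a := by linarith
  exact_mod_cast h5

variable {ℓ : ℕ} [Fact ℓ.Prime] {K : Type*} [Field K] [Algebra ℚ_[ℓ] K] [FiniteDimensional ℚ_[ℓ] K]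
variable {F : Type*} [Field F] [CharZero F] {φ : weilGroup ℓ K}

/-- The eigenvectors of `s i g` give eigenvectors of `r g`. -/
theorem IsSegmentBasis.apply_sum_eq_smul {G F V : Type*} [Group G] [Field F] [AddCommGroup V]
    [Module F V] {χ : G →* F} {r : G →* Module.End F V} {N : Module.End F V} {ι : Type*}
    {t d : ι → ℕ} {s : ∀ i, G →* Matrix (Fin (d i)) (Fin (d i)) F}
    {b : Module.Basis (Σ i, Fin (d i) × Fin (t i)) F V} (h : IsSegmentBasis χ r N t d s b)
    {i : ι} (hi : 0 < t i) {α : F} {x : Fin (d i) → F} {g : G} (hα : (s i g).mulVec x = α • x) :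
    r g (∑ a, x a • b ⟨i, (a, ⟨0, hi⟩)⟩) = α • ∑ a, x a • b ⟨i, (a, ⟨0, hi⟩)⟩ := by
  simp only [map_sum, map_smul, h.act, pow_zero, one_mul, Finset.smul_sum, smul_smul]
  rw [Finset.sum_comm]
  refine Finset.sum_congr rfl fun a _ => ?_
  rw [← Finset.sum_smul]
  congr 1
  have := congrFun hα a
  rw [Matrix.mulVec, dotProduct, Pi.smul_apply, smul_eq_mul] at this
  rw [← this]
  exact Finset.sum_congr rfl fun a' _ => mul_comm _ _

theorem IsSegmentBasis.sum_ne_zero {G F V : Type*} [Group G] [Field F] [AddCommGroup V]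
    [Module F V] {χ : G →* F} {r : G →* Module.End F V} {N : Module.End F V} {ι : Type*}
    {t d : ι → ℕ} {s : ∀ i, G →* Matrix (Fin (d i)) (Fin (d i)) F}
    {b : Module.Basis (Σ i, Fin (d i) × Fin (t i)) F V} (_ : IsSegmentBasis χ r N t d s b)
    {i : ι} (hi : 0 < t i) {x : Fin (d i) → F} (hx : x ≠ 0) :
    ∑ a, x a • b ⟨i, (a, ⟨0, hi⟩)⟩ ≠ 0 := by
  intro h0
  refine hx (funext fun a => ?_)
  have hinj : Function.Injective fun a : Fin (d i) =>
      (⟨i, (a, ⟨0, hi⟩)⟩ : Σ i, Fin (d i) × Fin (t i)) := fun a a' haa => by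
    simpa using haa
  exact Fintype.linearIndependent_iff.mp (b.linearIndependent.comp _ hinj) x h0 a

/-- If `r` has finite image on `X`, so have the `s i`, as their matrices are blocks of those of `r`.
-/
theorem IsSegmentBasis.finite_image {G F V : Type*} [Group G] [Field F] [AddCommGroup V]
    [Module F V] {χ : G →* F} {r : G →* Module.End F V} {N : Module.End F V} {ι : Type*}
    {t d : ι → ℕ} {s : ∀ i, G →* Matrix (Fin (d i)) (Fin (d i)) F}
    {b : Module.Basis (Σ i, Fin (d i) × Fin (t i)) F V} (h : IsSegmentBasis χ r N t d s b)
    {X : Set G} (hX : (r '' X).Finite) {i : ι} (hi : 0 < t i) : (s i '' X).Finite := by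
  refine (hX.image fun f : Module.End F V => Matrix.of fun a' a =>
    b.repr (f (b ⟨i, (a, ⟨0, hi⟩)⟩)) ⟨i, (a', ⟨0, hi⟩)⟩).subset ?_
  rintro - ⟨g, hg, rfl⟩
  refine ⟨r g, ⟨g, hg, rfl⟩, ?_⟩
  ext a' a
  change b.repr (r g (b ⟨i, (a, ⟨0, hi⟩)⟩)) ⟨i, (a', ⟨0, hi⟩)⟩ = s i g a' a
  rw [h.act, map_sum, Finsupp.finsetSum_apply, Finset.sum_eq_single a']
  · simp
  · intro c _ hc
    simp [hc]
  · simp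

/-- In a pure representation of weight `w`, the eigenvalues of `φ` on the first summand of a copy of
`Sp_t(s)` have weight `w + t - 1`. -/
theorem WDData.IsPureOfWeight.isWeilNumber {κ : Type*} [Fintype κ] [DecidableEq κ]
    {ρ : WDData ℓ K κ F} {w : ℤ} (hρ : ρ.IsPureOfWeight φ w) {ι : Type*} {t d : ι → ℕ}
    {s : ∀ i, weilGroup ℓ K →* Matrix (Fin (d i)) (Fin (d i)) F}
    {b : Module.Basis (Σ i, Fin (d i) × Fin (t i)) F (κ → F)}
    (h : IsSegmentBasis (normChar ℓ K F) (matRep ρ.r) (Matrix.toLin' ρ.N) t d s b)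
    {i : ι} (hi : 0 < t i) {α : F} {x : Fin (d i) → F} (hx : x ≠ 0)
    (hα : (s i φ).mulVec x = α • x) : IsWeilNumber (resCard ℓ K) (w + (t i - 1)) α := by
  let y : κ → F := ∑ a, x a • b ⟨i, (a, ⟨0, hi⟩)⟩
  refine hρ (t i - 1) α y ?_ ?_ ?_
  · have hy : y ∈ LinearMap.ker (Matrix.toLin' ρ.N ^ (t i - 1 + 1)) ⊓
        LinearMap.range (Matrix.toLin' ρ.N ^ 0) := by
      refine ⟨?_, y, by simp⟩
      change (Matrix.toLin' ρ.N ^ (t i - 1 + 1)) y = 0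
      rw [map_sum]
      refine Finset.sum_eq_zero fun a _ => ?_
      rw [map_smul, h.mono_pow, dif_neg (by simp; omega), smul_zero]
    exact Submodule.mem_iSup_of_mem (t i - 1) (Submodule.mem_iSup_of_mem 0
      (Submodule.mem_iSup_of_mem (by push_cast; omega) hy))
  · intro hy
    refine hx (funext fun a => ?_)
    have := h.repr_eq_zero_of_mem_monodromyFiltration i hi hy a
    rw [map_sum, Finsupp.finsetSum_apply, Finset.sum_eq_single a] at this
    · simpa using this
    · intro a' _ ha'
      simp [ha']
    · simp
  · have : Matrix.toLin' (ρ.r φ) y = α • y := h.apply_sum_eq_smul hi hα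
    rw [this, sub_self]
    exact Submodule.zero_mem _

/-- A pure specialization forces the segments of the generic representation to be concentric: if
two of them start on the same line of twists, their eigenvalues of `φ` specialize to Weil numbers
whose weights determine the difference of their lengths. -/
theorem concentricSegments_of_isPure {L : Type*} [Field L] [CharZero L] [IsAlgClosed L]
    [IsAlgClosed F] {A : Type*} [CommRing A] {g : A →+* L} (hg : Function.Injective g)
    (hF : A →+* F) {ι : Type*} [Fintype ι] {t d : ι → ℕ} (ht : ∀ i, 0 < t i)
    {r : ∀ i, weilGroup ℓ K →* Matrix (Fin (d i)) (Fin (d i)) A}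
    (hr : ∀ i, (matRep (repMap g (r i))).IsIrreducible)
    {κ : Type*} [Fintype κ] [DecidableEq κ] {ρ : WDData ℓ K κ F} {w : ℤ}
    (hφ : weilVal ℓ K φ = 1) (hρ : ρ.IsPureOfWeight φ w)
    {b : Module.Basis (Σ i, Fin (d i) × Fin (t i)) F (κ → F)}
    (h : IsSegmentBasis (normChar ℓ K F) (matRep ρ.r) (Matrix.toLin' ρ.N) t d
      (fun i => repMap hF (r i)) b) :
    ConcentricSegments charShift (segmentMultiset t fun i => repMap g (r i)) := by
  intro x hx y hy a hxy
  obtain ⟨i, rfl⟩ := mem_segmentMultiset.mp hx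
  obtain ⟨j, rfl⟩ := mem_segmentMultiset.mp hy
  dsimp only at hxy ⊢
  rw [← trace_normTwist] at hxy
  have hsim := simRep_of_trace_eq (hr j) (normTwist_isIrreducible (hr i) a) (congrFun hxy)
  have hq := resCard_cast_ne_zero ℓ K L
  have hqF := resCard_cast_ne_zero ℓ K F
  set q := resCard ℓ K
  -- clear denominators in the comparison of `r j φ` with `q ^ (-a) • r i φ`
  obtain ⟨m, n, rfl⟩ : ∃ m n : ℕ, a = m - n := ⟨a.toNat, (-a).toNat, by omega⟩
  have hc : ((q : A) ^ m • r j φ).charpoly = ((q : A) ^ n • r i φ).charpoly := by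
    apply Polynomial.map_injective g hg
    rw [← Matrix.charpoly_map, ← Matrix.charpoly_map]
    have h1 : ((q : A) ^ m • r j φ).map g = (q : L) ^ m • repMap g (r j) φ := by
      rw [Matrix.map_smul' g _ _ (map_mul g), map_pow, map_natCast]; rfl
    have h2 : ((q : A) ^ n • r i φ).map g = (q : L) ^ m • normTwist (m - n) (repMap g (r i)) φ := by
      rw [Matrix.map_smul' g _ _ (map_mul g), map_pow, map_natCast, normTwist_apply, smul_smul,
        normChar_apply, hφ, ← zpow_natCast, ← zpow_natCast, ← zpow_mul, ← zpow_add₀ hq]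
      congr 2
      ring
    rw [h1, h2]
    obtain ⟨P, Q, hPQ, hQP, hP⟩ := hsim
    exact charpoly_eq_of_mul_eq_mul hPQ hQP (by rw [Matrix.smul_mul, hP, Matrix.mul_smul])
  have : Nonempty (Fin (d i)) := ((matRep_isIrreducible_iff _).mp (hr i)).1
  obtain ⟨α, v, hv, hα⟩ := exists_eigenvector (repMap hF (r i) φ)
  have hw1 := hρ.isWeilNumber h (ht i) hv hα
  obtain ⟨u, hu, huα⟩ : ∃ u, u ≠ 0 ∧ (repMap hF (r j) φ).mulVec u =
      ((q : F) ^ (-(m - n : ℤ)) * α) • u := by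
    have h1 : ((q : F) ^ n • repMap hF (r i) φ).charpoly.IsRoot ((q : F) ^ n * α) :=
      isRoot_charpoly_iff.mpr ⟨v, hv, by rw [Matrix.smul_mulVec, hα, smul_smul]⟩
    have h2 := congrArg (Polynomial.map hF) hc
    rw [← Matrix.charpoly_map, ← Matrix.charpoly_map, Matrix.map_smul' hF _ _ (map_mul hF),
      Matrix.map_smul' hF _ _ (map_mul hF), map_pow, map_pow, map_natCast] at h2
    have h3 : ((q : F) ^ m • repMap hF (r j) φ).charpoly.IsRoot ((q : F) ^ n * α) := by
      have : ((q : F) ^ m • repMap hF (r j) φ).charpoly =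
        ((q : F) ^ n • repMap hF (r i) φ).charpoly := h2
      rwa [this]
    obtain ⟨u, hu, hu'⟩ := isRoot_charpoly_iff.mp h3
    refine ⟨u, hu, ?_⟩
    rw [Matrix.smul_mulVec] at hu'
    have h4 := congrArg (fun z => ((q : F) ^ m)⁻¹ • z) hu'
    simp only [smul_smul, inv_mul_cancel₀ (pow_ne_zero m hqF), one_smul] at h4
    rw [h4, neg_sub, zpow_sub₀ hqF, zpow_natCast, zpow_natCast]
    congr 1
    field_simp
  have hw2 := hρ.isWeilNumber h (ht j) hu huα
  have := hw1.weight_eq (one_lt_resCard ℓ K) hw2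
  omega

end Weights

/-! ### Segment data attached to a pure Weil-Deligne representation -/

section Coefficients

variable {p : ℕ} [Fact p.Prime] {S : Type*} [CommRing S] [IsDomain S] [CharZero S] [Algebra ℤ_[p] S]

/-- All nonzero integers are invertible in `S^intal[1/p]`: those prime to `p` are units of `ℤ_p`. -/
theorem isUnit_natCast_invP {N : ℕ} (hN : N ≠ 0) : IsUnit (N : InvP p (Intal S)) := by
  have hN' : (N : QBar S) ≠ 0 := Nat.cast_ne_zero.mpr hN
  obtain ⟨b, hb⟩ := mem_range_intalToBar (p := p) hN (y := (N : QBar S)⁻¹) (by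
    rw [mul_inv_cancel₀ hN']; exact isIntegral_one)
  refine IsUnit.of_mul_eq_one b (intalToBar_injective ?_)
  rw [map_mul, map_natCast, hb, mul_inv_cancel₀ hN', map_one]

theorem map_units_zpow {A F : Type*} [CommRing A] [Field F] (h : A →+* F) (u : Aˣ) (n : ℤ) :
    h ((u ^ n : Aˣ) : A) = h u ^ n := by
  have : h ((u ^ n : Aˣ) : A) = ((Units.map (h : A →* F) (u ^ n) : Fˣ) : F) := rfl
  rw [this, map_zpow, Units.val_zpow_eq_zpow_val]
  rfl

end Coefficients

section Main

variable {ℓ p : ℕ} [Fact ℓ.Prime] {K : Type w} [Field K] [Algebra ℚ_[ℓ] K]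
  [FiniteDimensional ℚ_[ℓ] K] {φ : weilGroup ℓ K} {S : Type u} [CommRing S] [IsDomain S]
  [CharZero S]

/-- `r` is an unramified twist, by a unit of `S^intal[1/p]`, of an irreducible representation with
finite image defined over the algebraic numbers. -/
def IsTwistOfFinite {d : ℕ}
    (r : weilGroup ℓ K →* Matrix (Fin d) (Fin d) (InvP p (Intal S))) : Prop :=
  ∃ (a : (InvP p (Intal S))ˣ) (j : algebraicClosure ℚ (QBar S) →+* InvP p (Intal S))
    (s : weilGroup ℓ K →* Matrix (Fin d) (Fin d) (algebraicClosure ℚ (QBar S))),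
    (matRep s).IsIrreducible ∧ (Set.range s).Finite ∧ r = twistRep (weilVal_mul ℓ K) a j s

theorem repMap_twistRep {A B k : Type*} [CommRing A] [CommRing B] [CommRing k] (g : A →+* B) {d : ℕ}
    (a : Aˣ) (j : k →+* A) (s : weilGroup ℓ K →* Matrix (Fin d) (Fin d) k) :
    repMap g (twistRep (weilVal_mul ℓ K) a j s) =
      twistRep (weilVal_mul ℓ K) (Units.map (g : A →* B) a) (g.comp j) s :=
  MonoidHom.ext fun σ => twistRep_map _ a j s g σ

theorem trace_repMap {A B : Type*} [CommRing A] [CommRing B] (g : A →+* B) {d : ℕ}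
    (r : weilGroup ℓ K →* Matrix (Fin d) (Fin d) A) (σ : weilGroup ℓ K) :
    (repMap g r σ).trace = g (r σ).trace := by
  change ((r σ).map g).trace = _
  rw [Matrix.trace, Matrix.trace, map_sum]
  rfl

variable {d : ℕ} {r : weilGroup ℓ K →* Matrix (Fin d) (Fin d) (InvP p (Intal S))}

/-- A representation of this form remains irreducible over every field, in contrast to an arbitrary
generically irreducible representation. -/
theorem IsTwistOfFinite.isIrreducible (h : IsTwistOfFinite r) {F : Type*} [Field F]
    (g : InvP p (Intal S) →+* F) : (matRep (repMap g r)).IsIrreducible := by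
  obtain ⟨a, j, s, hs, -, rfl⟩ := h
  have : IsAlgClosed (algebraicClosure ℚ (QBar S)) :=
    (algebraicClosure.isAlgClosure ℚ (QBar S)).isAlgClosed
  rw [repMap_twistRep]
  exact twistRep_isIrreducible _ hs _ _

theorem IsTwistOfFinite.isIrreducibleFrobSemisimple (h : IsTwistOfFinite r) {F : Type*} [Field F]
    [CharZero F] (g : InvP p (Intal S) →+* F) :
    IsIrreducibleFrobSemisimple φ (repMap g r) := by
  refine ⟨h.isIrreducible g, ?_, ?_⟩
  · obtain ⟨a, j, s, -, hfin, rfl⟩ := h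
    rw [repMap_twistRep]
    exact twistRep_isSemisimple _ _ _ hfin _
  · obtain ⟨a, j, s, -, hfin, rfl⟩ := h
    rw [repMap_twistRep, inertiaGroup_eq]
    refine (hfin.image fun X => X.map (g.comp j)).subset ?_
    rintro - ⟨σ, hσ, rfl⟩
    refine ⟨s σ, ⟨σ, rfl⟩, ?_⟩
    rw [Set.mem_ofPred_eq] at hσ
    rw [twistRep_apply, hσ, zpow_zero, Units.val_one, one_smul]

variable [Fact p.Prime]

namespace SegmentData

variable {T : weilGroup ℓ K → S}

/-- The trace formula holds in `S^intal[1/p]`, so it may be mapped to any field. -/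
theorem TraceFormula.map [Algebra ℤ_[p] S] {D : SegmentData ℓ p K φ S} (h : D.TraceFormula T)
    {F : Type*} [Field F] [CharZero F] (g : InvP p (Intal S) →+* F) (σ : weilGroup ℓ K) :
    g (algebraMap (Intal S) _ (algebraMap S (Intal S) (T σ))) =
      ∑ i, ∑ j : Fin (D.t i), (repMap g (D.r i) σ).trace * normChar ℓ K F σ ^ (j : ℕ) := by
  have hq0 : resCard ℓ K ≠ 0 := by have := one_lt_resCard ℓ K; omega
  obtain ⟨q, hq⟩ := isUnit_natCast_invP (p := p) (S := S) hq0
  have key : algebraMap (Intal S) (InvP p (Intal S)) (algebraMap S (Intal S) (T σ)) =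
      ∑ i, ∑ j : Fin (D.t i), (D.r i σ).trace *
        ((q ^ (-weilVal ℓ K σ) : (InvP p (Intal S))ˣ) : InvP p (Intal S)) ^ (j : ℕ) := by
    apply intalToBar_injective
    simp only [map_sum, map_mul, map_pow, map_units_zpow, hq, map_natCast, intalToBar_algebraMap]
    exact h σ
  rw [key]
  simp only [map_sum, map_mul, map_pow, map_units_zpow, hq, map_natCast, trace_repMap,
    normChar_apply]

/-- Isomorphisms with `⊕ Sp_{t_i}(g ∘ r_i)` only depend on the segments of characters. -/
theorem iso_spSum_of_equiv {D D' : SegmentData ℓ p K φ S} {F : Type*} [Field F] [CharZero F]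
    [IsAlgClosed F] {g : InvP p (Intal S) →+* F} (hD : ∀ i, IsTwistOfFinite (D.r i))
    (hD' : ∀ i, IsTwistOfFinite (D'.r i)) (e : Fin D.m ≃ Fin D'.m)
    (he : ∀ i, D.t i = D'.t (e i) ∧ ∀ σ, (D.r i σ).trace = (D'.r (e i) σ).trace)
    {κ : Type*} [Fintype κ] [DecidableEq κ] {ρ : WDData ℓ K κ F} (h : ρ.Iso (D'.spSum g)) :
    ρ.Iso (D.spSum g) := by
  obtain ⟨b, hb⟩ := iso_directSum_sp_iff.mp h
  refine iso_directSum_sp_iff.mpr (hb.exists_transport e (fun i => (he i).1) fun i => ?_)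
  refine simRep_of_trace_eq ((hD i).isIrreducible g) ((hD' _).isIrreducible g) fun σ => ?_
  rw [trace_repMap, trace_repMap, (he i).2]

theorem matRep_isIrreducible (D : SegmentData ℓ p K φ S) (i : Fin D.m) :
    (matRep (repMap (intalToBar p S) (D.r i))).IsIrreducible := (D.irreducible i).irreducible

/-- Two concentric families of segments with the same trace agree up to a permutation. -/
theorem exists_equiv_of_concentricSegments [Algebra ℤ_[p] S] {D D' : SegmentData ℓ p K φ S}
    (h : D.TraceFormula T) (h' : D'.TraceFormula T)
    (hD : ConcentricSegments charShift
      (segmentMultiset D.t fun i => repMap (intalToBar p S) (D.r i)))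
    (hD' : ConcentricSegments charShift
      (segmentMultiset D'.t fun i => repMap (intalToBar p S) (D'.r i))) :
    ∃ e : Fin D.m ≃ Fin D'.m,
      ∀ i, D.t i = D'.t (e i) ∧ ∀ σ, (D.r i σ).trace = (D'.r (e i) σ).trace := by
  have hexp := expandSegments_eq_of_trace_eq D.matRep_isIrreducible D'.matRep_isIrreducible
    fun σ => (h.map (intalToBar p S) σ).symm.trans (h'.map (intalToBar p S) σ)
  have := eq_of_expandSegments_eq charShift_zero charShift_add hD hD'
    (fun s hs => pos_of_mem_segmentMultiset D.t_pos hs)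
    (fun s hs => pos_of_mem_segmentMultiset D'.t_pos hs) hexp
  obtain ⟨e, he⟩ := exists_equiv_of_segmentMultiset_eq this
  refine ⟨e, fun i => ⟨(he i).1, fun σ => intalToBar_injective ?_⟩⟩
  have := (he i).2 σ
  rwa [trace_repMap, trace_repMap] at this

end SegmentData

end Main

section Existence

variable {ℓ p : ℕ} [Fact ℓ.Prime] [Fact p.Prime] {K : Type w} [Field K] [Algebra ℚ_[ℓ] K]
  [FiniteDimensional ℚ_[ℓ] K] {φ : weilGroup ℓ K}

theorem repMap_id {A : Type*} [CommRing A] {d : ℕ} (r : weilGroup ℓ K →* Matrix (Fin d) (Fin d) A) :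
    repMap (RingHom.id A) r = r :=
  MonoidHom.ext fun σ => Matrix.map_id (r σ)

/-- The rank of the powers of the monodromy operator, as a function of the multiset of segments.
The dimension of a representation is recovered from its character as the value at `1`. -/
theorem sum_map_segmentMultiset {F : Type*} [Field F] [CharZero F] {ι : Type*} [Fintype ι]
    {t d : ι → ℕ} {s : ∀ i, weilGroup ℓ K →* Matrix (Fin (d i)) (Fin (d i)) F} (k : ℕ) :
    ((segmentMultiset t s).map fun x =>
      Function.invFun (Nat.cast : ℕ → F) (x.1 1) * (x.2 - k)).sum = ∑ i, d i * (t i - k) := by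
  rw [segmentMultiset, Multiset.map_map]
  refine Finset.sum_congr rfl fun i _ => ?_
  change Function.invFun (Nat.cast : ℕ → F) (s i 1).trace * (t i - k) = _
  rw [map_one, Matrix.trace_one, Fintype.card_fin, Function.leftInverse_invFun Nat.cast_injective]

/-- A specialization of a Weil-Deligne representation whose generic member has the segments
`(r_i, t_i)` has the segments obtained by specializing the `r_i`, provided it is pure: the traces
agree, and the ranks of the powers of the monodromy operator can only drop. -/
theorem segmentMultiset_eq_of_isPure {L F B A : Type*} [Field L] [CharZero L]
    [Field F] [CharZero F] [IsAlgClosed F] [CommRing B] [CommRing A] {n : ℕ}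
    {X : Matrix (Fin n) (Fin n) B} {g₁ : B →+* L} (hg₁ : Function.Injective g₁) {g₂ : B →+* F}
    {m : ℕ} {t d : Fin m → ℕ} (ht : ∀ i, 0 < t i)
    {r : ∀ i, weilGroup ℓ K →* Matrix (Fin (d i)) (Fin (d i)) A} {g : A →+* L} {h : A →+* F}
    (hr : ∀ i, (matRep (repMap h (r i))).IsIrreducible)
    {ρ₁ : WDData ℓ K (Fin n) L} (hρ₁ : ρ₁.N = X.map g₁)
    {b : Module.Basis (Σ i, Fin (d i) × Fin (t i)) L (Fin n → L)}
    (hb : IsSegmentBasis (normChar ℓ K L) (matRep ρ₁.r) (Matrix.toLin' ρ₁.N) t d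
      (fun i => repMap g (r i)) b)
    {ρ₂ : WDData ℓ K (Fin n) F} (hρ₂ : ρ₂.N = X.map g₂) (hφ : weilVal ℓ K φ = 1) {w : ℤ}
    (hw : ρ₂.IsPureOfWeight φ w) {ι : Type*} [Fintype ι] {t' d' : ι → ℕ} (ht' : ∀ i, 0 < t' i)
    {s' : ∀ i, weilGroup ℓ K →* Matrix (Fin (d' i)) (Fin (d' i)) F}
    (hs' : ∀ i, (matRep (s' i)).IsIrreducible)
    {b' : Module.Basis (Σ i, Fin (d' i) × Fin (t' i)) F (Fin n → F)}
    (hb' : IsSegmentBasis (normChar ℓ K F) (matRep ρ₂.r) (Matrix.toLin' ρ₂.N) t' d' s' b')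
    (htr : ∀ σ, (ρ₂.r σ).trace =
      ∑ i, ∑ j : Fin (t i), (repMap h (r i) σ).trace * normChar ℓ K F σ ^ (j : ℕ)) :
    segmentMultiset t (fun i => repMap h (r i)) = segmentMultiset t' s' := by
  -- the special segments, being those of a pure representation, are concentric
  have hconc : ConcentricSegments charShift (segmentMultiset t' s') := by
    have := concentricSegments_of_isPure (g := RingHom.id F) Function.injective_id (RingHom.id F)
      (r := s') ht' (by simpa only [repMap_id] using hs') hφ hw (b := b')
      (by simpa only [repMap_id] using hb')
    simpa only [repMap_id] using this
  refine eq_of_expandSegments_eq_of_rank_le charShift_zero charShift_add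
    (fun x => Function.invFun (Nat.cast : ℕ → F) (x 1)) hconc
    (fun s hs => pos_of_mem_segmentMultiset ht hs) (fun s hs => pos_of_mem_segmentMultiset ht' hs)
    ?_ ?_ fun k => ?_
  · intro x hx
    obtain ⟨i, rfl⟩ := mem_segmentMultiset.mp hx
    dsimp only
    rw [map_one, Matrix.trace_one, Fintype.card_fin, Function.leftInverse_invFun Nat.cast_injective]
    exact Fin.pos_iff_nonempty.mpr ((matRep_isIrreducible_iff _).mp (hs' i)).1
  · refine expandSegments_eq_of_trace_eq hr hs' fun σ => ?_
    rw [← htr, ← hb'.trace_eq]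
    exact (Matrix.trace_toLin'_eq _).symm
  · rw [sum_map_segmentMultiset, sum_map_segmentMultiset, ← hb.finrank_range_pow,
      ← hb'.finrank_range_pow, ← Matrix.toLin'_pow, ← Matrix.toLin'_pow, hρ₁, hρ₂]
    have h1 : (X.map g₁) ^ k = (X ^ k).map g₁ := (map_pow g₁.mapMatrix X k).symm
    have h2 : (X.map g₂) ^ k = (X ^ k).map g₂ := (map_pow g₂.mapMatrix X k).symm
    rw [h1, h2]
    exact rank_map_le_rank_map (X ^ k) hg₁ g₂

variable {S : Type u} [CommRing S] [IsDomain S] [CharZero S] [Algebra ℤ_[p] S]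
  {O : Type v} [CommRing O] [IsDomain O] [CharZero O]
  {res : S →+* O} {n : ℕ} {T : weilGroup ℓ K → S}
  {ρ : WDData ℓ K (Fin n) (InvP p O)}

/-- The segments of `(r, N)` over `Q̄(O)` are defined over `S^intal[1/p]`. The third assertion
places the eigenvalues of `φ` on the `r_i`, and their inverses, among the roots of the
characteristic polynomials of `φ` and `φ⁻¹`. -/
theorem exists_segmentData (hφ : weilVal ℓ K φ = 1) (hres : Function.Injective res) (hn : 1 ≤ n)
    (hρ : ρ.IsWeilDeligne)
    (htr : ∀ σ, algebraMap O (InvP p O) (res (T σ)) = (ρ.r σ).trace)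
    {resL : Intal S →+* Intal O} (hresL : IsLift res resL) :
    ∃ D : SegmentData ℓ p K φ S, D.TraceFormula T ∧ (∀ i, IsTwistOfFinite (D.r i)) ∧
      (∀ i (β : QBar S) (x : Fin (D.d i) → QBar S), x ≠ 0 →
        (repMap (intalToBar p S) (D.r i) φ).mulVec x = β • x →
        Polynomial.aeval β (pseudoCharpoly T n φ) = 0 ∧
          Polynomial.aeval β⁻¹ (pseudoCharpoly T n φ⁻¹) = 0) ∧
      ∃ ρ₁, WDData.IsFrobSemisimplification φ
          (ρ.map (invLift p (algebraMap O (QBar O)))) ρ₁ ∧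
        ρ₁.Iso (D.spSum ((intalToBar p O).comp (invMap p resL))) := by
  obtain ⟨R, hR, hRS⟩ := hresL.exists_qBar_ringHom (p := p) hres
  set g : InvP p (Intal S) →+* QBar O := (intalToBar p O).comp (invMap p resL) with hg
  have hRg : ∀ x, R (intalToBar p S x) = g x := fun x => RingHom.congr_fun hR x
  have hρL := hρ.map (invLift p (algebraMap O (QBar O)))
  obtain ⟨ρ₁, hρ₁⟩ := hρL.exists_frobSemisimplification hφ
  have hρ₁W := hρ₁.isWeilDeligne hφ hρL
  have hss := hρ₁.semisimple hφ
  have htr₁ : ∀ σ, (ρ₁.r σ).trace = R (algebraMap S (QBar S) (T σ)) := by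
    intro σ
    rw [hρ₁.trace_eq hφ hρL, hRS, ← invLift_algebraMap (p := p), htr]
    exact trace_repMap _ _ _
  obtain ⟨ι, _, t, d, s, b, ht, hs, hb⟩ := exists_isSegmentBasis hφ hρ₁W hss
  have : Nonempty (Fin n) := ⟨⟨0, hn⟩⟩
  -- eigenvalues of `φ` are roots of the characteristic polynomial
  have hroot : ∀ (α : (QBar O)ˣ) (y : Fin n → QBar O), y ≠ 0 →
      matRep ρ₁.r φ y = (α : QBar O) • y →
      (((pseudoCharpoly T n φ).map (algebraMap (FractionRing S) (QBar S))).map R).IsRoot α ∧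
      (((pseudoCharpoly T n φ⁻¹).map (algebraMap (FractionRing S) (QBar S))).map R).IsRoot
        ((α⁻¹ : (QBar O)ˣ) : QBar O) := by
    intro α y hy hα
    rw [Polynomial.map_map, Polynomial.map_map]
    refine isRoot_pseudoCharpoly (r := ρ₁.r) (fun σ => ?_) hss hy hα
    rw [htr₁, RingHom.comp_apply, ← IsScalarTower.algebraMap_apply]
  -- each `s i` descends to `S^intal[1/p]`
  have hdesc : ∀ i, ∃ (d' : ℕ) (r : weilGroup ℓ K →* Matrix (Fin d') (Fin d') (InvP p (Intal S))),
      IsTwistOfFinite r ∧ SimRep (repMap g r) (s i) := by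
    intro i
    have : Nonempty (Fin (d i)) := ((matRep_isIrreducible_iff _).mp (hs i)).1
    obtain ⟨α, x, hx, hα⟩ := exists_eigenvector (s i φ)
    have hα0 : α ≠ 0 := by
      rintro rfl
      have hinv : s i φ⁻¹ * s i φ = 1 := by rw [← map_mul, inv_mul_cancel, map_one]
      have := congrArg (s i φ⁻¹).mulVec hα
      rw [Matrix.mulVec_mulVec, hinv, Matrix.one_mulVec, zero_smul, Matrix.mulVec_zero] at this
      exact hx this
    obtain ⟨α, rfl⟩ : ∃ u : (QBar O)ˣ, (u : QBar O) = α := ⟨Units.mk0 α hα0, rfl⟩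
    obtain ⟨h1, h2⟩ := hroot α _ (hb.sum_ne_zero (ht i) hx) (hb.apply_sum_eq_smul (ht i) hα)
    obtain ⟨a, ha⟩ := exists_unit_of_isRoot (p := p) h1 h2
    obtain ⟨j⟩ := nonempty_ringHom_algebraicClosure_rat p S
    have : IsAlgClosed (algebraicClosure ℚ (QBar S)) :=
      (algebraicClosure.isAlgClosure ℚ (QBar S)).isAlgClosed
    have hfin : (s i '' {σ | weilVal ℓ K σ = 0}).Finite := by
      refine hb.finite_image ?_ (ht i)
      have := hρ₁W.finite_inertia
      rw [inertiaGroup_eq] at this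
      refine (this.image fun X => Matrix.toLin' X).subset ?_
      rintro - ⟨σ, hσ, rfl⟩
      exact ⟨ρ₁.r σ, ⟨σ, hσ, rfl⟩, rfl⟩
    obtain ⟨d', s', hs', hfin', hsim⟩ :=
      exists_descent (weilVal_mul ℓ K) hφ (hs i) hfin hx hα (g.comp j)
    refine ⟨d', twistRep (weilVal_mul ℓ K) a j s', ⟨a, j, s', hs', hfin', rfl⟩, ?_⟩
    have hu : Units.map (g : InvP p (Intal S) →* QBar O) a = α := Units.ext ((hRg a).symm.trans ha)
    rw [repMap_twistRep, hu]
    exact hsim.symm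
  choose d' r hr hsim using hdesc
  -- the segments are ordered by their lengths
  let e₀ : Fin (Fintype.card ι) ≃ ι := (Fintype.equivFin ι).symm
  let e : Fin (Fintype.card ι) ≃ ι := (Tuple.sort (t ∘ e₀)).trans e₀
  have hmono : Monotone fun i => t (e i) := Tuple.monotone_sort (t ∘ e₀)
  have hι : Nonempty ι := by
    obtain ⟨i⟩ := b.index_nonempty
    exact ⟨i.1⟩
  let D : SegmentData ℓ p K φ S :=
    { m := Fintype.card ι
      m_pos := Fintype.card_pos
      t := fun i => t (e i)
      t_pos := fun i => ht _
      t_mono := hmono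
      d := fun i => d' (e i)
      r := fun i => r (e i)
      irreducible := fun i => (hr _).isIrreducibleFrobSemisimple _ }
  obtain ⟨b', hb'⟩ : ∃ b', IsSegmentBasis (normChar ℓ K (QBar O)) (matRep ρ₁.r)
      (Matrix.toLin' ρ₁.N) D.t D.d (fun i => repMap g (D.r i)) b' :=
    hb.exists_transport e (fun _ => rfl) fun i => hsim (e i)
  refine ⟨D, fun σ => R.injective ?_, fun i => hr _, fun i β x hx hβ => ?_, ρ₁, hρ₁,
    iso_directSum_sp_iff.mpr ⟨b', hb'⟩⟩
  · rw [← htr₁]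
    have h1 := hb'.trace_eq σ
    simp only [trace_repMap, normChar_apply] at h1
    simp only [map_sum, map_mul, map_pow, hRg, map_zpow₀, map_natCast]
    rw [← h1]
    exact (Matrix.trace_toLin'_eq _).symm
  · have hβ0 : β ≠ 0 := by
      rintro rfl
      have hinv : repMap (intalToBar p S) (D.r i) φ⁻¹ * repMap (intalToBar p S) (D.r i) φ = 1 := by
        rw [← map_mul, inv_mul_cancel, map_one]
      have := congrArg (repMap (intalToBar p S) (D.r i) φ⁻¹).mulVec hβ
      rw [Matrix.mulVec_mulVec, hinv, Matrix.one_mulVec, zero_smul, Matrix.mulVec_zero] at this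
      exact hx this
    have hgR : (repMap (intalToBar p S) (D.r i) φ).map R = repMap g (D.r i) φ := by
      ext a c
      exact hRg _
    have hx' : R ∘ x ≠ 0 := by
      intro h0
      refine hx (funext fun a => R.injective ?_)
      rw [Pi.zero_apply, map_zero]
      exact congrFun h0 a
    have hβ' : (repMap g (D.r i) φ).mulVec (R ∘ x) = R β • (R ∘ x) := by
      ext a
      rw [← hgR, ← RingHom.map_mulVec, hβ]
      simp
    have hu : R β ≠ 0 := (map_ne_zero R).mpr hβ0
    obtain ⟨h1, h2⟩ := hroot (Units.mk0 (R β) hu) _ (hb'.sum_ne_zero (D.t_pos i) hx')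
      (hb'.apply_sum_eq_smul (D.t_pos i) hβ')
    have key : ∀ (P : Polynomial (FractionRing S)) (γ : QBar S),
        ((P.map (algebraMap (FractionRing S) (QBar S))).map R).IsRoot (R γ) →
        Polynomial.aeval γ P = 0 := by
      intro P γ h
      rw [Polynomial.IsRoot, Polynomial.eval_map_apply] at h
      rw [← Polynomial.eval_map_algebraMap]
      exact (map_eq_zero R).mp h
    refine ⟨key _ _ h1, key _ _ ?_⟩
    rw [map_inv₀]
    simpa using h2

end Existence

/-! ### Existence, integrality and uniqueness -/

section Final

variable {ℓ p : ℕ} [Fact ℓ.Prime] [Fact p.Prime] {K : Type w} [Field K] [Algebra ℚ_[ℓ] K]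
  [FiniteDimensional ℚ_[ℓ] K] {φ : weilGroup ℓ K}
  {S : Type u} [CommRing S] [IsDomain S] [CharZero S]
  {O : Type v} [CommRing O] [IsDomain O] [CharZero O]
  {res : S →+* O} {n : ℕ} {T : weilGroup ℓ K → S} {ρ : WDData ℓ K (Fin n) (InvP p O)}
  {f : O →+* PadicAlgCl p} {resL : Intal S →+* Intal O} {fL : Intal O →+* PadicAlgCl p}

/-- If the specialization of `⊕ Sp_{t_i}(r_i)` at a point is the Frobenius-semisimplification of a
pure representation, then the segments `(r_i, t_i)` are concentric. -/
theorem SegmentData.concentricSegments (hφ : weilVal ℓ K φ = 1) {F : Type*} [Field F] [CharZero F]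
    [IsAlgClosed F] {κ : Type*} [Fintype κ] [DecidableEq κ] {ρ ρ₂ : WDData ℓ K κ F}
    (hpure : ρ.IsPure φ) (hρ₂ : WDData.IsFrobSemisimplification φ ρ ρ₂)
    {D : SegmentData ℓ p K φ S} {h : InvP p (Intal S) →+* F} (hiso : ρ₂.Iso (D.spSum h)) :
    ConcentricSegments charShift
      (segmentMultiset D.t fun i => repMap (intalToBar p S) (D.r i)) := by
  obtain ⟨ρ₂', hρ₂', w, hw⟩ := hpure
  obtain rfl := hρ₂'.unique hρ₂
  obtain ⟨b, hb⟩ := iso_directSum_sp_iff.mp hiso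
  exact concentricSegments_of_isPure (g := intalToBar p S) intalToBar_injective h (t := D.t)
    (r := D.r) D.t_pos D.matRep_isIrreducible hφ hw (b := b) hb

theorem mem_range_algebraMap_of_isIntegral {y : InvP p (Intal S)}
    (hy : IsIntegral S (intalToBar p S y)) :
    y ∈ (algebraMap (Intal S) (InvP p (Intal S))).range :=
  ⟨⟨_, hy⟩, intalToBar_injective (intalToBar_algebraMap _)⟩

theorem mulVec_one_of_dim_one {A : Type*} [CommRing A] {d : ℕ} (hd : d = 1)
    {X : Matrix (Fin d) (Fin d) A} (a b : Fin d) :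
    X.mulVec (fun _ => 1) = X a b • fun _ => 1 := by
  subst hd
  ext c
  rw [Subsingleton.elim a c, Subsingleton.elim b c]
  simp [Matrix.mulVec, dotProduct, Subsingleton.elim c 0]

theorem map_inv_of_dim_one {G F : Type*} [Group G] [Field F] {d : ℕ} (hd : d = 1)
    {r : G →* Matrix (Fin d) (Fin d) F} {g : G} (a b : Fin d) : r g⁻¹ a b = (r g a b)⁻¹ := by
  subst hd
  rw [Subsingleton.elim a 0, Subsingleton.elim b 0]
  have h1 : r g⁻¹ * r g = 1 := by rw [← map_mul, inv_mul_cancel, map_one]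
  have h2 := congrFun (congrFun h1 0) 0
  rw [Matrix.mul_apply, Fin.sum_univ_one, Matrix.one_apply_eq] at h2
  exact eq_inv_of_mul_eq_one_left h2

/-- If a character has finite image on inertia and `σ` is in the coset of `ψ ^ m` modulo inertia,
then its value at `σ` is the product of a root of unity and the `m`-th power of its value at `ψ`, so
that it is integral if the latter is. -/
theorem isIntegral_of_character {S : Type*} [CommRing S] [IsDomain S] {d : ℕ} (hd : d = 1)
    {r : weilGroup ℓ K →* Matrix (Fin d) (Fin d) (QBar S)}
    (hfin : (r '' (inertiaGroup ℓ K : Set (weilGroup ℓ K))).Finite) {ψ σ : weilGroup ℓ K}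
    (hψ : ∀ a b, IsIntegral S (r ψ a b)) {m : ℕ} (hσ : weilVal ℓ K (ψ ^ (-m : ℤ) * σ) = 0) (a b) :
    IsIntegral S (r σ a b) := by
  subst hd
  have hab : ∀ c : Fin 1, c = 0 := fun c => Subsingleton.elim _ _
  rw [hab a, hab b]
  let χ : weilGroup ℓ K →* QBar S :=
    { toFun := fun τ => r τ 0 0
      map_one' := by simp
      map_mul' := fun x y => by simp [Matrix.mul_apply] }
  have h1 : ∀ τ, weilVal ℓ K τ = 0 → IsIntegral S (χ τ) := by
    intro τ hτ
    have hτ' : ∀ k : ℕ, weilVal ℓ K (τ ^ k) = 0 := fun k => by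
      have := valuation_zpow (weilVal_mul ℓ K) τ k
      rwa [zpow_natCast, hτ, mul_zero] at this
    have hne : χ τ ≠ 0 := by
      have : χ τ⁻¹ * χ τ = 1 := by rw [← map_mul, inv_mul_cancel, map_one]
      exact right_ne_zero_of_mul_eq_one this
    have hmaps : ∀ k : ℕ, χ τ ^ k ∈ (fun X : Matrix (Fin 1) (Fin 1) (QBar S) => X 0 0) ''
        (r '' (inertiaGroup ℓ K : Set (weilGroup ℓ K))) := fun k => by
      rw [inertiaGroup_eq, ← map_pow]
      exact ⟨_, ⟨τ ^ k, hτ' k, rfl⟩, rfl⟩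
    obtain ⟨k, -, l, -, hkl, h⟩ := Set.infinite_univ.exists_ne_map_eq_of_mapsTo
      (f := fun k : ℕ => χ τ ^ k) (fun k _ => hmaps k) (hfin.image _)
    have key : ∀ k l : ℕ, k < l → χ τ ^ k = χ τ ^ l → IsIntegral S (χ τ) := by
      intro k l hkl h
      refine IsIntegral.of_pow (n := l - k) (by omega) ?_
      have : χ τ ^ (l - k) = 1 := by
        rw [pow_sub₀ _ hne hkl.le, ← h, mul_inv_cancel₀ (pow_ne_zero k hne)]
      rw [this]
      exact isIntegral_one
    rcases lt_or_gt_of_ne hkl with h2 | h2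
    · exact key k l h2 h
    · exact key l k h2 h.symm
  have h2 : σ = ψ ^ m * (ψ ^ (-m : ℤ) * σ) := by
    rw [← mul_assoc, ← zpow_natCast, ← zpow_add]; simp
  change IsIntegral S (χ σ)
  rw [h2, map_mul, map_pow]
  exact ((hψ 0 0).pow m).mul (h1 _ hσ)

variable [Algebra ℤ_[p] S]

/-- The segments of a Weil-Deligne representation with a pure specialization, both at the generic
and at the pure point. -/
theorem exists_segmentData_of_isPure (hφ : weilVal ℓ K φ = 1) (hres : Function.Injective res)
    (hn : 1 ≤ n) (hρ : ρ.IsWeilDeligne)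
    (htr : ∀ σ, algebraMap O (InvP p O) (res (T σ)) = (ρ.r σ).trace)
    (hpure : (ρ.map (invLift p f)).IsPure φ) (hresL : IsLift res resL) (hfL : IsLiftToField f fL) :
    ∃ D : SegmentData ℓ p K φ S, D.TraceFormula T ∧ (∀ i, IsTwistOfFinite (D.r i)) ∧
      (∀ i (β : QBar S) (x : Fin (D.d i) → QBar S), x ≠ 0 →
        (repMap (intalToBar p S) (D.r i) φ).mulVec x = β • x →
        Polynomial.aeval β (pseudoCharpoly T n φ) = 0 ∧
          Polynomial.aeval β⁻¹ (pseudoCharpoly T n φ⁻¹) = 0) ∧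
      ConcentricSegments charShift
        (segmentMultiset D.t fun i => repMap (intalToBar p S) (D.r i)) ∧
      (∃ ρ₁, WDData.IsFrobSemisimplification φ
          (ρ.map (invLift p (algebraMap O (QBar O)))) ρ₁ ∧
        ρ₁.Iso (D.spSum ((intalToBar p O).comp (invMap p resL)))) ∧
      ∃ ρ₂, WDData.IsFrobSemisimplification φ (ρ.map (invLift p f)) ρ₂ ∧
        ρ₂.Iso (D.spSum ((invLift p fL).comp (invMap p resL))) := by
  obtain ⟨D, hD, hDtw, hDroot, ρ₁, hρ₁, hiso₁⟩ := exists_segmentData hφ hres hn hρ htr hresL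
  have hρF := hρ.map (invLift p f)
  obtain ⟨ρ₂, hρ₂, w, hw⟩ := id hpure
  have hN₁ : ρ₁.N = ρ.N.map (invLift p (algebraMap O (QBar O))) := by
    obtain ⟨s, u, -, -, -, -, -, h⟩ := hρ₁; exact h
  have hN₂ : ρ₂.N = ρ.N.map (invLift p f) := by
    obtain ⟨s, u, -, -, -, -, -, h⟩ := hρ₂; exact h
  obtain ⟨b, hb⟩ := iso_directSum_sp_iff.mp hiso₁
  obtain ⟨ι, _, t, d, s, b', ht, hs, hb'⟩ :=
    exists_isSegmentBasis hφ (hρ₂.isWeilDeligne hφ hρF) (hρ₂.semisimple hφ)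
  set h : InvP p (Intal S) →+* PadicAlgCl p := (invLift p fL).comp (invMap p resL) with hh
  have htr₂ : ∀ σ, (ρ₂.r σ).trace = ∑ i, ∑ j : Fin (D.t i),
      (repMap h (D.r i) σ).trace * normChar ℓ K (PadicAlgCl p) σ ^ (j : ℕ) := by
    intro σ
    rw [hρ₂.trace_eq hφ hρF, ← hD.map h]
    have h1 : ((ρ.map (invLift p f)).r σ).trace = f (res (T σ)) := by
      rw [← invLift_algebraMap (p := p), htr]
      exact trace_repMap _ _ _
    rw [h1, hh, RingHom.comp_apply, invMap_algebraMap, invLift_algebraMap, hresL, hfL]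
  have heq := segmentMultiset_eq_of_isPure (invLift_injective (algebraMap_qBar_injective O)) D.t_pos
    (fun i => (hDtw i).isIrreducible h) hN₁ hb hN₂ hφ hw ht hs hb' htr₂
  obtain ⟨e, he⟩ := exists_equiv_of_segmentMultiset_eq heq
  have hiso₂ : ρ₂.Iso (D.spSum h) := iso_directSum_sp_iff.mpr
    (hb'.exists_transport e (fun i => (he i).1) fun i =>
      simRep_of_trace_eq ((hDtw i).isIrreducible h) (hs _) (he i).2)
  exact ⟨D, hD, hDtw, hDroot, SegmentData.concentricSegments hφ hpure hρ₂ hiso₂,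
    ⟨ρ₁, hρ₁, hiso₁⟩, ρ₂, hρ₂, hiso₂⟩

end Final

end

theorem mainTheorem2 (ℓ p : ℕ) [Fact ℓ.Prime] [Fact p.Prime] (hℓp : ℓ ≠ p)
    (K : Type w) [Field K] [Algebra ℚ_[ℓ] K] [FiniteDimensional ℚ_[ℓ] K]
    (φ : weilGroup ℓ K) (hφ : weilVal ℓ K φ = 1)
    (S : Type u) [CommRing S] [IsDomain S] [CharZero S] [Algebra ℤ_[p] S]
    (O : Type v) [CommRing O] [IsDomain O] [CharZero O] [Algebra ℤ_[p] O]
    (res : S →ₐ[ℤ_[p]] O) (hres : Function.Injective res)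
    (n : ℕ) (hn : 1 ≤ n) (T : weilGroup ℓ K → S) (hT : IsPseudorep T n)
    (ρ : WDData ℓ K (Fin n) (InvP p O)) (hρ : ρ.IsWeilDeligne)
    (htr : ∀ σ, algebraMap O (InvP p O) (res (T σ)) = (ρ.r σ).trace)
    (f : O →ₐ[ℤ_[p]] PadicAlgCl p)
    (hpure : (ρ.map (invLift p (f : O →+* PadicAlgCl p))).IsPure φ) :
    ∃ D : SegmentData ℓ p K φ S,
      -- (1)
      D.TraceFormula T ∧
      -- (2)
      SegmentData.Rigidity.{u, v, w} D T n ∧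
      -- (3)
      ((∀ k, IsIntegral S ((pseudoCharpoly T n φ).coeff k)) →
        ∀ i, D.d i = 1 →
          (∀ σ, 0 ≤ weilVal ℓ K σ → ∀ a b,
            D.r i σ a b ∈ (algebraMap (Intal S) (InvP p (Intal S))).range) ∧
          ((∀ k, IsIntegral S ((pseudoCharpoly T n φ⁻¹).coeff k)) → ∀ σ a b,
            D.r i σ a b ∈ (algebraMap (Intal S) (InvP p (Intal S))).range)) ∧
      -- uniqueness
      ∀ E : SegmentData ℓ p K φ S, E.TraceFormula T → SegmentData.Rigidity.{u, v, w} E T n →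
        ∃ h : E.m = D.m, (∀ i, D.t (Fin.cast h i) = E.t i) ∧
          ∃ s : Equiv.Perm (Fin D.m),
            (∀ i, RepIso (repMap (intalToBar p S) (D.r (s (Fin.cast h i))))
              (repMap (intalToBar p S) (E.r i))) ∧
            ∀ i, D.t (s i) = D.t i := by
  have hresR : Function.Injective (res : S →+* O) := hres
  obtain ⟨resL, hresL⟩ := exists_isLift hresR
  obtain ⟨fL, hfL⟩ := exists_isLiftToField (f : O →+* PadicAlgCl p)
  obtain ⟨D, hD, hDtw, hDroot, hDconc, -, -⟩ :=
    exists_segmentData_of_isPure hφ hresR hn hρ htr hpure hresL hfL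
  refine ⟨D, hD, ?_, fun hint i hi => ?_, fun E hE hErig => ?_⟩
  · intro O' _ _ _ _ res' ρ' f' hres' hρ' htr' hpure' resL' fL' hresL' hfL'
    have hresR' : Function.Injective (res' : S →+* O') := hres'
    obtain ⟨D', hD', hDtw', -, hDconc', ⟨ρ₁, hρ₁, hiso₁⟩, ρ₂, hρ₂, hiso₂⟩ :=
      exists_segmentData_of_isPure hφ hresR' hn hρ' htr' hpure' hresL' hfL'
    -- the segments obtained from `(r', N')` are those of `D` up to a permutation
    obtain ⟨e, he⟩ := SegmentData.exists_equiv_of_concentricSegments hD hD' hDconc hDconc'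
    exact ⟨⟨ρ₁, hρ₁, SegmentData.iso_spSum_of_equiv hDtw hDtw' e he hiso₁⟩,
      ρ₂, hρ₂, SegmentData.iso_spSum_of_equiv hDtw hDtw' e he hiso₂⟩
  · have hfin := (D.irreducible i).finite_inertia
    have hroot : ∀ a b, Polynomial.aeval (intalToBar p S (D.r i φ a b)) (pseudoCharpoly T n φ) = 0 ∧
        Polynomial.aeval (intalToBar p S (D.r i φ⁻¹ a b)) (pseudoCharpoly T n φ⁻¹) = 0 := by
      intro a b
      have h1 := hDroot i _ (fun _ => 1) (fun h => one_ne_zero (congrFun h a))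
        (mulVec_one_of_dim_one hi a b)
      have h2 : intalToBar p S (D.r i φ⁻¹ a b) = (intalToBar p S (D.r i φ a b))⁻¹ :=
        map_inv_of_dim_one hi (r := repMap (intalToBar p S) (D.r i)) a b
      rw [h2]
      exact h1
    have hpos : ∀ σ, 0 ≤ weilVal ℓ K σ → ∀ a b,
        D.r i σ a b ∈ (algebraMap (Intal S) (InvP p (Intal S))).range := by
      intro σ hσ a b
      refine mem_range_algebraMap_of_isIntegral ?_
      exact isIntegral_of_character hi hfin (ψ := φ) (m := (weilVal ℓ K σ).toNat)
        (fun a b => isIntegral_of_isRoot_of_coeff (hroot a b).1 hint) (by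
          rw [weilVal_mul, valuation_zpow (weilVal_mul ℓ K), hφ]; omega) a b
    refine ⟨hpos, fun hint' σ a b => ?_⟩
    · rcases le_total 0 (weilVal ℓ K σ) with hσ | hσ
      · exact hpos σ hσ a b
      · refine mem_range_algebraMap_of_isIntegral ?_
        exact isIntegral_of_character hi hfin (ψ := φ⁻¹) (m := (-weilVal ℓ K σ).toNat)
          (fun a b => isIntegral_of_isRoot_of_coeff (hroot a b).2 hint') (by
            rw [weilVal_mul, valuation_zpow (weilVal_mul ℓ K), valuation_inv (weilVal_mul ℓ K), hφ]
            omega) a b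
  · obtain ⟨-, ρ₂, hρ₂, hiso₂⟩ := hErig O res ρ f hres hρ htr hpure resL fL hresL hfL
    -- at the pure point `f`, the segments of `E` are those of a pure representation
    have hEconc := SegmentData.concentricSegments hφ hpure hρ₂ hiso₂
    obtain ⟨e, he⟩ := SegmentData.exists_equiv_of_concentricSegments hE hD hEconc hDconc
    have hm : E.m = D.m := by simpa using Fintype.card_congr e
    let c : Fin E.m ≃ Fin D.m := finCongr hm
    have hmono : Monotone fun i => D.t (c i) := fun i j hij => D.t_mono hij
    -- both families of lengths are increasing and agree up to a permutation, so they are equal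
    have ht : (fun i => D.t (c i)) = E.t := by
      have h1 : E.t = (fun i => D.t (c i)) ∘ (e.trans c.symm) := by
        funext i
        simp [(he i).1]
      have h2 := Tuple.unique_monotone (f := fun i => D.t (c i)) (σ := 1) (τ := e.trans c.symm)
        hmono (h1 ▸ E.t_mono)
      rw [h1]
      exact h2
    refine ⟨hm, congrFun ht, c.symm.trans e, fun i => ?_, fun i => ?_⟩
    · have h1 : (c.symm.trans e) (Fin.cast hm i) = e i := by
        change e (c.symm (c i)) = e i
        rw [Equiv.symm_apply_apply]
      rw [h1]
      refine simRep_of_trace_eq (D.matRep_isIrreducible _) (E.matRep_isIrreducible _) fun σ => ?_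
      rw [trace_repMap, trace_repMap, (he i).2]
    · have := congrFun ht (c.symm i)
      simp only [Equiv.apply_symm_apply] at this
      rw [this, (he _).1]
      rfl
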